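/- **Notation.** Greek indices run over $0,\dots,3$; repeated upper and lower indices are summed; $p_0,\dots,p_3$ is the standard basis of $\mathbb R^{1,3}$ and $\eta=\mathrm{diag}(1,-1,-1,-1)$ raises and lowers indices. Let $p\in\{1,2\}$ and let $E=W^{1,p}_0([0,1],\mathbb R^{1,3})$ be the space of absolutely continuous curves $\sigma$ on $[0,1]$ with $\sigma(0)=0$ and $\dot\sigma\in L_p$, normed by $\|\sigma\|=\|\dot\sigma\|_{L_p}$; let $E_0=\{u\in E: u(1)=0\}$. For $\sigma\in E$ and $r\in[0,1]$ put $\sigma^r(t)=\sigma(rt)$. Let $\gamma^\mu\in M_4(\mathbb C)$ be Dirac matrices: $\gamma^\mu\gamma^\nu+\gamma^\nu\gamma^\mu=2\eta^{\mu\nu}I_4$, $\gamma_0^*=\gamma_0$, $\gamma_k^*=-\gamma_k$ for $k=1,2,3$. For $\varphi=\sum_{\alpha=1}^4\varphi_\alpha\otimes g_\alpha\in\mathbb C^N\otimes\mathbb C^4$ (with $\{g_\alpha\}$ the standard basis of $\mathbb C^4$) let $\overline\varphi\gamma_\mu\varphi=\sum_\alpha((I_N\otimes\gamma_0\gamma_\mu)\varphi)_\alpha\otimes\varphi_\alpha^*\in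 M_N(\mathbb C)$. Let $pr_{su(N)}$ be the orthogonal projection of $u(N)$ onto $su(N)$, $X\mapsto X-\frac1N\mathrm{tr}(X)I_N$, and let $m\in\mathbb R$. Let $A=A_\mu dx^\mu$ be a $C^\infty$ $su(N)$-valued 1-form on $\mathbb R^{1,3}$ and let $\psi\in C^\infty(\mathbb R^{1,3},\mathbb C^N\otimes\mathbb C^4)$. Put $F_{\mu\nu}=\partial_\mu A_\nu-\partial_\nu A_\mu+[A_\mu,A_\nu]$ and $\nabla_\mu\phi=\partial_\mu\phi+[A_\mu,\phi]$. For $\sigma\in E$ and $0\le s\le t\le1$ let $U^A_{t,s}(\sigma)\in M_N(\mathbb C)$ be the solution, absolutely continuous in $t$ and in $s$, of $\frac{d}{dt}U^A_{t,s}=-A_\mu(\sigma(t))\dot\sigma^\mu(t)U^A_{t,s}$ and $\frac{d}{ds}U^A_{t,s}=U^A_{t,s}A_\mu(\sigma(s))\dot\sigma^\mu(s)$ (almost everywhere), $U^A_{t,t}=I_N$. Put $U^A_{0,1}=(U^A_{1,0})^{-1}$ and $\Psi^{A,\psi}(\sigma)=(U^A_{0,1}(\sigma)\otimes I_4)\psi(\sigma(1))$.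 *Endpoint derivatives.* Let $V$ be a finite-dimensional real vector space and $f\in C^1(E,V)$. If for every $\sigma\in E$ there are $V$-valued Borel measures $\nu_0,\dots,\nu_3$ on $[0,1]$ with $f'(\sigma)u=\sum_\mu\int_0^1u^\mu(t)\,\nu_\mu(dt)$ for all $u\in E$, then $D_\mu f(\sigma)=\nu_\mu(\{1\})$. *Lévy d'Alembertian.* Let $f\in C^2(E,V)$. If for every $\sigma\in E$ there are $V$-valued coefficients $Q^V_{\mu\nu}\in L_1([0,1]^2)$, $Q^L_{\mu\nu}=Q^L_{\nu\mu}\in L_1[0,1]$, $Q^S_{\mu\nu}=-Q^S_{\nu\mu}\in L_\infty[0,1]$ such that for all $u,v\in E_0$ $$f''(\sigma)(u,v)=\int_0^1\!\!\int_0^1Q^V_{\mu\nu}(t,s)u^\mu(t)v^\nu(s)\,dt\,ds+\int_0^1Q^L_{\mu\nu}(t)u^\mu(t)v^\nu(t)\,dt+\frac12\int_0^1Q^S_{\mu\nu}(t)(\dot u^\mu(t)v^\nu(t)+\dot v^\mu(t)u^\nu(t))\,dt,$$ then $\Box_Lf(\sigma)=\int_0^1\eta^{\mu\nu}Q^L_{\mu\nu}(t)\,dt$.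 **Theorem.** The pair $(A,\psi)$ is a solution of the Yang–Mills–Dirac equations $$(I_N\otimes\gamma^\mu)(\partial_\mu+A_\mu\otimes I_4)\psi+im\psi=0,\qquad \nabla^\mu F_{\mu\nu}=-pr_{su(N)}(i\,\overline\psi\gamma_\nu\psi)\quad\text{on }\mathbb R^{1,3}$$ if and only if $\Psi^{A,\psi}$ is in the domain of each $D_\mu$, $U^A_{1,0}$ is in the domain of $\Box_L$, and for all $\sigma\in E$ $$(I_N\otimes\gamma^\mu)D_\mu\Psi^{A,\psi}(\sigma)+im\Psi^{A,\psi}(\sigma)=0,$$ $$\Box_LU^A_{1,0}(\sigma)=U^A_{1,0}(\sigma)\,pr_{su(N)}\Bigl(i\int_0^1\overline{\Psi^{A,\psi}(\sigma^r)}\gamma_\nu\Psi^{A,\psi}(\sigma^r)\,\dot\sigma^\nu(r)\,dr\Bigr).$$ -/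

import Mathlib

open MeasureTheory Set
open scoped ContDiff ENNReal Matrix

noncomputable section

namespace LevyYM

/-! ### Minkowski space and curves of Sobolev class -/

/-- Underlying vector space of `ℝ^{1,3}`, with Greek indices in `Fin 4`. -/
abbrev Mink : Type := EuclideanSpace ℝ (Fin 4)

/-- The vectors `p_μ` of the standard basis. -/
def basisVec (μ : Fin 4) : Mink := EuclideanSpace.single μ 1

/-- The Minkowski metric `diag(1,-1,-1,-1)`; the matrices `(η_{μν})` and `(η^{μν})` coincide. -/
def eta (μ ν : Fin 4) : ℝ := if μ = ν then (if μ = 0 then 1 else -1) else 0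

/-- Lebesgue measure on `[0,1]`. -/
abbrev leb : Measure ℝ := volume.restrict (Icc (0 : ℝ) 1)

/-- Extension of a function on `[0,1]` to `ℝ`, constant on either side. -/
abbrev extendI {X : Type*} (f : unitInterval → X) : ℝ → X := IccExtend (zero_le_one' ℝ) f

theorem ae_differentiableAt_of_ac {f : ℝ → Mink} (hf : AbsolutelyContinuousOnInterval f 0 1) :
    ∀ᵐ t ∂leb, DifferentiableAt ℝ f t := by
  rw [ae_restrict_iff' measurableSet_Icc]
  filter_upwards [hf.boundedVariationOn.ae_differentiableAt_of_mem_uIcc] with t ht h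
  exact ht (by rwa [uIcc_of_le zero_le_one])

/-- `W₀^{1,p}([0,1], ℝ^{1,3})`: absolutely continuous curves starting at the origin whose
derivative is in `L_p`. -/
def curveSubmodule (p : ℝ≥0∞) : Submodule ℝ (unitInterval → Mink) where
  carrier := {σ | σ 0 = 0 ∧ AbsolutelyContinuousOnInterval (extendI σ) 0 1 ∧
    MemLp (deriv (extendI σ)) p leb}
  zero_mem' := by
    have h : extendI (0 : unitInterval → Mink) = fun _ => 0 := rfl
    refine ⟨rfl, ?_, ?_⟩
    · rw [h]
      exact (LipschitzWith.const (0 : Mink)).lipschitzOnWith.absolutelyContinuousOnInterval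
    · rw [h]
      simp
  add_mem' := by
    rintro σ τ ⟨h0, h1, h2⟩ ⟨k0, k1, k2⟩
    have h : extendI (σ + τ) = extendI σ + extendI τ := rfl
    refine ⟨by simp [h0, k0], ?_, ?_⟩
    · rw [h]
      exact h1.add k1
    · refine (h2.add k2).ae_eq ?_
      filter_upwards [ae_differentiableAt_of_ac h1, ae_differentiableAt_of_ac k1] with t a b
      rw [h]
      exact (deriv_add a b).symm
  smul_mem' := by
    rintro c σ ⟨h0, h1, h2⟩
    have h : extendI (c • σ) = c • extendI σ := rfl
    refine ⟨by simp [h0], ?_, ?_⟩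
    · rw [h]
      exact h1.const_smul c
    · refine (h2.const_smul c).ae_eq ?_
      filter_upwards [ae_differentiableAt_of_ac h1] with t a
      rw [h]
      exact (deriv_const_smul c a).symm

/-- The space `E = W₀^{1,p}([0,1], ℝ^{1,3})` of curves. -/
def Curve (p : ℝ≥0∞) : Type := curveSubmodule p

namespace Curve

variable {p : ℝ≥0∞}

instance instAddCommGroup : AddCommGroup (Curve p) :=
  inferInstanceAs (AddCommGroup (curveSubmodule p))

instance instModule : Module ℝ (Curve p) := inferInstanceAs (Module ℝ (curveSubmodule p))

/-- The point `σ(t)` for `t ∈ [0,1]` (constant continuation outside `[0,1]`). -/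
def val (σ : Curve p) : ℝ → Mink := extendI σ.1

/-- The velocity `dσ/dt`, meaningful for almost all `t ∈ [0,1]`. -/
def vel (σ : Curve p) : ℝ → Mink := deriv σ.val

theorem memLp_vel (σ : Curve p) : MemLp σ.vel p leb := σ.2.2.2

/-- The velocity as a linear map to `L_p`. -/
def velL (p : ℝ≥0∞) : Curve p →ₗ[ℝ] Lp Mink p leb where
  toFun σ := (memLp_vel σ).toLp σ.vel
  map_add' σ τ := by
    rw [← MemLp.toLp_add]
    apply MemLp.toLp_congr
    filter_upwards [ae_differentiableAt_of_ac σ.2.2.1, ae_differentiableAt_of_ac τ.2.2.1]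
      with t a b
    exact deriv_add a b
  map_smul' c σ := by
    rw [RingHom.id_apply, ← MemLp.toLp_const_smul]
    apply MemLp.toLp_congr
    filter_upwards [ae_differentiableAt_of_ac σ.2.2.1] with t a
    exact deriv_const_smul c a

theorem velL_injective : Function.Injective (velL p) := by
  rw [injective_iff_map_eq_zero]
  intro σ h
  have h1 : σ.vel =ᵐ[leb] 0 := by
    have h2 : (memLp_vel σ).toLp σ.vel = (MemLp.zero' (p := p) (μ := leb)).toLp
      (fun _ : ℝ => (0 : Mink)) := h
    exact (MemLp.toLp_eq_toLp_iff _ _).1 h2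
  have h3 : ∀ᵐ t, t ∈ uIcc (0 : ℝ) 1 → HasDerivAt σ.val 0 t := by
    have h4 : ∀ᵐ t ∂leb, HasDerivAt σ.val 0 t := by
      filter_upwards [h1, ae_differentiableAt_of_ac σ.2.2.1] with t a b
      have := b.hasDerivAt
      have e : deriv (extendI σ.1) t = 0 := a
      rwa [e] at this
    rw [uIcc_of_le zero_le_one]
    exact (ae_restrict_iff' measurableSet_Icc).1 h4
  obtain ⟨C, hC⟩ := AbsolutelyContinuousOnInterval.const_of_ae_hasDerivAt_zero σ.2.2.1 h3
  rw [uIcc_of_le zero_le_one] at hC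
  have key : ∀ t : unitInterval, σ.1 t = C := fun t => by
    rw [← hC t t.2]
    exact (IccExtend_val _ _ _).symm
  have hC0 : C = 0 := by rw [← key 0, σ.2.1]
  exact Subtype.ext (funext fun t => (key t).trans hC0)

/-- The norm is `‖σ‖ = ‖dσ/dt‖_{L_p}`. -/
instance instNormedAddCommGroup [Fact (1 ≤ p)] : NormedAddCommGroup (Curve p) :=
  NormedAddCommGroup.induced (Curve p) (Lp Mink p leb) (velL p) velL_injective

instance instNormedSpace [Fact (1 ≤ p)] : NormedSpace ℝ (Curve p) :=
  NormedSpace.induced ℝ (Curve p) (Lp Mink p leb) (velL p)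

theorem shrink_mem (σ : Curve p) (r : unitInterval) :
    (fun t : unitInterval => σ.1 (r * t)) ∈ curveSubmodule p := by
  obtain ⟨h0, h1, h2⟩ := σ.2
  have hext : ∀ t ∈ Icc (0 : ℝ) 1,
      extendI (fun t : unitInterval => σ.1 (r * t)) t = σ.val (r * t) := by
    intro t ht
    have hrt : (r : ℝ) * t ∈ Icc (0 : ℝ) 1 :=
      ⟨mul_nonneg r.2.1 ht.1, mul_le_one₀ r.2.2 ht.1 ht.2⟩
    rw [extendI, IccExtend_of_mem _ _ ht, val, extendI, IccExtend_of_mem _ _ hrt]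
    rfl
  refine ⟨by simpa using h0, ?_, ?_⟩
  · rw [absolutelyContinuousOnInterval_iff] at h1 ⊢
    intro ε hε
    obtain ⟨δ, hδ, H⟩ := h1 ε hε
    refine ⟨δ, hδ, ?_⟩
    rintro ⟨n, I⟩ ⟨hI, hd⟩ hlen
    simp only [uIcc_of_le (zero_le_one' ℝ)] at hI
    have hr0 : (0 : ℝ) ≤ r := r.2.1
    have hle : ∑ i ∈ Finset.range n, dist ((r : ℝ) * (I i).1) (r * (I i).2) < δ := by
      refine lt_of_le_of_lt (Finset.sum_le_sum fun i _ => ?_) hlen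
      rw [Real.dist_eq, Real.dist_eq, ← mul_sub, abs_mul, abs_of_nonneg hr0]
      exact mul_le_of_le_one_left (abs_nonneg _) r.2.2
    have hm : ((n, fun i => ((r : ℝ) * (I i).1, (r : ℝ) * (I i).2)) : ℕ × (ℕ → ℝ × ℝ)) ∈
        AbsolutelyContinuousOnInterval.disjWithin 0 1 := by
      refine ⟨fun i hi => ?_, fun i hi j hj hij => ?_⟩
      · simp only [uIcc_of_le (zero_le_one' ℝ)]
        obtain ⟨a, b⟩ := hI i hi
        exact ⟨⟨mul_nonneg hr0 a.1, mul_le_one₀ r.2.2 a.1 a.2⟩,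
          ⟨mul_nonneg hr0 b.1, mul_le_one₀ r.2.2 b.1 b.2⟩⟩
      · have hij' := hd hi hj hij
        simp only [Function.onFun] at hij' ⊢
        rcases hr0.eq_or_lt with h | h
        · simp [← h]
        · rw [Set.disjoint_left] at hij' ⊢
          have key : ∀ a b x : ℝ, x ∈ uIoc (r * a) (r * b) → x / r ∈ uIoc a b := by
            intro a b x hx
            rw [mem_uIoc] at hx ⊢
            rcases hx with hx | hx
            · exact Or.inl ⟨(lt_div_iff₀' h).2 hx.1, (div_le_iff₀' h).2 hx.2⟩
            · exact Or.inr ⟨(lt_div_iff₀' h).2 hx.1, (div_le_iff₀' h).2 hx.2⟩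
          exact fun x hx hx' => hij' (key _ _ _ hx) (key _ _ _ hx')
    have := H _ hm hle
    refine lt_of_eq_of_lt (Finset.sum_congr rfl fun i hi => ?_) this
    obtain ⟨a, b⟩ := hI i hi
    rw [hext _ a, hext _ b]
    rfl
  · rcases r.2.1.eq_or_lt with h | h
    · have hr : r = 0 := Subtype.ext h.symm
      have : extendI (fun t : unitInterval => σ.1 (r * t)) = fun _ => σ.1 0 := by
        funext t
        simp [extendI, IccExtend, hr]
      rw [this]
      simp
    · have hcomp : MemLp (fun t => σ.vel (r * t)) p leb := by
        have hmeas : Measurable fun t : ℝ => (r : ℝ) * t := measurable_const_mul _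
        have hmap : Measure.map (fun t : ℝ => (r : ℝ) * t) leb ≤
            ENNReal.ofReal |(r : ℝ)⁻¹| • leb := by
          have hsub : Icc (0 : ℝ) 1 ⊆ (fun t : ℝ => (r : ℝ) * t) ⁻¹' Icc 0 1 := fun t ht =>
            ⟨mul_nonneg r.2.1 ht.1, mul_le_one₀ r.2.2 ht.1 ht.2⟩
          calc Measure.map (fun t : ℝ => (r : ℝ) * t) leb
              ≤ Measure.map (fun t : ℝ => (r : ℝ) * t)
                  (volume.restrict ((fun t : ℝ => (r : ℝ) * t) ⁻¹' Icc 0 1)) :=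
                Measure.map_mono (Measure.restrict_mono hsub le_rfl) hmeas
            _ = (Measure.map (fun t : ℝ => (r : ℝ) * t) volume).restrict (Icc 0 1) :=
                (Measure.restrict_map hmeas measurableSet_Icc).symm
            _ = ENNReal.ofReal |(r : ℝ)⁻¹| • leb := by
                rw [Real.map_volume_mul_left h.ne', Measure.restrict_smul]
        have h3 : MemLp σ.vel p (Measure.map (fun t : ℝ => (r : ℝ) * t) leb) :=
          (h2.smul_measure ENNReal.ofReal_ne_top).mono_measure hmap
        exact h3.comp_of_map hmeas.aemeasurable
      refine (hcomp.const_smul (r : ℝ)).ae_eq ?_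
      have hIoo : ∀ᵐ t ∂leb, t ∈ Ioo (0 : ℝ) 1 := by
        rw [leb, ← Measure.restrict_congr_set Ioo_ae_eq_Icc]
        exact ae_restrict_mem measurableSet_Ioo
      filter_upwards [hIoo] with t ht
      have e : extendI (fun t : unitInterval => σ.1 (r * t)) =ᶠ[nhds t]
          fun t => σ.val (r * t) := by
        filter_upwards [Ioo_mem_nhds ht.1 ht.2] with s hs
        exact hext s ⟨hs.1.le, hs.2.le⟩
      rw [e.deriv_eq]
      exact (deriv_comp_mul_left (r : ℝ) σ.val t).symm

/-- The curve `σ^r`, `σ^r(t) = σ(rt)`. -/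
def shrink (r : unitInterval) (σ : Curve p) : Curve p :=
  ⟨fun t => σ.1 (r * t), shrink_mem σ r⟩

end Curve

/-! ### Gauge fields, spinors and the Yang-Mills-Dirac equations -/

/-- `M_N(ℂ)`. -/
abbrev Mat (N : ℕ) : Type := Matrix (Fin N) (Fin N) ℂ

/-- `ℂ^N ⊗ ℂ^4`: the vector `∑_{a,α} φ_{aα} e_a ⊗ g_α` is stored as the matrix `(φ_{aα})`, whose
`α`-th column is `φ_α ∈ ℂ^N`. -/
abbrev Spinor (N : ℕ) : Type := Matrix (Fin N) (Fin 4) ℂ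

attribute [local instance] Matrix.frobeniusNormedAddCommGroup Matrix.frobeniusNormedSpace

/-- `su(N)`. -/
def su (N : ℕ) : Set (Mat N) := {X | Xᴴ = -X ∧ X.trace = 0}

/-- The orthogonal projection of `u(N)` onto `su(N)`, with respect to `tr(X* Y)`:
it removes the component along the scalar matrices. -/
def prSu {N : ℕ} (X : Mat N) : Mat N := X - (X.trace / N) • (1 : Mat N)

theorem prSu_mem {N : ℕ} {X : Mat N} (hX : Xᴴ = -X) : prSu X ∈ su N := by
  rcases Nat.eq_zero_or_pos N with rfl | hN
  · exact ⟨Subsingleton.elim _ _, by simp [Matrix.trace]⟩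
  have hN' : (N : ℂ) ≠ 0 := by exact_mod_cast hN.ne'
  have ht : star X.trace = -X.trace := by
    rw [← Matrix.trace_conjTranspose, hX, Matrix.trace_neg]
  refine ⟨?_, ?_⟩
  · rw [prSu, Matrix.conjTranspose_sub, Matrix.conjTranspose_smul, hX, Matrix.conjTranspose_one,
      star_div₀, ht]
    simp only [star_natCast, neg_div, neg_smul]
    abel
  · simp [prSu, Matrix.trace_sub, Matrix.trace_smul, hN']

theorem trace_conjTranspose_mul_sub_prSu {N : ℕ} (X : Mat N) {Y : Mat N} (hY : Y ∈ su N) :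
    (Yᴴ * (X - prSu X)).trace = 0 := by
  simp [prSu, Matrix.trace_conjTranspose, hY.2]

/-- Partial derivative `∂_μ f`. -/
def pd {V : Type*} [NormedAddCommGroup V] [NormedSpace ℝ V] (μ : Fin 4) (f : Mink → V) :
    Mink → V := fun x => fderiv ℝ f x (basisVec μ)

/-- Covariant derivative `∇_μ φ = ∂_μ φ + [A_μ, φ]`. -/
def covD {N : ℕ} (A : Fin 4 → Mink → Mat N) (μ : Fin 4) (φ : Mink → Mat N) : Mink → Mat N :=
  fun x => pd μ φ x + (A μ x * φ x - φ x * A μ x)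

/-- Curvature `F_{μν} = ∂_μ A_ν - ∂_ν A_μ + [A_μ, A_ν]`. -/
def curv {N : ℕ} (A : Fin 4 → Mink → Mat N) (μ ν : Fin 4) : Mink → Mat N :=
  fun x => pd μ (A ν) x - pd ν (A μ) x + (A μ x * A ν x - A ν x * A μ x)

/-- Dirac matrices `γ^0, …, γ^3`. -/
structure IsDirac (γ : Fin 4 → Matrix (Fin 4) (Fin 4) ℂ) : Prop where
  clifford : ∀ μ ν, γ μ * γ ν + γ ν * γ μ = (2 * eta μ ν) • (1 : Matrix (Fin 4) (Fin 4) ℂ)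
  conj_zero : (γ 0)ᴴ = γ 0
  conj_space : ∀ μ, μ ≠ 0 → (γ μ)ᴴ = -γ μ

/-- `γ_μ = η_{μν} γ^ν`. -/
def lowerGamma (γ : Fin 4 → Matrix (Fin 4) (Fin 4) ℂ) (μ : Fin 4) : Matrix (Fin 4) (Fin 4) ℂ :=
  ∑ ν, eta μ ν • γ ν

/-- `(I_N ⊗ M) φ` for `M ∈ M_4(ℂ)`. -/
def spinAct {N : ℕ} (M : Matrix (Fin 4) (Fin 4) ℂ) (φ : Spinor N) : Spinor N :=
  Matrix.of fun a α => ∑ β, M α β * φ a β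

/-- `(X ⊗ I_4) φ` for `X ∈ M_N(ℂ)`. -/
def colorAct {N : ℕ} (X : Mat N) (φ : Spinor N) : Spinor N :=
  Matrix.of fun a α => ∑ b, X a b * φ b α

/-- The operator `φ̄ γ_μ φ = ∑_α ((I_N ⊗ γ_0 γ_μ) φ)_α ⊗ φ_α^*` on `ℂ^N`. -/
def bilin {N : ℕ} (γ : Fin 4 → Matrix (Fin 4) (Fin 4) ℂ) (μ : Fin 4) (φ : Spinor N) : Mat N :=
  Matrix.of fun a b =>
    ∑ α, spinAct (lowerGamma γ 0 * lowerGamma γ μ) φ a α * star (φ b α)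

/-- The Yang-Mills-Dirac equations
`(I_N ⊗ γ^μ)(∂_μ + A_μ ⊗ I_4)ψ + i m ψ = 0`, `∇^μ F_{μν} = -pr_{su(N)}(i ψ̄ γ_ν ψ)`. -/
def IsYangMillsDirac {N : ℕ} (γ : Fin 4 → Matrix (Fin 4) (Fin 4) ℂ) (m : ℝ)
    (A : Fin 4 → Mink → Mat N) (ψ : Mink → Spinor N) : Prop :=
  (∀ x, (∑ μ, spinAct (γ μ) (pd μ ψ x + colorAct (A μ x) (ψ x))) +
      (Complex.I * m) • ψ x = 0) ∧
  (∀ x ν, ∑ μ, ∑ κ, eta μ κ • covD A κ (curv A μ ν) x =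
      -prSu (Complex.I • bilin γ ν (ψ x)))

/-! ### Parallel transport -/

section

variable {N : ℕ} {p : ℝ≥0∞}

/-- `A_μ(σ(t)) dσ^μ/dt`. -/
def connAlong (A : Fin 4 → Mink → Mat N) (σ : Curve p) (t : ℝ) : Mat N :=
  ∑ μ, σ.vel t μ • A μ (σ.val t)

/-- `U t s`, `0 ≤ s ≤ t ≤ 1`, solves the equations of parallel transport along `σ`:
`dU_{t,s}/dt = -A_μ(σ(t)) σ̇^μ(t) U_{t,s}`, `dU_{t,s}/ds = U_{t,s} A_μ(σ(s)) σ̇^μ(s)`,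
`U_{t,t} = I_N`. As `σ` is only absolutely continuous, the solution is absolutely continuous in each
variable and the equations hold almost everywhere. -/
structure IsParallelTransport (A : Fin 4 → Mink → Mat N) (σ : Curve p) (U : ℝ → ℝ → Mat N) :
    Prop where
  ac_left : ∀ s ∈ Icc (0 : ℝ) 1, AbsolutelyContinuousOnInterval (fun t => U t s) s 1
  deriv_left : ∀ s ∈ Icc (0 : ℝ) 1, ∀ᵐ t, t ∈ Ioo s 1 →
    HasDerivAt (fun t => U t s) (-(connAlong A σ t * U t s)) t
  ac_right : ∀ t ∈ Icc (0 : ℝ) 1, AbsolutelyContinuousOnInterval (fun s => U t s) 0 t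
  deriv_right : ∀ t ∈ Icc (0 : ℝ) 1, ∀ᵐ s, s ∈ Ioo 0 t →
    HasDerivAt (fun s => U t s) (U t s * connAlong A σ s) s
  diag : ∀ t ∈ Icc (0 : ℝ) 1, U t t = 1

/-- `U^A_{1,0}(σ)`, from the solution of the equations of parallel transport (which is unique
for `0 ≤ s ≤ t ≤ 1`). -/
def transport (A : Fin 4 → Mink → Mat N) (σ : Curve p) : Mat N :=
  Classical.epsilon (IsParallelTransport A σ) 1 0

/-- `Ψ^{A,ψ}(σ) = (U^A_{0,1}(σ) ⊗ I_4) ψ(σ(1))`, where `U^A_{0,1} = (U^A_{1,0})⁻¹`. -/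
def transportedSpinor (A : Fin 4 → Mink → Mat N) (ψ : Mink → Spinor N) (σ : Curve p) : Spinor N :=
  colorAct (transport A σ)⁻¹ (ψ (σ.val 1))

end

/-! ### Endpoint derivation and Lévy d'Alembertian -/

section

variable {p : ℝ≥0∞} [Fact (1 ≤ p)] {V : Type*} [NormedAddCommGroup V] [NormedSpace ℝ V]

/-- `T ∈ dom S_h` and `S_h(T) = v`: `T(u) = ∫₀¹ (u(t), ν(dt))` for a Borel measure `ν` on `[0,1]`
with values in `V ⊗ ℝ^4` (components `ν_μ`; finiteness of the variation is automatic when `V` is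
finite-dimensional), and `v = (h, ν({1}))`. -/
def HasEndpointValue (h : Mink) (T : Curve p →L[ℝ] V) (v : V) : Prop :=
  ∃ ν : Fin 4 → VectorMeasure unitInterval V,
    (∀ μ, IsFiniteMeasure (ν μ).variation) ∧
    (∀ u : Curve p, T u =
      ∑ μ, (ν μ).integral (fun t => u.val t μ) (ContinuousLinearMap.lsmul ℝ ℝ)) ∧
    v = ∑ μ, h μ • ν μ {1}

/-- `f` is in the domain of the endpoint derivation `D_h`, and `D_h f = f'`. -/
def HasEndpointDeriv (h : Mink) (f f' : Curve p → V) : Prop :=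
  ContDiff ℝ 1 f ∧ ∀ σ, HasEndpointValue h (fderiv ℝ f σ) (f' σ)

/-- The continuous bilinear map `Q` is in the domain `T²_E` of the Lévy trace for the Minkowski
metric, and its Lévy trace is `w`. -/
def HasLevyTrace (Q : Curve p →L[ℝ] Curve p →L[ℝ] V) (w : V) : Prop :=
  ∃ (QV : Fin 4 → Fin 4 → ℝ × ℝ → V) (QL QS : Fin 4 → Fin 4 → ℝ → V),
    (∀ μ ν, Integrable (QV μ ν) (leb.prod leb)) ∧
    (∀ μ ν, Integrable (QL μ ν) leb) ∧
    (∀ μ ν, MemLp (QS μ ν) ∞ leb) ∧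
    (∀ μ ν, QL μ ν =ᵐ[leb] QL ν μ) ∧
    (∀ μ ν, QS μ ν =ᵐ[leb] -QS ν μ) ∧
    (∀ u v : Curve p, u.val 1 = 0 → v.val 1 = 0 →
      Q u v =
        (∫ x, ∑ μ, ∑ ν, (u.val x.1 μ * v.val x.2 ν) • QV μ ν x ∂(leb.prod leb)) +
        (∫ t, ∑ μ, ∑ ν, (u.val t μ * v.val t ν) • QL μ ν t ∂leb) +
        (1 / 2 : ℝ) • ∫ t, ∑ μ, ∑ ν,
          (u.vel t μ * v.val t ν + v.vel t μ * u.val t ν) • QS μ ν t ∂leb) ∧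
    w = ∫ t, ∑ μ, ∑ ν, eta μ ν • QL μ ν t ∂leb

/-- `f` is in the domain of the Lévy d'Alembertian `□_L`, and `□_L f = g`. -/
def HasLevyDAlembertian (f g : Curve p → V) : Prop :=
  ContDiff ℝ 2 f ∧ ∀ σ, HasLevyTrace (fderiv ℝ (fderiv ℝ f) σ) (g σ)

end

end LevyYM

end

attribute [local instance] Matrix.frobeniusNormedAddCommGroup Matrix.frobeniusNormedSpace

noncomputable section

namespace LevyYM

open Filter Topology

set_option linter.unusedSectionVars false

/-! ### Calculus of absolutely continuous functions on the unit interval -/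

section AbsolutelyContinuous

/-! Write U_t for the parallel transport from 0 to t along σ. It solves the Volterra equation U + ∫
A(σ̇)U = 1 in C([0,1]). The Volterra operator depends smoothly on σ, and its n-th power is bounded
by H^n/n! with H = ∫ |A(σ̇)|, so 1 plus the operator is always invertible and U_1 is a smooth
function of the curve (`contDiff_transportC`). As A is skew-Hermitian, U is unitary, and adjoints
serve as inverses.

Linearising the equation and integrating by parts gives Duhamel's formula dU_t(u) = -A(u(t))U_t -
U_t ∫_0^t U_s⁻¹ F(u,σ̇) U_s ds (`fderiv_transportC_apply`). It has two consequences. First, dΨ(u) is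
U_1⁻¹∇ψ paired with u(1), plus an integral of u against an L_1 density; so D_μΨ = U_1⁻¹(∂_μ + A_μ)ψ
at σ(1). The Dirac equation for Ψ is therefore U_1⁻¹ times the Dirac equation at σ(1), and every
point is the endpoint of some curve (`dirac_equation_iff`). Second, differentiating once more along
curves that vanish at 1 gives products of two curvatures (the Volterra part), -∇F on the diagonal
(the Lévy part) and F against velocities (the singular part). Hence □_L U_1 = -U_1 ∫ U⁻¹ ∇^μF_{μν} U
σ̇^ν (`hasLevyTrace_transportC`).

Both operators are specified by the existence of a representation, so the converse needs their
values to be unique. Each value is a limit computed from the functional alone: the curves t^{n+1}h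
isolate the mass at 1 (`HasEndpointValue.tendsto`), and by the Riemann–Lebesgue lemma the curves √2
sin(πnt)p_μ isolate the Lévy trace (`HasLevyTrace.tendsto`).

For the Yang–Mills equation, the current transforms by conjugation and the projection to su(N)
commutes with unitary conjugation. The equation for □_L thus says that ∫ U⁻¹ K(σ̇) U = 0 for every
curve, where K = ∇^μF_{μν}dx^ν + pr(i·current). Applying this to all σ^r and differentiating in r
kills the integrand; since position and velocity at time 1/2 can be prescribed, K = 0
(`eq_zero_of_integral_conjL_eq_zero`). -/

theorem intervalIntegrable_of_integrable_leb {V : Type*} [NormedAddCommGroup V] {g : ℝ → V} (hg : Integrable g leb) {a b : ℝ}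
    (ha : a ∈ Icc (0 : ℝ) 1) (hb : b ∈ Icc (0 : ℝ) 1) : IntervalIntegrable g volume a b := by
  rw [intervalIntegrable_iff]
  exact IntegrableOn.mono_set (t := Icc 0 1) hg
    (uIoc_subset_uIcc.trans (uIcc_subset_Icc ha hb))

/-- A bound on increments transfers the ε–δ condition. It covers primitives, Lipschitz images and
functions that agree only on the interval. -/
theorem absolutelyContinuous_of_dist_le {V₁ V₂ : Type*} [PseudoMetricSpace V₁]
    [PseudoMetricSpace V₂] {f : ℝ → V₁} {g : ℝ → V₂} {a b : ℝ} (c : ℝ)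
    (hg : AbsolutelyContinuousOnInterval g a b)
    (h : ∀ x ∈ uIcc a b, ∀ y ∈ uIcc a b, dist (f x) (f y) ≤ c * dist (g x) (g y)) :
    AbsolutelyContinuousOnInterval f a b := by
  rw [absolutelyContinuousOnInterval_iff] at hg ⊢
  intro ε hε
  -- The divisor `|c| + 1` is positive for every real c, including 0.
  obtain ⟨δ, hδ, H⟩ := hg (ε / (|c| + 1)) (by positivity)
  refine ⟨δ, hδ, fun E hE hl => ?_⟩
  have h1 := H E hE hl
  calc ∑ i ∈ Finset.range E.1, dist (f (E.2 i).1) (f (E.2 i).2)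
      ≤ ∑ i ∈ Finset.range E.1, (|c| + 1) * dist (g (E.2 i).1) (g (E.2 i).2) := by
        refine Finset.sum_le_sum fun i hi => (h _ (hE.1 i hi).1 _ (hE.1 i hi).2).trans ?_
        gcongr
        linarith [le_abs_self c]
    _ = (|c| + 1) * ∑ i ∈ Finset.range E.1, dist (g (E.2 i).1) (g (E.2 i).2) :=
        (Finset.mul_sum _ _ _).symm
    _ < (|c| + 1) * (ε / (|c| + 1)) := by gcongr
    _ = ε := by field

variable {V V₁ V₂ V₃ : Type*} [NormedAddCommGroup V] [NormedSpace ℝ V]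
  [NormedAddCommGroup V₁] [NormedSpace ℝ V₁] [NormedAddCommGroup V₂] [NormedSpace ℝ V₂]
  [NormedAddCommGroup V₃] [NormedSpace ℝ V₃]

theorem integral_leb_eq (g : ℝ → V) : ∫ t, g t ∂leb = ∫ t in (0 : ℝ)..1, g t := by
  rw [intervalIntegral.integral_of_le zero_le_one, integral_Icc_eq_integral_Ioc]

theorem ae_leb_Ioo : ∀ᵐ t ∂leb, t ∈ Ioo (0 : ℝ) 1 := by
  rw [leb, ← Measure.restrict_congr_set Ioo_ae_eq_Icc]
  exact ae_restrict_mem measurableSet_Ioo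

/-- `f` is absolutely continuous on `[0,1]` and its almost everywhere derivative is the
integrable function `g`. -/
structure HasWeakDeriv (f g : ℝ → V) : Prop where
  ac : AbsolutelyContinuousOnInterval f 0 1
  integrable : Integrable g leb
  ae_hasDerivAt : ∀ᵐ t ∂leb, HasDerivAt f (g t) t

/-- The increments of the vector-valued primitive are dominated by those of the scalar primitive of
‖g‖, for which absolute continuity is known. -/
theorem absolutelyContinuous_primitive {g : ℝ → V} (hg : Integrable g leb) :
    AbsolutelyContinuousOnInterval (fun t => ∫ s in (0 : ℝ)..t, g s) 0 1 := by
  have h0 : (0 : ℝ) ∈ Icc (0 : ℝ) 1 := by simp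
  have h1 : (1 : ℝ) ∈ Icc (0 : ℝ) 1 := by simp
  have hn := (intervalIntegrable_of_integrable_leb hg.norm h0 h1)
  refine absolutelyContinuous_of_dist_le 1
    (hn.absolutelyContinuousOnInterval_intervalIntegral (c := 0) (by simp)) ?_
  intro x hx y hy
  rw [uIcc_of_le zero_le_one] at hx hy
  rw [one_mul, dist_eq_norm, dist_eq_norm, intervalIntegral.integral_interval_sub_left
    (intervalIntegrable_of_integrable_leb hg h0 hx) (intervalIntegrable_of_integrable_leb hg h0 hy),
    intervalIntegral.integral_interval_sub_left
    (intervalIntegrable_of_integrable_leb hg.norm h0 hx)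
    (intervalIntegrable_of_integrable_leb hg.norm h0 hy)]
  exact intervalIntegral.norm_integral_le_abs_integral_norm

theorem HasWeakDeriv.primitive [CompleteSpace V] {g : ℝ → V} (hg : Integrable g leb) :
    HasWeakDeriv (fun t => ∫ s in (0 : ℝ)..t, g s) g where
  ac := absolutelyContinuous_primitive hg
  integrable := hg
  ae_hasDerivAt := by
    have h1 := (intervalIntegrable_of_integrable_leb hg (a := 0) (b := 1)
      (by simp) (by simp)).ae_hasDerivAt_integral
    rw [ae_restrict_iff' measurableSet_Icc]
    filter_upwards [h1] with t ht h
    rw [uIcc_of_le zero_le_one] at ht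
    exact ht h 0 (by simp)

namespace HasWeakDeriv

theorem const (c : V) : HasWeakDeriv (fun _ => c) (fun _ => 0) :=
  ⟨(LipschitzWith.const c).lipschitzOnWith.absolutelyContinuousOnInterval, integrable_zero _ _ _,
    .of_forall fun t => hasDerivAt_const t c⟩

theorem add {f g f' g' : ℝ → V} (hf : HasWeakDeriv f f') (hg : HasWeakDeriv g g') :
    HasWeakDeriv (fun t => f t + g t) (fun t => f' t + g' t) :=
  ⟨hf.ac.add hg.ac, hf.integrable.add hg.integrable, by
    filter_upwards [hf.ae_hasDerivAt, hg.ae_hasDerivAt] with t a b using a.add b⟩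

theorem congr_deriv {f g g' : ℝ → V} (hf : HasWeakDeriv f g) (h : g =ᵐ[leb] g') :
    HasWeakDeriv f g' :=
  ⟨hf.ac, hf.integrable.congr h, by filter_upwards [hf.ae_hasDerivAt, h] with t a b using b ▸ a⟩

/-- Agreement on [0,1] is enough: almost every time is interior, and there the two functions agree
in a neighbourhood. -/
theorem congr {f f' g : ℝ → V} (hf : HasWeakDeriv f g) (h : ∀ t ∈ Icc (0 : ℝ) 1, f t = f' t) :
    HasWeakDeriv f' g := by
  refine ⟨absolutelyContinuous_of_dist_le 1 hf.ac ?_, hf.integrable, ?_⟩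
  · intro x hx y hy
    rw [uIcc_of_le zero_le_one] at hx hy
    rw [h x hx, h y hy, one_mul]
  · filter_upwards [hf.ae_hasDerivAt, ae_leb_Ioo] with t a b
    refine a.congr_of_eventuallyEq ?_
    filter_upwards [Ioo_mem_nhds b.1 b.2] with s hs using (h s ⟨hs.1.le, hs.2.le⟩).symm

theorem continuousOn {f g : ℝ → V} (hf : HasWeakDeriv f g) : ContinuousOn f (Icc 0 1) := by
  have := hf.ac.continuousOn
  rwa [uIcc_of_le zero_le_one] at this

theorem eq_of_deriv_zero {f : ℝ → V} (hf : HasWeakDeriv f fun _ => 0) {t : ℝ}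
    (ht : t ∈ Icc (0 : ℝ) 1) : f t = f 0 := by
  have h : ∀ᵐ t, t ∈ uIcc (0 : ℝ) 1 → HasDerivAt f 0 t := by
    rw [uIcc_of_le zero_le_one]
    exact (ae_restrict_iff' measurableSet_Icc).1 hf.ae_hasDerivAt
  obtain ⟨C, hC⟩ := hf.ac.const_of_ae_hasDerivAt_zero h
  rw [uIcc_of_le zero_le_one] at hC
  rw [hC t ht, hC 0 (by simp)]

theorem neg {f g : ℝ → V} (hf : HasWeakDeriv f g) :
    HasWeakDeriv (fun t => -f t) (fun t => -g t) :=
  ⟨hf.ac.neg, hf.integrable.neg, by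
    filter_upwards [hf.ae_hasDerivAt] with t a using a.neg⟩

theorem sub {f g f' g' : ℝ → V} (hf : HasWeakDeriv f f') (hg : HasWeakDeriv g g') :
    HasWeakDeriv (fun t => f t - g t) (fun t => f' t - g' t) := by
  simpa only [sub_eq_add_neg] using hf.add hg.neg

/-- Subtracting the primitive of g leaves a function with zero weak derivative, hence a constant. -/
theorem eq_add_integral [CompleteSpace V] {f g : ℝ → V} (hf : HasWeakDeriv f g) {t : ℝ}
    (ht : t ∈ Icc (0 : ℝ) 1) : f t = f 0 + ∫ s in (0 : ℝ)..t, g s := by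
  have h := (hf.sub (HasWeakDeriv.primitive hf.integrable)).congr_deriv
    (g' := fun _ => 0) (.of_forall fun t => sub_self _)
  have := h.eq_of_deriv_zero ht
  simp only [intervalIntegral.integral_same, sub_zero] at this
  rw [← this, sub_add_cancel]

end HasWeakDeriv

theorem integrable_clm_apply {φ : ℝ → V₁ →L[ℝ] V₂} (hφ : ContinuousOn φ (Icc 0 1)) {g : ℝ → V₁}
    (hg : Integrable g leb) : Integrable (fun t => φ t (g t)) leb := by
  obtain ⟨C, hC⟩ := isCompact_Icc.exists_bound_of_continuousOn hφ
  have hm : AEStronglyMeasurable φ leb := hφ.aestronglyMeasurable measurableSet_Icc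
  refine (hg.norm.const_mul C).mono'
    ((ContinuousLinearMap.id ℝ (V₁ →L[ℝ] V₂)).aestronglyMeasurable_comp₂ hm
      hg.aestronglyMeasurable) ?_
  filter_upwards [ae_restrict_mem measurableSet_Icc] with t ht
  exact ((φ t).le_opNorm _).trans (mul_le_mul_of_nonneg_right (hC t ht) (norm_nonneg _))

/-- The curve f stays in a closed ball, which is compact in finite dimension; a C¹ map is Lipschitz
there, and so preserves absolute continuity. -/
theorem HasWeakDeriv.comp [FiniteDimensional ℝ V₁] {Φ : V₁ → V₂} (hΦ : ContDiff ℝ 1 Φ)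
    {f g : ℝ → V₁} (hf : HasWeakDeriv f g) :
    HasWeakDeriv (fun t => Φ (f t)) (fun t => fderiv ℝ Φ (f t) (g t)) := by
  have hfc := hf.continuousOn
  refine ⟨?_, integrable_clm_apply ((hΦ.continuous_fderiv one_ne_zero).comp_continuousOn hfc)
    hf.integrable, ?_⟩
  · obtain ⟨C, hC⟩ := isCompact_Icc.exists_bound_of_continuousOn hfc
    have : ProperSpace V₁ := FiniteDimensional.proper ℝ V₁
    obtain ⟨K, hK⟩ := hΦ.contDiffOn.exists_lipschitzOnWith (one_ne_zero)
      (convex_closedBall (0 : V₁) C) (isCompact_closedBall _ _)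
    refine absolutelyContinuous_of_dist_le K hf.ac fun x hx y hy => ?_
    rw [uIcc_of_le zero_le_one] at hx hy
    exact hK.dist_le_mul _ (by simpa using hC x hx) _ (by simpa using hC y hy)
  · filter_upwards [hf.ae_hasDerivAt] with t ht
    exact ((hΦ.differentiable one_ne_zero _).hasFDerivAt.comp_hasDerivAt t ht)

theorem HasWeakDeriv.clm_apply (L : V₁ →L[ℝ] V₂) {f g : ℝ → V₁} (hf : HasWeakDeriv f g) :
    HasWeakDeriv (fun t => L (f t)) (fun t => L (g t)) := by
  refine ⟨absolutelyContinuous_of_dist_le ‖L‖ hf.ac fun x _ y _ => ?_,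
    L.integrable_comp hf.integrable, ?_⟩
  · rw [dist_eq_norm, dist_eq_norm, ← map_sub]
    exact L.le_opNorm _
  · filter_upwards [hf.ae_hasDerivAt] with t ht using L.hasFDerivAt.comp_hasDerivAt t ht

/-- The chain rule for the smooth map (x, y) ↦ B x y, applied to the pair (f, g) assembled as `inl f
+ inr g`. -/
theorem HasWeakDeriv.bilin [FiniteDimensional ℝ V₁] [FiniteDimensional ℝ V₂]
    (B : V₁ →L[ℝ] V₂ →L[ℝ] V₃) {f f' : ℝ → V₁} {g g' : ℝ → V₂} (hf : HasWeakDeriv f f')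
    (hg : HasWeakDeriv g g') :
    HasWeakDeriv (fun t => B (f t) (g t)) (fun t => B (f' t) (g t) + B (f t) (g' t)) := by
  have h1 := (hf.clm_apply (ContinuousLinearMap.inl ℝ V₁ V₂)).add
    (hg.clm_apply (ContinuousLinearMap.inr ℝ V₁ V₂))
  have h2 := h1.comp (Φ := fun x : V₁ × V₂ => B x.1 x.2) B.isBoundedBilinearMap.contDiff
  simp only [ContinuousLinearMap.inl_apply, ContinuousLinearMap.inr_apply, Prod.mk_add_mk, zero_add,
    add_zero] at h2
  refine h2.congr_deriv (.of_forall fun t => ?_)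
  simp [(B.isBoundedBilinearMap.hasFDerivAt (f t, g t)).fderiv, add_comm]

theorem HasWeakDeriv.mul {R : Type*} [NormedRing R] [NormedAlgebra ℝ R] [FiniteDimensional ℝ R]
    {f f' g g' : ℝ → R} (hf : HasWeakDeriv f f') (hg : HasWeakDeriv g g') :
    HasWeakDeriv (fun t => f t * g t) (fun t => f' t * g t + f t * g' t) :=
  hf.bilin (ContinuousLinearMap.mul ℝ R) hg

end AbsolutelyContinuous

/-! ### Smoothness of composition operators on spaces of continuous functions -/

section ContinuousMaps

variable {α : Type*} [TopologicalSpace α] [CompactSpace α]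
  {X Y Z : Type*} [NormedAddCommGroup X] [NormedSpace ℝ X] [NormedAddCommGroup Y] [NormedSpace ℝ Y]
  [NormedAddCommGroup Z] [NormedSpace ℝ Z]

/-- The pointwise action of a continuous bilinear map on continuous functions. -/
def pointwise (B : X →L[ℝ] Y →L[ℝ] Z) : C(α, X) →L[ℝ] C(α, Y) →L[ℝ] C(α, Z) :=
  LinearMap.mkContinuous₂
    (LinearMap.mk₂ ℝ (fun (f : C(α, X)) (g : C(α, Y)) => (⟨fun t => B (f t) (g t), by fun_prop⟩ :
        C(α, Z)))
      (fun _ _ _ => by ext; simp) (fun _ _ _ => by ext; simp) (fun _ _ _ => by ext; simp)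
      (fun _ _ _ => by ext; simp)) ‖B‖ (fun f g => by
    rw [ContinuousMap.norm_le _ (by positivity)]
    intro t
    refine (B.le_opNorm₂ _ _).trans ?_
    gcongr
    · exact f.norm_coe_le_norm t
    · exact g.norm_coe_le_norm t)

/-- At each t the mean value inequality is applied on the segment from σ(t) to τ(t). The bound is
uniform in t because σ ↦ f' ∘ σ is continuous for the sup norm. -/
theorem hasFDerivAt_comp_left (f : C(X, Y)) (f' : C(X, X →L[ℝ] Y))
    (hf : ∀ x, HasFDerivAt f (f' x) x) (σ : C(α, X)) :
    HasFDerivAt (fun σ : C(α, X) => f.comp σ)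
      (pointwise (ContinuousLinearMap.id ℝ (X →L[ℝ] Y)) (f'.comp σ)) σ := by
  rw [hasFDerivAt_iff_isLittleO, Asymptotics.isLittleO_iff]
  intro c hc
  have hcont : Continuous fun σ : C(α, X) => f'.comp σ := ContinuousMap.continuous_postcomp f'
  have h1 := (Metric.continuousAt_iff (f := fun σ : C(α, X) => f'.comp σ) (a := σ)).1
    hcont.continuousAt c hc
  obtain ⟨δ, hδ, H⟩ := h1
  filter_upwards [Metric.ball_mem_nhds σ hδ] with τ hτ
  rw [ContinuousMap.norm_le _ (by positivity)]
  intro t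
  -- Points of the segment are values at t of σ + θ(τ - σ), a function still within δ of σ.
  have key : ∀ z ∈ segment ℝ (σ t) (τ t), ‖f' z - f' (σ t)‖ ≤ c := by
    rintro z hz
    rw [segment_eq_image'] at hz
    obtain ⟨θ, hθ, rfl⟩ := hz
    have h2 : dist (σ + θ • (τ - σ)) σ < δ := by
      rw [dist_eq_norm, add_sub_cancel_left, norm_smul]
      refine lt_of_le_of_lt (mul_le_of_le_one_left (norm_nonneg _) ?_) (by simpa [dist_eq_norm] using hτ)
      rw [Real.norm_of_nonneg hθ.1]
      exact hθ.2
    have h3 := (ContinuousMap.dist_lt_iff hc).1 (H h2) t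
    rw [dist_eq_norm] at h3
    exact h3.le
  have h4 := (convex_segment (σ t) (τ t)).norm_image_sub_le_of_norm_hasFDerivWithin_le'
    (fun z _ => (hf z).hasFDerivWithinAt) key (left_mem_segment ℝ _ _) (right_mem_segment ℝ _ _)
  refine h4.trans ?_
  gcongr
  exact (τ - σ).norm_coe_le_norm t

end ContinuousMaps

/-- The derivative of f ∘ · is again a composition operator, with f' in place of f, followed by a
bounded linear map. The target Y is quantified inside the induction because the step replaces it by
X →L[ℝ] Y. -/
theorem contDiff_comp_left_nat {α : Type} [TopologicalSpace α] [CompactSpace α] {X : Type}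
    [NormedAddCommGroup X] [NormedSpace ℝ X] (n : ℕ) : ∀ {Y : Type} [NormedAddCommGroup Y]
    [NormedSpace ℝ Y] (f : C(X, Y)), ContDiff ℝ n f →
      ContDiff ℝ n (fun σ : C(α, X) => f.comp σ) := by
  induction n with
  | zero =>
    intro Y _ _ f _
    exact contDiff_zero.2 (ContinuousMap.continuous_postcomp f)
  | succ n ih =>
    intro Y _ _ f hf
    have hf' := contDiff_succ_iff_fderiv.1 (by exact_mod_cast hf : ContDiff ℝ ((n : WithTop ℕ∞) + 1) f)
    let f' : C(X, X →L[ℝ] Y) := ⟨fderiv ℝ f, hf'.2.2.continuous⟩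
    have h := fun σ : C(α, X) => hasFDerivAt_comp_left f f'
      (fun x => (hf'.1 x).hasFDerivAt) σ
    have : ContDiff ℝ ((n : WithTop ℕ∞) + 1) (fun σ : C(α, X) => f.comp σ) := by
      refine contDiff_succ_iff_fderiv.2 ⟨fun σ => (h σ).differentiableAt, by simp, ?_⟩
      rw [show fderiv ℝ (fun σ : C(α, X) => f.comp σ) = fun σ =>
        pointwise (ContinuousLinearMap.id ℝ (X →L[ℝ] Y)) (f'.comp σ) from
        funext fun σ => (h σ).fderiv]
      exact (ContinuousLinearMap.contDiff _).comp (ih f' hf'.2.2)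
    exact_mod_cast this

theorem contDiff_comp_left {α : Type} [TopologicalSpace α] [CompactSpace α] {X Y : Type}
    [NormedAddCommGroup X] [NormedSpace ℝ X] [NormedAddCommGroup Y] [NormedSpace ℝ Y]
    (f : C(X, Y)) (hf : ContDiff ℝ ∞ f) : ContDiff ℝ ∞ (fun σ : C(α, X) => f.comp σ) :=
  contDiff_infty.2 fun n => contDiff_comp_left_nat n f (contDiff_infty.1 hf n)

/-! ### Volterra operators -/

section Volterra

theorem continuous_extendI {V : Type*} [TopologicalSpace V] {f : unitInterval → V}
    (hf : Continuous f) : Continuous (extendI f) :=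
  hf.comp continuous_projIcc

theorem extendI_coe {V : Type*} (f : unitInterval → V) (t : unitInterval) : extendI f t = f t :=
  IccExtend_val _ _ _

variable {X V : Type*} [NormedAddCommGroup X] [NormedSpace ℝ X] [NormedAddCommGroup V]
  [NormedSpace ℝ V]

theorem integral_congr_ae_leb {f g : ℝ → V} (t : unitInterval) (h : f =ᵐ[leb] g) :
    ∫ s in (0 : ℝ)..t, f s = ∫ s in (0 : ℝ)..t, g s := by
  refine intervalIntegral.integral_congr_ae ?_
  filter_upwards [(ae_restrict_iff' measurableSet_Icc).1 h] with s hs hs'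
  rw [uIoc_of_le t.2.1] at hs'
  exact hs ⟨hs'.1.le, hs'.2.trans t.2.2⟩

theorem integrable_volterra (h : Lp X 1 leb) (w : C(unitInterval, X →L[ℝ] V)) :
    Integrable (fun s => extendI w s (h s)) leb :=
  integrable_clm_apply (continuous_extendI w.continuous).continuousOn (L1.integrable_coeFn h)

/-- `t ↦ ∫₀ᵗ w(s) h(s) ds`, as a bilinear function of `h` and `w`. -/
def volterra : Lp X 1 leb →L[ℝ] C(unitInterval, X →L[ℝ] V) →L[ℝ] C(unitInterval, V) :=
  LinearMap.mkContinuous₂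
    (LinearMap.mk₂ ℝ (fun (h : Lp X 1 leb) (w : C(unitInterval, X →L[ℝ] V)) =>
        (⟨fun t => ∫ s in (0 : ℝ)..t, extendI w s (h s), by
          have := (absolutelyContinuous_primitive (integrable_volterra h w)).continuousOn
          rw [uIcc_of_le zero_le_one] at this
          exact this.comp_continuous continuous_subtype_val fun t => t.2⟩ : C(unitInterval, V)))
      (fun h k w => by
        ext t
        have i1 := intervalIntegrable_of_integrable_leb (integrable_volterra h w) (a := 0) (b := t)
          (by simp) t.2
        have i2 := intervalIntegrable_of_integrable_leb (integrable_volterra k w) (a := 0) (b := t)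
          (by simp) t.2
        refine (integral_congr_ae_leb t ?_).trans
          (intervalIntegral.integral_add i1 i2)
        filter_upwards [Lp.coeFn_add h k] with s hs
        simp only [hs, Pi.add_apply, map_add])
      (fun c h w => by
        ext t
        refine (integral_congr_ae_leb t ?_).trans
          (intervalIntegral.integral_smul c _)
        filter_upwards [Lp.coeFn_smul c h] with s hs
        simp only [hs, Pi.smul_apply, map_smul])
      (fun h w z => by
        ext t
        have i1 := intervalIntegrable_of_integrable_leb (integrable_volterra h w) (a := 0) (b := t)
          (by simp) t.2
        have i2 := intervalIntegrable_of_integrable_leb (integrable_volterra h z) (a := 0) (b := t)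
          (by simp) t.2
        exact intervalIntegral.integral_add i1 i2)
      (fun c h w => by
        ext t
        exact intervalIntegral.integral_smul _ _)) 1 (fun h w => by
    rw [ContinuousMap.norm_le _ (by positivity)]
    intro t
    have i0 := L1.integrable_coeFn h
    calc ‖∫ s in (0 : ℝ)..t, extendI w s (h s)‖ ≤ ∫ s in (0 : ℝ)..t, ‖w‖ * ‖h s‖ := by
          refine intervalIntegral.norm_integral_le_of_norm_le t.2.1 (.of_forall fun s _ => ?_)
            ((intervalIntegrable_of_integrable_leb i0.norm (by simp) t.2).const_mul _)
          exact ((extendI w s).le_opNorm _).trans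
            (mul_le_mul_of_nonneg_right (w.norm_coe_le_norm _) (norm_nonneg _))
      _ ≤ ∫ s in (0 : ℝ)..1, ‖w‖ * ‖h s‖ :=
          intervalIntegral.integral_mono_interval le_rfl t.2.1 t.2.2
            (.of_forall fun s => by positivity)
            ((intervalIntegrable_of_integrable_leb i0.norm (by simp) (by simp)).const_mul _)
      _ = 1 * ‖h‖ * ‖w‖ := by
          rw [← integral_leb_eq, integral_const_mul, L1.norm_eq_integral_norm, one_mul, mul_comm])

theorem volterra_apply (h : Lp X 1 leb) (w : C(unitInterval, X →L[ℝ] V)) (t : unitInterval) :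
    volterra h w t = ∫ s in (0 : ℝ)..t, extendI w s (h s) := rfl

/-- With H(t) = ∫_0^t h, each application of K integrates h H^n/n!, which is the derivative of
H^{n+1}/(n+1)!. -/
theorem norm_pow_le_of_volterra (K : C(unitInterval, V) →L[ℝ] C(unitInterval, V)) {h : ℝ → ℝ}
    (hi : Integrable h leb) (h0 : ∀ s, 0 ≤ h s)
    (hK : ∀ w t, ‖K w t‖ ≤ ∫ s in (0 : ℝ)..t, h s * ‖extendI w s‖) (n : ℕ)
    (w : C(unitInterval, V)) (t : unitInterval) :
    ‖(K ^ n) w t‖ ≤ ‖w‖ * ((∫ s in (0 : ℝ)..t, h s) ^ n / n.factorial) := by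
  induction n generalizing t with
  | zero => simpa using w.norm_coe_le_norm t
  | succ n ih =>
    -- The derivative of H^{n+1} holds only almost everywhere, as h is merely integrable; the
    -- fundamental theorem for weak derivatives applies.
    have hw := ((HasWeakDeriv.primitive hi).comp (Φ := fun x : ℝ => x ^ (n + 1))
      (by fun_prop)).congr_deriv
      (g' := fun s => h s * (((n + 1 : ℕ) : ℝ) * (∫ r in (0 : ℝ)..s, h r) ^ n))
      (.of_forall fun s => by simp [fderiv_eq_smul_deriv])
    have hw' := hw.eq_add_integral t.2
    simp only [intervalIntegral.integral_same, zero_pow (Nat.succ_ne_zero n), zero_add] at hw'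
    have iK := intervalIntegrable_of_integrable_leb hw.integrable (a := 0) (b := t) (by simp) t.2
    rw [hw', pow_succ', mul_apply_eq_comp]
    refine (hK _ t).trans ?_
    have e : ‖w‖ * ((∫ s in (0 : ℝ)..t, h s * (((n + 1 : ℕ) : ℝ) * (∫ r in (0 : ℝ)..s, h r) ^ n)) /
        (n + 1).factorial) = ∫ s in (0 : ℝ)..t, (‖w‖ / (n + 1).factorial) *
          (h s * (((n + 1 : ℕ) : ℝ) * (∫ r in (0 : ℝ)..s, h r) ^ n)) := by
      rw [intervalIntegral.integral_const_mul]
      ring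
    rw [e]
    refine intervalIntegral.integral_mono_on t.2.1 ?_ (iK.const_mul _) ?_
    · refine (intervalIntegrable_of_integrable_leb hi (by simp) t.2).mul_continuousOn ?_
      exact (continuous_extendI ((K ^ n) w).continuous).norm.continuousOn
    · intro s hs
      have hs' : s ∈ Icc (0 : ℝ) 1 := ⟨hs.1, hs.2.trans t.2.2⟩
      have := ih ⟨s, hs'⟩
      rw [extendI, IccExtend_of_mem _ _ hs']
      calc h s * ‖((K ^ n) w) ⟨s, hs'⟩‖
          ≤ h s * (‖w‖ * ((∫ r in (0 : ℝ)..s, h r) ^ n / n.factorial)) :=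
            mul_le_mul_of_nonneg_left this (h0 s)
        _ = _ := by
            rw [Nat.factorial_succ]
            push_cast
            field

/-- 1 - (-K)^n is invertible by the Neumann series and factors as 1 + K times a geometric sum;
commuting factors of a unit are units. -/
theorem isUnit_one_add_of_norm_pow_lt_one {S : Type*} [NormedRing S] [CompleteSpace S] (K : S)
    {n : ℕ} (hK : ‖K ^ n‖ < 1) : IsUnit (1 + K) := by
  have h1 : ‖(-K) ^ n‖ < 1 := by
    rcases neg_one_pow_eq_or S n with e | e <;> simpa [neg_pow K, e] using hK
  have h2 := isUnit_one_sub_of_norm_lt_one h1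
  rw [← mul_neg_geom_sum, sub_neg_eq_add] at h2
  refine ((Commute.isUnit_mul_iff ?_).1 h2).1
  refine Commute.sum_right _ _ _ fun i _ => ?_
  exact (Commute.one_left _).add_left ((Commute.refl K).neg_right.pow_right i)

/-- Some power of K has norm below 1, as H^n/n! tends to 0; no smallness of h is needed. -/
theorem isUnit_one_add_of_volterra [CompleteSpace V]
    (K : C(unitInterval, V) →L[ℝ] C(unitInterval, V)) {h : ℝ → ℝ}
    (hi : Integrable h leb) (h0 : ∀ s, 0 ≤ h s)
    (hK : ∀ w t, ‖K w t‖ ≤ ∫ s in (0 : ℝ)..t, h s * ‖extendI w s‖) : IsUnit (1 + K) := by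
  set H := ∫ s in (0 : ℝ)..1, h s
  have hH : 0 ≤ H := intervalIntegral.integral_nonneg zero_le_one fun s _ => h0 s
  have hn : ∀ n, ‖K ^ n‖ ≤ H ^ n / n.factorial := by
    intro n
    refine ContinuousLinearMap.opNorm_le_bound _ (by positivity) fun w => ?_
    rw [ContinuousMap.norm_le _ (by positivity)]
    intro t
    refine (norm_pow_le_of_volterra K hi h0 hK n w t).trans ?_
    rw [mul_comm]
    gcongr
    · exact intervalIntegral.integral_nonneg t.2.1 fun s _ => h0 s
    · exact intervalIntegral.integral_mono_interval le_rfl t.2.1 t.2.2 (.of_forall h0)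
        (intervalIntegrable_of_integrable_leb hi (by simp) (by simp))
  obtain ⟨n, hn1⟩ := ((FloorSemiring.tendsto_pow_div_factorial_atTop H).eventually
    (gt_mem_nhds zero_lt_one)).exists
  exact isUnit_one_add_of_norm_pow_lt_one K ((hn n).trans_lt hn1)

end Volterra

theorem hasWeakDeriv_volterra {X V : Type*} [NormedAddCommGroup X] [NormedSpace ℝ X]
    [NormedAddCommGroup V] [NormedSpace ℝ V] [CompleteSpace V] (h : Lp X 1 leb)
    (w : C(unitInterval, X →L[ℝ] V)) :
    HasWeakDeriv (extendI (volterra h w)) (fun s => extendI w s (h s)) := by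
  refine (HasWeakDeriv.primitive (integrable_volterra h w)).congr fun t ht => ?_
  exact (extendI_coe (volterra h w) ⟨t, ht⟩).symm

/-! ### Curves as elements of L_1 (velocity) and of C([0,1]) (position) -/

namespace Curve

variable {p : ℝ≥0∞}

theorem hasWeakDeriv [hp : Fact (1 ≤ p)] (σ : Curve p) : HasWeakDeriv σ.val σ.vel :=
  ⟨σ.2.2.1, (memLp_vel σ).integrable hp.out, by
    filter_upwards [ae_differentiableAt_of_ac σ.2.2.1] with t ht using ht.hasDerivAt⟩

theorem val_zero (σ : Curve p) : σ.val 0 = 0 := by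
  rw [← σ.2.1]
  exact extendI_coe σ.1 0

variable [hp : Fact (1 ≤ p)]

/-- The velocity as an element of `L_1`. -/
def velL1 : Curve p →L[ℝ] Lp Mink 1 leb :=
  LinearMap.mkContinuous
    { toFun := fun σ => ((memLp_vel σ).mono_exponent hp.out).toLp σ.vel
      map_add' := fun σ τ => by
        rw [← MemLp.toLp_add]
        apply MemLp.toLp_congr
        filter_upwards [ae_differentiableAt_of_ac σ.2.2.1, ae_differentiableAt_of_ac τ.2.2.1]
          with t a b
        exact deriv_add a b
      map_smul' := fun c σ => by
        rw [RingHom.id_apply, ← MemLp.toLp_const_smul]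
        apply MemLp.toLp_congr
        filter_upwards [ae_differentiableAt_of_ac σ.2.2.1] with t a
        exact deriv_const_smul c a } 1 fun σ => by
    -- On a probability space the L_1 norm is at most the L_p norm.
    have : IsProbabilityMeasure leb := ⟨by simp⟩
    rw [one_mul, LinearMap.coe_mk, AddHom.coe_mk]
    change _ ≤ ‖(memLp_vel σ).toLp σ.vel‖
    rw [Lp.norm_toLp, Lp.norm_toLp]
    exact ENNReal.toReal_mono (memLp_vel σ).2.ne
      (eLpNorm_le_eLpNorm_of_exponent_le hp.out (memLp_vel σ).1)

theorem coeFn_velL1 (σ : Curve p) : velL1 σ =ᵐ[leb] σ.vel :=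
  MemLp.coeFn_toLp ((memLp_vel σ).mono_exponent hp.out)

/-- The inclusion of the space of curves in the space of continuous functions. -/
def posL : Curve p →L[ℝ] C(unitInterval, Mink) :=
  (ContinuousLinearMap.flip (𝕜 := ℝ) (𝕜₂ := ℝ) (𝕜₃ := ℝ) (E := Lp Mink 1 leb) (F := C(unitInterval, Mink →L[ℝ] Mink))
    (G := C(unitInterval, Mink)) volterra
    (ContinuousMap.const _ (ContinuousLinearMap.id ℝ Mink))).comp velL1

@[simp] theorem extendI_posL (σ : Curve p) : extendI (posL σ) = σ.val := by
  have h : ⇑(posL σ) = σ.1 := by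
    funext t
    have h1 : posL σ t = ∫ s in (0 : ℝ)..t, velL1 σ s := rfl
    have h2 := σ.hasWeakDeriv.eq_add_integral t.2
    rw [σ.val_zero, zero_add] at h2
    rw [h1, integral_congr_ae_leb t σ.coeFn_velL1, ← h2]
    exact extendI_coe σ.1 t
  rw [h, val]

@[simp] theorem posL_apply (σ : Curve p) (t : unitInterval) : posL σ t = σ.val t := by
  rw [← extendI_posL, extendI_coe]

end Curve

theorem contDiff_bilin_comp {E L C₀ C₁ C₂ D : Type*} [NormedAddCommGroup E] [NormedSpace ℝ E]
    [NormedAddCommGroup L] [NormedSpace ℝ L] [NormedAddCommGroup C₀] [NormedSpace ℝ C₀]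
    [NormedAddCommGroup C₁] [NormedSpace ℝ C₁] [NormedAddCommGroup C₂] [NormedSpace ℝ C₂]
    [NormedAddCommGroup D] [NormedSpace ℝ D] {n : WithTop ℕ∞} (T : L →L[ℝ] C₁ →L[ℝ] C₂)
    (S : D →L[ℝ] C₀ →L[ℝ] C₁) {h : E → L} {f : E → D} (hh : ContDiff ℝ n h)
    (hf : ContDiff ℝ n f) : ContDiff ℝ n fun σ => (T (h σ)).comp (S (f σ)) :=
  (T.contDiff.comp hh).clm_comp (S.contDiff.comp hf)

/-! ### Parallel transport as the solution of a Volterra equation -/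

section Algebra

variable {R : Type} [NormedRing R] [NormedAlgebra ℝ R]

/-- `(L, w) ↦ (v ↦ L v * w)`. -/
def actR : (Mink →L[ℝ] R) →L[ℝ] R →L[ℝ] (Mink →L[ℝ] R) :=
  ((ContinuousLinearMap.compL ℝ Mink R R).comp (ContinuousLinearMap.mul ℝ R).flip).flip

/-- `(w, L) ↦ (v ↦ w * L v)`. -/
def actL : R →L[ℝ] (Mink →L[ℝ] R) →L[ℝ] (Mink →L[ℝ] R) :=
  (ContinuousLinearMap.compL ℝ Mink R R).comp (ContinuousLinearMap.mul ℝ R)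

/-- Evaluation of a continuous linear map, as a bilinear map. -/
abbrev evalB (X Y : Type) [NormedAddCommGroup X] [NormedSpace ℝ X] [NormedAddCommGroup Y]
    [NormedSpace ℝ Y] : (X →L[ℝ] Y) →L[ℝ] X →L[ℝ] Y :=
  ContinuousLinearMap.id ℝ (X →L[ℝ] Y)

/-- The derivative as a continuous map. -/
def fderivC {X Y : Type} [NormedAddCommGroup X] [NormedSpace ℝ X] [NormedAddCommGroup Y]
    [NormedSpace ℝ Y] (f : C(X, Y)) (hf : ContDiff ℝ ∞ f) : C(X, X →L[ℝ] Y) :=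
  ⟨fderiv ℝ f, hf.continuous_fderiv (by simp)⟩

variable {p : ℝ≥0∞} [Fact (1 ≤ p)] (A : C(Mink, Mink →L[ℝ] R))

/-- The Volterra operator `w ↦ ∫₀ᵗ A(σ(s))(σ̇(s)) w(s) ds` of parallel transport. -/
def connOp (σ : Curve p) : C(unitInterval, R) →L[ℝ] C(unitInterval, R) :=
  (volterra (Curve.velL1 σ)).comp (pointwise actR (A.comp (Curve.posL σ)))

theorem connOp_apply (σ : Curve p) (w : C(unitInterval, R)) (t : unitInterval) :
    connOp A σ w t = ∫ s in (0 : ℝ)..t, A (σ.val s) (σ.vel s) * extendI w s := by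
  refine (volterra_apply _ _ _).trans (integral_congr_ae_leb t ?_)
  filter_upwards [σ.coeFn_velL1] with s hs
  rw [hs, ← Curve.extendI_posL]
  rfl

theorem integrable_conn (σ : Curve p) : Integrable (fun s => A (σ.val s) (σ.vel s)) leb :=
  integrable_clm_apply (A.continuous.comp_continuousOn σ.hasWeakDeriv.continuousOn)
    σ.hasWeakDeriv.integrable

theorem isUnit_one_add_connOp [CompleteSpace R] (σ : Curve p) : IsUnit (1 + connOp A σ) := by
  refine isUnit_one_add_of_volterra (connOp A σ) (integrable_conn A σ).norm
    (fun s => norm_nonneg _) fun w t => ?_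
  rw [connOp_apply]
  refine intervalIntegral.norm_integral_le_of_norm_le t.2.1
    (.of_forall fun s _ => norm_mul_le _ _) ?_
  exact (intervalIntegrable_of_integrable_leb (integrable_conn A σ).norm (by simp) t.2).mul_continuousOn
    (continuous_extendI w.continuous).norm.continuousOn

/-- The parallel transport `t ↦ U_{t,0}(σ)`. -/
def transportC (σ : Curve p) : C(unitInterval, R) := Ring.inverse (1 + connOp A σ) 1

theorem transportC_add_connOp [CompleteSpace R] (σ : Curve p) :
    transportC A σ + connOp A σ (transportC A σ) = 1 := by
  have h := Ring.mul_inverse_cancel _ (isUnit_one_add_connOp A σ)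
  exact congrArg (fun T : C(unitInterval, R) →L[ℝ] C(unitInterval, R) => T 1) h

theorem eq_transportC [CompleteSpace R] {σ : Curve p} {w : C(unitInterval, R)}
    (h : w + connOp A σ w = 1) : w = transportC A σ := by
  have h1 := Ring.inverse_mul_cancel _ (isUnit_one_add_connOp A σ)
  have h2 := congrArg (fun T : C(unitInterval, R) →L[ℝ] C(unitInterval, R) => T w) h1
  rw [transportC, ← h]
  exact h2.symm

theorem contDiff_comp_posL {Y : Type} [NormedAddCommGroup Y] [NormedSpace ℝ Y] {f : C(Mink, Y)}
    (hf : ContDiff ℝ ∞ f) : ContDiff ℝ ∞ fun σ : Curve p => f.comp (Curve.posL σ) :=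
  (contDiff_comp_left f hf).comp Curve.posL.contDiff

variable {A} (hA : ContDiff ℝ ∞ A)
include hA

theorem contDiff_connOp : ContDiff ℝ ∞ (connOp (p := p) A) :=
  contDiff_bilin_comp volterra (pointwise (actR (R := R))) Curve.velL1.contDiff
    (contDiff_comp_posL hA)

/-- Inversion of bounded operators is smooth at units, and the connection operator is bilinear in σ̇
and A ∘ σ, both smooth in σ. -/
theorem contDiff_transportC [CompleteSpace R] : ContDiff ℝ ∞ (transportC (p := p) A) := by
  have h : ContDiff ℝ ∞ fun σ : Curve p => Ring.inverse (1 + connOp A σ) := by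
    rw [contDiff_iff_contDiffAt]
    intro σ
    obtain ⟨x, hx⟩ := isUnit_one_add_connOp A σ
    have := contDiffAt_ringInverse (n := ∞) ℝ
      (R := C(unitInterval, R) →L[ℝ] C(unitInterval, R)) x
    rw [hx] at this
    exact this.comp σ (contDiff_const.add (contDiff_connOp hA)).contDiffAt
  exact h.clm_apply contDiff_const

end Algebra

theorem fderiv_bilin_apply {E X Y Z : Type*} [NormedAddCommGroup E] [NormedSpace ℝ E]
    [NormedAddCommGroup X] [NormedSpace ℝ X] [NormedAddCommGroup Y] [NormedSpace ℝ Y]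
    [NormedAddCommGroup Z] [NormedSpace ℝ Z] (B : X →L[ℝ] Y →L[ℝ] Z) {f : E → X} {g : E → Y}
    {x : E} (hf : DifferentiableAt ℝ f x) (hg : DifferentiableAt ℝ g x) (u : E) :
    fderiv ℝ (fun y => B (f y) (g y)) x u = B (fderiv ℝ f x u) (g x) + B (f x) (fderiv ℝ g x u) := by
  rw [(B.hasFDerivAt_of_bilinear hf.hasFDerivAt hg.hasFDerivAt).fderiv]
  simp [add_comm]

theorem contDiff_bilin {E X Y Z : Type*} [NormedAddCommGroup E] [NormedSpace ℝ E]
    [NormedAddCommGroup X] [NormedSpace ℝ X] [NormedAddCommGroup Y] [NormedSpace ℝ Y]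
    [NormedAddCommGroup Z] [NormedSpace ℝ Z] (B : X →L[ℝ] Y →L[ℝ] Z) {f : E → X} {g : E → Y}
    {n : WithTop ℕ∞} (hf : ContDiff ℝ n f) (hg : ContDiff ℝ n g) :
    ContDiff ℝ n fun y => B (f y) (g y) :=
  (B.contDiff.comp hf).clm_apply hg

/-- Implicit differentiation. The integral equation of parallel transport is the case of T the
Volterra map, S the pointwise product, h the velocity and f(σ) = A ∘ σ. -/
theorem fderiv_eq_of_add_bilin_eq {E L C₀ C₁ D : Type*} [NormedAddCommGroup E] [NormedSpace ℝ E]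
    [NormedAddCommGroup L] [NormedSpace ℝ L] [NormedAddCommGroup C₀] [NormedSpace ℝ C₀]
    [NormedAddCommGroup C₁] [NormedSpace ℝ C₁] [NormedAddCommGroup D] [NormedSpace ℝ D]
    (T : L →L[ℝ] C₁ →L[ℝ] C₀) (S : D →L[ℝ] C₀ →L[ℝ] C₁) (h : E →L[ℝ] L) {f : E → D} {W : E → C₀}
    (hf : Differentiable ℝ f) (hW : Differentiable ℝ W) {c : C₀}
    (H : ∀ σ, W σ + T (h σ) (S (f σ) (W σ)) = c) (σ u : E) :
    fderiv ℝ W σ u = -(T (h u) (S (f σ) (W σ)) + T (h σ) (S (fderiv ℝ f σ u) (W σ)) +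
      T (h σ) (S (f σ) (fderiv ℝ W σ u))) := by
  have d1 : Differentiable ℝ fun σ => S (f σ) (W σ) := (S.differentiable.comp hf).clm_apply hW
  have d2 : Differentiable ℝ fun σ => T (h σ) (S (f σ) (W σ)) :=
    (T.differentiable.comp h.differentiable).clm_apply d1
  have h1 : fderiv ℝ (fun σ => W σ + T (h σ) (S (f σ) (W σ))) σ u = 0 := by
    simp [funext H]
  rw [fderiv_fun_add (hW σ) (d2 σ), add_apply,
    fderiv_bilin_apply T h.differentiableAt (d1 σ), fderiv_bilin_apply S (hf σ) (hW σ),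
    ContinuousLinearMap.fderiv, map_add] at h1
  rw [add_assoc]
  exact eq_neg_of_add_eq_zero_left h1

theorem fderiv_comp_posL {p : ℝ≥0∞} [Fact (1 ≤ p)] {Y : Type} [NormedAddCommGroup Y]
    [NormedSpace ℝ Y] {f : C(Mink, Y)} (hf : ContDiff ℝ ∞ f) (σ u : Curve p) :
    fderiv ℝ (fun σ : Curve p => f.comp (Curve.posL σ)) σ u =
      pointwise (evalB Mink Y) ((fderivC f hf).comp (Curve.posL σ)) (Curve.posL u) := by
  have h := hasFDerivAt_comp_left (α := unitInterval) f (fderivC f hf)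
    (fun x => (hf.differentiable (by simp) x).hasFDerivAt) (Curve.posL σ)
  exact congrArg (fun T : Curve p →L[ℝ] C(unitInterval, Y) => T u)
    (h.comp σ Curve.posL.hasFDerivAt).fderiv

/-! ### First derivative of parallel transport: the linearised equation -/

section Derivative

variable {R : Type} [NormedRing R] [NormedAlgebra ℝ R] [CompleteSpace R]
  {p : ℝ≥0∞} [Fact (1 ≤ p)] {A : C(Mink, Mink →L[ℝ] R)} (hA : ContDiff ℝ ∞ A)

variable (A) in
theorem hasWeakDeriv_transportC (σ : Curve p) :
    HasWeakDeriv (extendI (transportC A σ))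
      (fun t => -(A (σ.val t) (σ.vel t) * extendI (transportC A σ) t)) := by
  have h := (HasWeakDeriv.const (1 : R)).sub (hasWeakDeriv_volterra (Curve.velL1 σ)
    (pointwise actR (A.comp (Curve.posL σ)) (transportC A σ)))
  refine (h.congr fun t ht => ?_).congr_deriv ?_
  · have h1 := congrArg (fun w : C(unitInterval, R) => w ⟨t, ht⟩) (transportC_add_connOp A σ)
    rw [extendI, extendI, IccExtend_of_mem _ _ ht, IccExtend_of_mem _ _ ht]
    exact sub_eq_of_eq_add h1.symm
  · filter_upwards [σ.coeFn_velL1] with s hs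
    rw [hs, zero_sub, ← Curve.extendI_posL]
    rfl

theorem extendI_transportC_zero (σ : Curve p) : extendI (transportC A σ) 0 = 1 := by
  have h := congrArg (fun w : C(unitInterval, R) => w 0) (transportC_add_connOp A σ)
  have h1 : connOp A σ (transportC A σ) 0 = 0 := by simp [connOp_apply]
  rw [ContinuousMap.add_apply, h1, add_zero] at h
  exact (extendI_coe (transportC A σ) 0).trans h

include hA

theorem differentiable_transportC : Differentiable ℝ (transportC (p := p) A) :=
  (contDiff_transportC hA).differentiable (by simp)

theorem fderiv_transportC_eq (σ u : Curve p) :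
    fderiv ℝ (transportC A) σ u =
      -(volterra (Curve.velL1 u) (pointwise actR (A.comp (Curve.posL σ)) (transportC A σ)) +
        volterra (Curve.velL1 σ) (pointwise actR (pointwise (evalB Mink (Mink →L[ℝ] R))
          ((fderivC A hA).comp (Curve.posL σ)) (Curve.posL u)) (transportC A σ)) +
        volterra (Curve.velL1 σ) (pointwise actR (A.comp (Curve.posL σ))
          (fderiv ℝ (transportC A) σ u))) := by
  have h := fderiv_eq_of_add_bilin_eq (E := Curve p) (L := Lp Mink 1 leb)
    (C₀ := C(unitInterval, R)) (C₁ := C(unitInterval, Mink →L[ℝ] R))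
    (D := C(unitInterval, Mink →L[ℝ] R)) volterra (pointwise actR)
    Curve.velL1 (f := fun σ => A.comp (Curve.posL σ)) (W := transportC A) (c := 1)
  have h' := h ((contDiff_comp_posL hA).differentiable (by simp))
    (differentiable_transportC (p := p) hA)
  have h'' := h' (fun σ => transportC_add_connOp A σ) σ u
  have e := fderiv_comp_posL hA σ u
  rw [e] at h''
  exact h''

/-- The linearised transport equation: the three terms come from varying the velocity, the point at
which A is evaluated, and the transport itself. -/
theorem hasWeakDeriv_fderiv_transportC (σ u : Curve p) :
    HasWeakDeriv (extendI (fderiv ℝ (transportC A) σ u))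
      (fun t => -(A (σ.val t) (u.vel t) * extendI (transportC A σ) t +
        fderiv ℝ A (σ.val t) (u.val t) (σ.vel t) * extendI (transportC A σ) t +
        A (σ.val t) (σ.vel t) * extendI (fderiv ℝ (transportC A) σ u) t)) := by
  have e := fderiv_transportC_eq hA σ u
  have h := (((hasWeakDeriv_volterra (Curve.velL1 u)
      (pointwise actR (A.comp (Curve.posL σ)) (transportC A σ))).add
    (hasWeakDeriv_volterra (Curve.velL1 σ) (pointwise actR (pointwise (evalB Mink (Mink →L[ℝ] R))
          ((fderivC A hA).comp (Curve.posL σ)) (Curve.posL u)) (transportC A σ)))).add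
    (hasWeakDeriv_volterra (Curve.velL1 σ) (pointwise actR (A.comp (Curve.posL σ))
          (fderiv ℝ (transportC A) σ u)))).neg
  refine (h.congr fun t ht => ?_).congr_deriv ?_
  · simp only [extendI, IccExtend_of_mem _ _ ht]
    exact congrArg (fun w : C(unitInterval, R) => w ⟨t, ht⟩) e.symm
  · filter_upwards [σ.coeFn_velL1, u.coeFn_velL1] with s hs hu
    rw [hs, hu, ← Curve.extendI_posL, ← Curve.extendI_posL]
    rfl

theorem extendI_fderiv_transportC_zero (σ u : Curve p) :
    extendI (fderiv ℝ (transportC A) σ u) 0 = 0 := by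
  refine (extendI_coe (fderiv ℝ (transportC A) σ u) 0).trans ?_
  rw [fderiv_transportC_eq hA σ u]
  simp [volterra_apply]

end Derivative

/-! ### The curvature two-form -/

section Curvature

variable {R : Type} [NormedRing R] [NormedAlgebra ℝ R]

/-- The commutator `(u, v) ↦ L u * M v - M v * L u`. -/
def commB (L M : Mink →L[ℝ] R) : Mink →L[ℝ] Mink →L[ℝ] R :=
  (((ContinuousLinearMap.mul ℝ R).comp L).flip.comp M).flip -
    (((ContinuousLinearMap.mul ℝ R).flip.comp L).flip.comp M).flip

/-- The curvature two-form `F(u, v) = ∂_u A(v) - ∂_v A(u) + [A(u), A(v)]`. -/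
def curvForm (A : Mink → Mink →L[ℝ] R) (x : Mink) : Mink →L[ℝ] Mink →L[ℝ] R :=
  fderiv ℝ A x - (fderiv ℝ A x).flip + commB (A x) (A x)

theorem curvForm_apply (A : Mink → Mink →L[ℝ] R) (x u v : Mink) : curvForm A x u v =
    fderiv ℝ A x u v - fderiv ℝ A x v u + (A x u * A x v - A x v * A x u) := rfl

theorem contDiff_curvForm {A : Mink → Mink →L[ℝ] R} (hA : ContDiff ℝ ∞ A) :
    ContDiff ℝ ∞ (curvForm A) := by
  have h : ContDiff ℝ ∞ (fderiv ℝ A) := hA.fderiv_right (m := ∞) (by simp)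
  refine contDiff_clm_apply_iff.2 fun u => contDiff_clm_apply_iff.2 fun v => ?_
  have h1 : ∀ u, ContDiff ℝ ∞ fun x => A x u := fun u => hA.clm_apply contDiff_const
  have h2 : ∀ u v, ContDiff ℝ ∞ fun x => fderiv ℝ A x u v := fun u v =>
    (h.clm_apply contDiff_const).clm_apply contDiff_const
  exact ((h2 u v).sub (h2 v u)).add (((h1 u).mul (h1 v)).sub ((h1 v).mul (h1 u)))

variable (R) in
/-- The space of bilinear forms on Minkowski space, as a normed space. -/
def TwoForm : Type := Mink →L[ℝ] Mink →L[ℝ] R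

instance : NormedAddCommGroup (TwoForm R) :=
  inferInstanceAs (NormedAddCommGroup (Mink →L[ℝ] Mink →L[ℝ] R))

instance : NormedSpace ℝ (TwoForm R) :=
  inferInstanceAs (NormedSpace ℝ (Mink →L[ℝ] Mink →L[ℝ] R))

variable (R) in
/-- Evaluation of a bilinear form at the first argument. -/
def evalTwo : TwoForm R →L[ℝ] Mink →L[ℝ] (Mink →L[ℝ] R) :=
  ContinuousLinearMap.id ℝ (Mink →L[ℝ] Mink →L[ℝ] R)

/-- The curvature as a continuous map. -/
def curvC (A : C(Mink, Mink →L[ℝ] R)) (hA : ContDiff ℝ ∞ A) : C(Mink, TwoForm R) :=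
  ⟨curvForm A, (contDiff_curvForm hA).continuous⟩

theorem contDiff_curvC {A : C(Mink, Mink →L[ℝ] R)} (hA : ContDiff ℝ ∞ A) :
    ContDiff ℝ ∞ (curvC A hA) := contDiff_curvForm hA

end Curvature

/-! ### Unitarity of parallel transport and Duhamel's formula -/

section Unitary

variable {R : Type} [NormedRing R] [NormedAlgebra ℝ R] [FiniteDimensional ℝ R] [CompleteSpace R]
  [StarRing R] [NormedStarGroup R] [StarModule ℝ R]
  {p : ℝ≥0∞} [Fact (1 ≤ p)] {A : C(Mink, Mink →L[ℝ] R)}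

variable (R) in
/-- The involution as a continuous linear map. -/
def starCLM : R →L[ℝ] R := (starL' ℝ : R ≃L[ℝ] R)

@[simp] theorem starCLM_apply (x : R) : starCLM R x = star x := rfl

variable (R) in
/-- The pointwise involution on continuous functions. -/
def starC : C(unitInterval, R) →L[ℝ] C(unitInterval, R) :=
  (starCLM R).compLeftContinuous ℝ unitInterval

variable (hs : ∀ x v, star (A x v) = -A x v)
include hs

theorem hasWeakDeriv_star_transportC (σ : Curve p) :
    HasWeakDeriv (fun t => star (extendI (transportC A σ) t))
      (fun t => star (extendI (transportC A σ) t) * A (σ.val t) (σ.vel t)) := by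
  refine ((hasWeakDeriv_transportC A σ).clm_apply (starCLM R)).congr_deriv (.of_forall fun t => ?_)
  simp [hs]

/-- The derivative of U*U vanishes because A is skew-adjoint, and U starts at 1. -/
theorem star_transportC_mul (σ : Curve p) {t : ℝ} (ht : t ∈ Icc (0 : ℝ) 1) :
    star (extendI (transportC A σ) t) * extendI (transportC A σ) t = 1 := by
  have h := ((hasWeakDeriv_star_transportC hs σ).mul (hasWeakDeriv_transportC A σ)).congr_deriv
    (g' := fun _ => 0) (.of_forall fun t => by noncomm_ring)
  rw [h.eq_of_deriv_zero ht, extendI_transportC_zero]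
  simp

/-- In a finite-dimensional algebra, which is Noetherian, a one-sided inverse is two-sided. -/
theorem transportC_mul_star (σ : Curve p) {t : ℝ} (ht : t ∈ Icc (0 : ℝ) 1) :
    extendI (transportC A σ) t * star (extendI (transportC A σ) t) = 1 := by
  have : IsNoetherianRing R := isNoetherian_of_tower ℝ inferInstance
  exact mul_eq_one_comm.1 (star_transportC_mul hs σ ht)

omit hs
variable (hA : ContDiff ℝ ∞ A)

/-- `∫₀ᵗ U_{0,s} F(u(s), σ̇(s)) U_{s,0} ds`. -/
def curvInt (σ u : Curve p) : C(unitInterval, R) :=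
  volterra (Curve.velL1 σ) (pointwise actL (starC R (transportC A σ))
    (pointwise actR (pointwise (evalTwo R) ((curvC A hA).comp (Curve.posL σ))
      (Curve.posL u)) (transportC A σ)))

theorem hasWeakDeriv_curvInt (σ u : Curve p) :
    HasWeakDeriv (extendI (curvInt hA σ u)) (fun t => star (extendI (transportC A σ) t) *
      (curvForm A (σ.val t) (u.val t) (σ.vel t) * extendI (transportC A σ) t)) := by
  refine (hasWeakDeriv_volterra _ _).congr_deriv ?_
  filter_upwards [σ.coeFn_velL1] with s hs
  rw [hs, ← Curve.extendI_posL, ← Curve.extendI_posL]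
  rfl

theorem extendI_curvInt_zero (σ u : Curve p) : extendI (curvInt hA σ u) 0 = 0 := by
  refine (extendI_coe (curvInt hA σ u) 0).trans ?_
  simp [volterra_apply, curvInt]

theorem hasWeakDeriv_conn (f : C(Mink, Mink →L[ℝ] R)) (hf : ContDiff ℝ ∞ f) (σ u : Curve p) :
    HasWeakDeriv (fun t => f (σ.val t) (u.val t)) (fun t =>
      fderiv ℝ f (σ.val t) (σ.vel t) (u.val t) + f (σ.val t) (u.vel t)) :=
  (σ.hasWeakDeriv.comp (Φ := f) (hf.of_le (by simp))).bilin (evalB Mink R) u.hasWeakDeriv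

include hs

/-- The sum of U*·dU(u), U*A(u)U and the curvature integral has zero derivative: the terms A(u̇)
cancel, and what remains of the first two is exactly -U*F(u,σ̇)U. All three vanish at time 0. -/
theorem star_mul_fderiv_transportC (σ u : Curve p) {t : ℝ} (ht : t ∈ Icc (0 : ℝ) 1) :
    star (extendI (transportC A σ) t) * extendI (fderiv ℝ (transportC A) σ u) t =
      -(star (extendI (transportC A σ) t) *
        (A (σ.val t) (u.val t) * extendI (transportC A σ) t) + extendI (curvInt hA σ u) t) := by
  have hW := hasWeakDeriv_transportC A σ
  have hV := hasWeakDeriv_star_transportC hs σ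
  have h := ((hV.mul (hasWeakDeriv_fderiv_transportC hA σ u)).add
    ((hV.mul ((hasWeakDeriv_conn A hA σ u).mul hW)).add (hasWeakDeriv_curvInt hA σ u))).congr_deriv
    (g' := fun _ => 0) (.of_forall fun t => by
      simp only [curvForm_apply]
      noncomm_ring)
  have h1 := h.eq_of_deriv_zero ht
  rw [extendI_fderiv_transportC_zero hA, extendI_curvInt_zero, u.val_zero] at h1
  refine eq_neg_of_add_eq_zero_left (h1.trans ?_)
  simp

theorem fderiv_transportC_apply (σ u : Curve p) {t : ℝ} (ht : t ∈ Icc (0 : ℝ) 1) :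
    extendI (fderiv ℝ (transportC A) σ u) t =
      -(A (σ.val t) (u.val t) * extendI (transportC A σ) t +
        extendI (transportC A σ) t * extendI (curvInt hA σ u) t) := by
  have h := congrArg (fun x => extendI (transportC A σ) t * x)
    (star_mul_fderiv_transportC hs hA σ u ht)
  simp only [← mul_assoc, transportC_mul_star hs σ ht, one_mul, mul_neg, mul_add] at h
  rw [h, neg_add]

end Unitary

/-- The product rule for σ ↦ ∫ U* F(u,σ̇) U, whose four σ-dependent factors are the velocity, U*, F
∘ σ and U, stated over abstract normed spaces. -/
theorem fderiv_sandwich_apply {E L C₀ C₁ C₂ D M : Type*} [NormedAddCommGroup E] [NormedSpace ℝ E]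
    [NormedAddCommGroup L] [NormedSpace ℝ L] [NormedAddCommGroup C₀] [NormedSpace ℝ C₀]
    [NormedAddCommGroup C₁] [NormedSpace ℝ C₁] [NormedAddCommGroup C₂] [NormedSpace ℝ C₂]
    [NormedAddCommGroup D] [NormedSpace ℝ D] [NormedAddCommGroup M] [NormedSpace ℝ M]
    (T : L →L[ℝ] C₁ →L[ℝ] C₂) (S : C₀ →L[ℝ] C₀) (Le : C₀ →L[ℝ] C₁ →L[ℝ] C₁)
    (Ri : C₁ →L[ℝ] C₀ →L[ℝ] C₁) (Ev : D →L[ℝ] M →L[ℝ] C₁) (h : E →L[ℝ] L) {f : E → D} {W : E → C₀}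
    (hf : Differentiable ℝ f) (hW : Differentiable ℝ W) (c : M) (σ v : E) :
    fderiv ℝ (fun σ => T (h σ) (Le (S (W σ)) (Ri (Ev (f σ) c) (W σ)))) σ v =
      T (h v) (Le (S (W σ)) (Ri (Ev (f σ) c) (W σ))) +
      (T (h σ) (Le (S (fderiv ℝ W σ v)) (Ri (Ev (f σ) c) (W σ))) +
      (T (h σ) (Le (S (W σ)) (Ri (Ev (fderiv ℝ f σ v) c) (W σ))) +
        T (h σ) (Le (S (W σ)) (Ri (Ev (f σ) c) (fderiv ℝ W σ v))))) := by
  have d0 : Differentiable ℝ fun σ => Ev (f σ) c :=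
    (Ev.differentiable.comp hf).clm_apply (differentiable_const c)
  have d1 : Differentiable ℝ fun σ => Ri (Ev (f σ) c) (W σ) :=
    (Ri.differentiable.comp d0).clm_apply hW
  have d2 : Differentiable ℝ fun σ => S (W σ) := S.differentiable.comp hW
  have d3 : Differentiable ℝ fun σ => Le (S (W σ)) (Ri (Ev (f σ) c) (W σ)) :=
    (Le.differentiable.comp d2).clm_apply d1
  have e0 : fderiv ℝ (fun σ => S (W σ)) σ = S.comp (fderiv ℝ W σ) :=
    (S.hasFDerivAt.comp σ (hW σ).hasFDerivAt).fderiv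
  rw [fderiv_bilin_apply T h.differentiableAt (d3 σ), fderiv_bilin_apply Le (d2 σ) (d1 σ),
    fderiv_bilin_apply Ri (d0 σ) (hW σ),
    fderiv_bilin_apply Ev (hf σ) (differentiableAt_const c), e0]
  simp

theorem contDiff_sandwich {E L C₀ C₁ C₂ D M : Type*} [NormedAddCommGroup E] [NormedSpace ℝ E]
    [NormedAddCommGroup L] [NormedSpace ℝ L] [NormedAddCommGroup C₀] [NormedSpace ℝ C₀]
    [NormedAddCommGroup C₁] [NormedSpace ℝ C₁] [NormedAddCommGroup C₂] [NormedSpace ℝ C₂]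
    [NormedAddCommGroup D] [NormedSpace ℝ D] [NormedAddCommGroup M] [NormedSpace ℝ M]
    (T : L →L[ℝ] C₁ →L[ℝ] C₂) (S : C₀ →L[ℝ] C₀) (Le : C₀ →L[ℝ] C₁ →L[ℝ] C₁)
    (Ri : C₁ →L[ℝ] C₀ →L[ℝ] C₁) (Ev : D →L[ℝ] M →L[ℝ] C₁) (h : E →L[ℝ] L) {f : E → D} {W : E → C₀}
    (hf : ContDiff ℝ ∞ f) (hW : ContDiff ℝ ∞ W) (c : M) :
    ContDiff ℝ ∞ fun σ => T (h σ) (Le (S (W σ)) (Ri (Ev (f σ) c) (W σ))) :=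
  contDiff_bilin T h.contDiff (contDiff_bilin Le (S.contDiff.comp hW)
    (contDiff_bilin Ri (contDiff_bilin Ev hf contDiff_const) hW))

theorem extendI_add {V : Type*} [TopologicalSpace V] [Add V] [ContinuousAdd V]
    (f g : C(unitInterval, V)) (t : ℝ) : extendI ⇑(f + g) t = extendI f t + extendI g t := rfl

/-! ### Second derivative of parallel transport -/

section SecondDerivative

variable {R : Type} [NormedRing R] [NormedAlgebra ℝ R] [FiniteDimensional ℝ R] [CompleteSpace R]
  [StarRing R] [NormedStarGroup R] [StarModule ℝ R]
  {p : ℝ≥0∞} [Fact (1 ≤ p)] {A : C(Mink, Mink →L[ℝ] R)}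

/-- The covariant derivative `∇_w F(u, v)` of the curvature. -/
def covCurv (A : Mink → Mink →L[ℝ] R) (x w u v : Mink) : R :=
  fderiv ℝ (curvForm A) x w u v + (A x w * curvForm A x u v - curvForm A x u v * A x w)

theorem extendI_sandwich (V W : C(unitInterval, R)) (F : C(unitInterval, TwoForm R))
    (u : C(unitInterval, Mink)) (t : ℝ) (x : Mink) :
    extendI (pointwise actL V (pointwise actR (pointwise (evalTwo R) F u) W)) t x =
      extendI V t * (evalTwo R (extendI F t) (extendI u t) x * extendI W t) := rfl

variable (hA : ContDiff ℝ ∞ A)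

theorem contDiff_curvInt (u : Curve p) : ContDiff ℝ ∞ fun σ : Curve p => curvInt hA σ u := by
  have h := contDiff_sandwich (E := Curve p) (L := Lp Mink 1 leb) (C₀ := C(unitInterval, R))
    (C₁ := C(unitInterval, Mink →L[ℝ] R)) (C₂ := C(unitInterval, R))
    (D := C(unitInterval, TwoForm R)) (M := C(unitInterval, Mink)) volterra
    (starC R) (pointwise actL) (pointwise actR) (pointwise (evalTwo R))
    Curve.velL1 (f := fun σ => (curvC A hA).comp (Curve.posL σ)) (W := transportC A)
  have h' := h (contDiff_comp_posL (contDiff_curvC hA))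
    (contDiff_transportC hA) (Curve.posL u)
  exact h'

theorem fderiv_curvInt_eq (σ u v : Curve p) :
    fderiv ℝ (fun σ : Curve p => curvInt hA σ u) σ v =
      volterra (Curve.velL1 v) (pointwise actL (starC R (transportC A σ))
        (pointwise actR (pointwise (evalTwo R) ((curvC A hA).comp (Curve.posL σ))
          (Curve.posL u)) (transportC A σ))) +
      (volterra (Curve.velL1 σ) (pointwise actL (starC R (fderiv ℝ (transportC A) σ v))
        (pointwise actR (pointwise (evalTwo R) ((curvC A hA).comp (Curve.posL σ))
          (Curve.posL u)) (transportC A σ))) +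
      (volterra (Curve.velL1 σ) (pointwise actL (starC R (transportC A σ))
        (pointwise actR (pointwise (evalTwo R)
          (pointwise (evalB Mink (TwoForm R))
            ((fderivC (curvC A hA) (contDiff_curvC hA)).comp (Curve.posL σ)) (Curve.posL v))
          (Curve.posL u)) (transportC A σ))) +
      volterra (Curve.velL1 σ) (pointwise actL (starC R (transportC A σ))
        (pointwise actR (pointwise (evalTwo R) ((curvC A hA).comp (Curve.posL σ))
          (Curve.posL u)) (fderiv ℝ (transportC A) σ v))))) := by
  have h := fderiv_sandwich_apply (E := Curve p) (L := Lp Mink 1 leb) (C₀ := C(unitInterval, R))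
    (C₁ := C(unitInterval, Mink →L[ℝ] R)) (C₂ := C(unitInterval, R))
    (D := C(unitInterval, TwoForm R)) (M := C(unitInterval, Mink)) volterra
    (starC R) (pointwise actL) (pointwise actR) (pointwise (evalTwo R))
    Curve.velL1 (f := fun σ => (curvC A hA).comp (Curve.posL σ)) (W := transportC A)
  have hF : ContDiff ℝ ∞ fun σ : Curve p => (curvC A hA).comp (Curve.posL σ) :=
    contDiff_comp_posL (contDiff_curvC hA)
  have h' := h (hF.differentiable (by simp)) (differentiable_transportC hA) (Curve.posL u) σ v
  have e := fderiv_comp_posL (contDiff_curvC hA) σ v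
  rw [e] at h'
  exact h'

theorem hasWeakDeriv_fderiv_curvInt (σ u v : Curve p) :
    HasWeakDeriv (extendI (fderiv ℝ (fun σ : Curve p => curvInt hA σ u) σ v)) (fun t =>
      star (extendI (transportC A σ) t) *
        (curvForm A (σ.val t) (u.val t) (v.vel t) * extendI (transportC A σ) t) +
      (star (extendI (fderiv ℝ (transportC A) σ v) t) *
        (curvForm A (σ.val t) (u.val t) (σ.vel t) * extendI (transportC A σ) t) +
      (star (extendI (transportC A σ) t) *
        (fderiv ℝ (curvForm A) (σ.val t) (v.val t) (u.val t) (σ.vel t) *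
          extendI (transportC A σ) t) +
      star (extendI (transportC A σ) t) *
        (curvForm A (σ.val t) (u.val t) (σ.vel t) *
          extendI (fderiv ℝ (transportC A) σ v) t)))) := by
  have e := fderiv_curvInt_eq hA σ u v
  have h := (hasWeakDeriv_volterra (Curve.velL1 v) (pointwise actL (starC R (transportC A σ))
        (pointwise actR (pointwise (evalTwo R) ((curvC A hA).comp (Curve.posL σ))
          (Curve.posL u)) (transportC A σ)))).add
      ((hasWeakDeriv_volterra (Curve.velL1 σ) (pointwise actL (starC R (fderiv ℝ (transportC A) σ v))
        (pointwise actR (pointwise (evalTwo R) ((curvC A hA).comp (Curve.posL σ))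
          (Curve.posL u)) (transportC A σ)))).add
      ((hasWeakDeriv_volterra (Curve.velL1 σ) (pointwise actL (starC R (transportC A σ))
        (pointwise actR (pointwise (evalTwo R)
          (pointwise (evalB Mink (TwoForm R))
            ((fderivC (curvC A hA) (contDiff_curvC hA)).comp (Curve.posL σ)) (Curve.posL v))
          (Curve.posL u)) (transportC A σ)))).add
      (hasWeakDeriv_volterra (Curve.velL1 σ) (pointwise actL (starC R (transportC A σ))
        (pointwise actR (pointwise (evalTwo R) ((curvC A hA).comp (Curve.posL σ))
          (Curve.posL u)) (fderiv ℝ (transportC A) σ v))))))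
  refine (h.congr fun t ht => ?_).congr_deriv ?_
  · rw [e]
    simp only [extendI_add]
  · filter_upwards [σ.coeFn_velL1, v.coeFn_velL1] with s hs hv
    have e1 : extendI ((curvC A hA).comp (Curve.posL σ)) s = curvC A hA (σ.val s) := by
      rw [← Curve.extendI_posL σ]
      rfl
    have e2 : extendI (pointwise (evalB Mink (TwoForm R))
        ((fderivC (curvC A hA) (contDiff_curvC hA)).comp (Curve.posL σ)) (Curve.posL v)) s =
        fderiv ℝ (curvForm A) (σ.val s) (v.val s) := by
      rw [← Curve.extendI_posL σ, ← Curve.extendI_posL v]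
      rfl
    rw [extendI_sandwich, extendI_sandwich, extendI_sandwich, extendI_sandwich, hs, hv, e1, e2,
      Curve.extendI_posL u]
    rfl

variable (hs : ∀ x v, star (A x v) = -A x v)

/-- Evaluation at a time, as a continuous linear map. -/
def evalAt (t : ℝ) : C(unitInterval, R) →L[ℝ] R :=
  ContinuousMap.evalCLM ℝ (projIcc 0 1 zero_le_one t)

theorem fderiv_evalAt_comp {f : Curve p → C(unitInterval, R)} (hf : Differentiable ℝ f)
    (L : R →L[ℝ] R) (t : ℝ) (σ v : Curve p) :
    fderiv ℝ (fun σ => L (extendI (f σ) t)) σ v = L (extendI (fderiv ℝ f σ v) t) :=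
  congrArg (fun T : Curve p →L[ℝ] R => T v)
    ((L.comp (evalAt t)).hasFDerivAt.comp σ (hf σ).hasFDerivAt).fderiv

theorem differentiable_evalAt_comp {f : Curve p → C(unitInterval, R)} (hf : Differentiable ℝ f)
    (L : R →L[ℝ] R) (t : ℝ) : Differentiable ℝ fun σ => L (extendI (f σ) t) :=
  fun σ => ((L.comp (evalAt t)).hasFDerivAt.comp σ (hf σ).hasFDerivAt).differentiableAt

include hs

/-- Differentiating U*U = 1 gives (dU)* = -U*·dU·U*, into which Duhamel's formula is inserted. -/
theorem star_fderiv_transportC (σ v : Curve p) {t : ℝ} (ht : t ∈ Icc (0 : ℝ) 1) :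
    star (extendI (fderiv ℝ (transportC A) σ v) t) =
      star (extendI (transportC A σ) t) * A (σ.val t) (v.val t) +
        extendI (curvInt hA σ v) t * star (extendI (transportC A σ) t) := by
  have d := differentiable_transportC (p := p) hA
  have h : fderiv ℝ (fun σ : Curve p => ContinuousLinearMap.mul ℝ R
      (starCLM R (extendI (transportC A σ) t))
      (ContinuousLinearMap.id ℝ R (extendI (transportC A σ) t))) σ v = 0 := by
    simp [star_transportC_mul hs _ ht]
  rw [fderiv_bilin_apply _ (differentiable_evalAt_comp d _ t σ)
    (differentiable_evalAt_comp d _ t σ), fderiv_evalAt_comp d, fderiv_evalAt_comp d] at h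
  rw [ContinuousLinearMap.mul_apply', ContinuousLinearMap.mul_apply', starCLM_apply, starCLM_apply,
    ContinuousLinearMap.id_apply, ContinuousLinearMap.id_apply,
    star_mul_fderiv_transportC hs hA σ v ht] at h
  have h1 := congrArg (fun x => x * star (extendI (transportC A σ) t)) (eq_neg_of_add_eq_zero_left h)
  simpa only [mul_assoc, transportC_mul_star hs σ ht, mul_one, neg_neg, add_mul] using h1

/-- Write G_u for the curvature integral of u. As u(1) = 0, the first derivative of U_1 is -U_1
G_u(1); as v(1) = 0, differentiating it along v gives U_1(G_v G_u - dG_u(v)) at time 1. -/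
theorem fderiv_fderiv_transportC (σ u v : Curve p) (hu : u.val 1 = 0) (hv : v.val 1 = 0) :
    fderiv ℝ (fderiv ℝ fun σ : Curve p => extendI (transportC A σ) 1) σ v u =
      extendI (transportC A σ) 1 * ∫ t, (star (extendI (transportC A σ) t) *
        (curvForm A (σ.val t) (v.val t) (σ.vel t) * extendI (transportC A σ) t)) *
          extendI (curvInt hA σ u) t +
        (star (extendI (transportC A σ) t) *
        (curvForm A (σ.val t) (u.val t) (σ.vel t) * extendI (transportC A σ) t)) *
          extendI (curvInt hA σ v) t -
        star (extendI (transportC A σ) t) *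
          (curvForm A (σ.val t) (u.val t) (v.vel t) * extendI (transportC A σ) t) -
        star (extendI (transportC A σ) t) *
          (covCurv A (σ.val t) (v.val t) (u.val t) (σ.vel t) * extendI (transportC A σ) t) ∂leb := by
  have h1 : (1 : ℝ) ∈ Icc (0 : ℝ) 1 := by simp
  have d := differentiable_transportC (p := p) hA
  have dG : Differentiable ℝ fun σ : Curve p => curvInt hA σ u :=
    (contDiff_curvInt hA u).differentiable (by simp)
  have hf2 : ContDiff ℝ ∞ fun σ : Curve p => extendI (transportC A σ) 1 :=
    (evalAt 1).contDiff.comp (contDiff_transportC hA)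
  have hdf : Differentiable ℝ (fderiv ℝ fun σ : Curve p => extendI (transportC A σ) 1) :=
    (hf2.fderiv_right (m := ∞) (by simp)).differentiable (by simp)
  have e1 : fderiv ℝ (fderiv ℝ fun σ : Curve p => extendI (transportC A σ) 1) σ v u =
      fderiv ℝ (fun σ => fderiv ℝ (fun σ : Curve p => extendI (transportC A σ) 1) σ u) σ v := by
    rw [fderiv_clm_apply (hdf σ) (differentiableAt_const u)]
    simp
  have e2 : (fun σ => fderiv ℝ (fun σ : Curve p => extendI (transportC A σ) 1) σ u) =
      fun σ => (-ContinuousLinearMap.mul ℝ R) (ContinuousLinearMap.id ℝ R (extendI (transportC A σ) 1))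
        (ContinuousLinearMap.id ℝ R (extendI (curvInt hA σ u) 1)) := by
    funext τ
    refine (fderiv_evalAt_comp d (ContinuousLinearMap.id ℝ R) 1 τ u).trans ?_
    rw [ContinuousLinearMap.id_apply, fderiv_transportC_apply hs hA τ u h1, hu]
    simp
  rw [e1, e2, fderiv_bilin_apply _ (differentiable_evalAt_comp d _ 1 σ)
    (differentiable_evalAt_comp dG _ 1 σ), fderiv_evalAt_comp d, fderiv_evalAt_comp dG]
  -- Writing the product G_v G_u at time 1 as the integral of its derivative merges it with dG_u(v)
  -- into one integral.
  have k := ((hasWeakDeriv_curvInt hA σ v).mul (hasWeakDeriv_curvInt hA σ u)).sub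
    (hasWeakDeriv_fderiv_curvInt hA σ u v)
  have k1 := k.eq_add_integral h1
  have k0 : extendI (fderiv ℝ (fun σ : Curve p => curvInt hA σ u) σ v) 0 = 0 := by
    refine (extendI_coe (fderiv ℝ (fun σ : Curve p => curvInt hA σ u) σ v) 0).trans ?_
    rw [fderiv_curvInt_eq hA σ u v]
    simp [volterra_apply]
  rw [← integral_leb_eq, k0, extendI_curvInt_zero, zero_mul, sub_zero, zero_add] at k1
  have k2 : ∀ x y : R, -(x * y) = x * (-y) := fun x y => (mul_neg x y).symm
  rw [fderiv_transportC_apply hs hA σ v h1, hv]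
  simp only [map_zero, zero_mul, zero_add, ContinuousLinearMap.id_apply]
  rw [show (-ContinuousLinearMap.mul ℝ R) (-(extendI (transportC A σ) 1 *
      extendI (curvInt hA σ v) 1)) (extendI (curvInt hA σ u) 1) +
      (-ContinuousLinearMap.mul ℝ R) (extendI (transportC A σ) 1)
        (extendI (fderiv ℝ (fun σ : Curve p => curvInt hA σ u) σ v) 1) =
      extendI (transportC A σ) 1 * (extendI (curvInt hA σ v) 1 * extendI (curvInt hA σ u) 1 -
        extendI (fderiv ℝ (fun σ : Curve p => curvInt hA σ u) σ v) 1) by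
    simp only [_root_.neg_apply, ContinuousLinearMap.mul_apply', mul_sub, mul_assoc, neg_mul]
    abel, k1]
  congr 1
  refine integral_congr_ae ?_
  filter_upwards [ae_restrict_mem measurableSet_Icc] with t ht
  -- The variations of U* and U contribute commutators of F(u,σ̇) with A(v), which complete ∂_vF to
  -- ∇_vF, and a term G_v·U*F(u,σ̇)U, which cancels half of the derivative of G_v G_u.
  rw [star_fderiv_transportC hA hs σ v ht, fderiv_transportC_apply hs hA σ v ht, covCurv]
  noncomm_ring

end SecondDerivative

/-! ### Gauge fields in components, the transport equations and shrinking of curves -/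

section Transport

variable {R : Type} [NormedRing R] [NormedAlgebra ℝ R] [FiniteDimensional ℝ R] [CompleteSpace R]
  [StarRing R] [NormedStarGroup R] [StarModule ℝ R]

/-- The `R`-valued one-form `A_μ dx^μ`. -/
def connForm (A : Fin 4 → Mink → R) (x : Mink) : Mink →L[ℝ] R :=
  ∑ μ, (EuclideanSpace.proj μ : Mink →L[ℝ] ℝ).smulRight (A μ x)

theorem connForm_apply (A : Fin 4 → Mink → R) (x v : Mink) :
    connForm A x v = ∑ μ, v μ • A μ x := by
  simp [connForm]

theorem contDiff_connForm {A : Fin 4 → Mink → R} (hA : ∀ μ, ContDiff ℝ ∞ (A μ)) :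
    ContDiff ℝ ∞ (connForm A) := by
  refine contDiff_clm_apply_iff.2 fun v => ?_
  simp only [connForm_apply]
  exact ContDiff.sum fun μ _ => (hA μ).const_smul (v μ)

theorem star_connForm {A : Fin 4 → Mink → R} (hA : ∀ μ x, star (A μ x) = -A μ x) (x v : Mink) :
    star (connForm A x v) = -connForm A x v := by
  rw [connForm_apply, star_sum, ← Finset.sum_neg_distrib]
  refine Finset.sum_congr rfl fun μ _ => ?_
  rw [star_smul, star_trivial, hA μ x, smul_neg]

/-- The connection form as a continuous map. -/
def connC (A : Fin 4 → Mink → R) (hA : ∀ μ, ContDiff ℝ ∞ (A μ)) :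
    C(Mink, Mink →L[ℝ] R) := ⟨connForm A, (contDiff_connForm hA).continuous⟩

variable {p : ℝ≥0∞} [Fact (1 ≤ p)] {A : Fin 4 → Mink → R} (hA : ∀ μ, ContDiff ℝ ∞ (A μ))
  (hAsu : ∀ μ x, star (A μ x) = -A μ x)

/-- The parallel transport `t ↦ U_{t,0}(σ)` on `[0,1]`, continued by constants. -/
abbrev holonomy (σ : Curve p) : ℝ → R := extendI (transportC (connC A hA) σ)

/-- The equations of parallel transport with values in `R`; `a t` stands for `A_μ(σ(t)) σ̇^μ(t)`. -/
structure IsTransport (a : ℝ → R) (U : ℝ → ℝ → R) : Prop where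
  ac_left : ∀ s ∈ Icc (0 : ℝ) 1, AbsolutelyContinuousOnInterval (fun t => U t s) s 1
  deriv_left : ∀ s ∈ Icc (0 : ℝ) 1, ∀ᵐ t, t ∈ Ioo s 1 →
    HasDerivAt (fun t => U t s) (-(a t * U t s)) t
  ac_right : ∀ t ∈ Icc (0 : ℝ) 1, AbsolutelyContinuousOnInterval (fun s => U t s) 0 t
  deriv_right : ∀ t ∈ Icc (0 : ℝ) 1, ∀ᵐ s, s ∈ Ioo 0 t →
    HasDerivAt (fun s => U t s) (U t s * a s) s
  diag : ∀ t ∈ Icc (0 : ℝ) 1, U t t = 1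

include hAsu

theorem star_holonomy_mul (σ : Curve p) {t : ℝ} (ht : t ∈ Icc (0 : ℝ) 1) :
    star (holonomy hA σ t) * holonomy hA σ t = 1 :=
  star_transportC_mul (A := connC A hA) (star_connForm hAsu) σ ht

theorem holonomy_mul_star (σ : Curve p) {t : ℝ} (ht : t ∈ Icc (0 : ℝ) 1) :
    holonomy hA σ t * star (holonomy hA σ t) = 1 :=
  transportC_mul_star (A := connC A hA) (star_connForm hAsu) σ ht

/-- The two-time transport is U_{t,s} = U_{t,0} U_{s,0}⁻¹, with the adjoint as inverse. -/
theorem isTransport_holonomy (σ : Curve p) :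
    IsTransport (fun t => connForm A (σ.val t) (σ.vel t)) fun t s => holonomy hA σ t * star (holonomy hA σ s) := by
  have hW := hasWeakDeriv_transportC (connC A hA) σ
  have hV := hasWeakDeriv_star_transportC (A := connC A hA) (star_connForm hAsu) σ
  refine ⟨fun s hs => ?_, fun s hs => ?_, fun t ht => ?_, fun t ht => ?_, fun t ht =>
    holonomy_mul_star hA hAsu σ ht⟩
  · refine (hW.clm_apply ((ContinuousLinearMap.mul ℝ (R)).flip _)).ac.mono ?_
    rw [uIcc_of_le zero_le_one, uIcc_of_le hs.2]
    exact Icc_subset_Icc_left hs.1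
  · filter_upwards [(ae_restrict_iff' measurableSet_Icc).1
      (hW.clm_apply ((ContinuousLinearMap.mul ℝ (R)).flip
        (star (holonomy hA σ s)))).ae_hasDerivAt] with t h ht
    refine (h ⟨hs.1.trans ht.1.le, ht.2.le⟩).congr_deriv ?_
    change -(connForm A (σ.val t) (σ.vel t) * holonomy hA σ t) * star (holonomy hA σ s) = _
    rw [neg_mul, mul_assoc]
  · refine (hV.clm_apply (ContinuousLinearMap.mul ℝ (R) _)).ac.mono ?_
    rw [uIcc_of_le zero_le_one, uIcc_of_le ht.1]
    exact Icc_subset_Icc_right ht.2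
  · filter_upwards [(ae_restrict_iff' measurableSet_Icc).1
      (hV.clm_apply (ContinuousLinearMap.mul ℝ (R) (holonomy hA σ t))).ae_hasDerivAt]
      with s h hs
    refine (h ⟨hs.1.le, hs.2.le.trans ht.2⟩).congr_deriv ?_
    rw [mul_assoc]
    rfl

/-- Uniqueness: multiplying a solution on the left by the adjoint of the holonomy gives a function
with zero derivative. -/
theorem IsTransport.eq_holonomy {σ : Curve p} {U : ℝ → ℝ → R}
    (hU : IsTransport (fun t => connForm A (σ.val t) (σ.vel t)) U) {t : ℝ} (ht : t ∈ Icc (0 : ℝ) 1) :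
    U t 0 = holonomy hA σ t := by
  have h0 : (0 : ℝ) ∈ Icc (0 : ℝ) 1 := by simp
  have hV := hasWeakDeriv_star_transportC (A := connC A hA) (star_connForm hAsu) σ
  have hc : ContinuousOn (fun t => U t 0) (Icc 0 1) := by
    have := (hU.ac_left 0 h0).continuousOn
    rwa [uIcc_of_le zero_le_one] at this
  have h1 : HasWeakDeriv (fun t => U t 0) (fun t => -(connForm A (σ.val t) (σ.vel t) * U t 0)) := by
    refine ⟨hU.ac_left 0 h0, ?_, ?_⟩
    · exact (integrable_clm_apply (φ := fun t => (ContinuousLinearMap.mul ℝ (R)).flip (U t 0))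
        ((ContinuousLinearMap.continuous _).comp_continuousOn hc)
        (integrable_conn (connC A hA) σ)).neg
    · filter_upwards [ae_leb_Ioo, ae_restrict_of_ae (hU.deriv_left 0 h0)] with t ht h
      exact h ht
  have h2 := (hV.mul h1).congr_deriv (g' := fun _ => 0) (.of_forall fun t => by
    change star _ * connForm A _ _ * _ + star _ * -(connForm A _ _ * _) = 0
    noncomm_ring)
  have h3 := h2.eq_of_deriv_zero ht
  rw [hU.diag 0 h0, extendI_transportC_zero, star_one, one_mul] at h3
  have h4 := congrArg (fun x => holonomy hA σ t * x) h3
  simpa only [← mul_assoc, holonomy_mul_star hA hAsu σ ht, one_mul, mul_one] using h4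

omit hAsu

theorem Curve.shrink_val (r : unitInterval) (σ : Curve p) {t : ℝ} (ht : t ∈ Icc (0 : ℝ) 1) :
    (Curve.shrink r σ).val t = σ.val (r * t) := by
  have hrt : (r : ℝ) * t ∈ Icc (0 : ℝ) 1 :=
    ⟨mul_nonneg r.2.1 ht.1, mul_le_one₀ r.2.2 ht.1 ht.2⟩
  rw [Curve.val, extendI, IccExtend_of_mem _ _ ht, Curve.val, extendI, IccExtend_of_mem _ _ hrt]
  rfl

theorem Curve.shrink_vel (r : unitInterval) (σ : Curve p) {t : ℝ} (ht : t ∈ Ioo (0 : ℝ) 1) :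
    (Curve.shrink r σ).vel t = (r : ℝ) • σ.vel (r * t) := by
  have e : (Curve.shrink r σ).val =ᶠ[𝓝 t] fun t => σ.val (r * t) := by
    filter_upwards [Ioo_mem_nhds ht.1 ht.2] with s hs
    exact Curve.shrink_val r σ ⟨hs.1.le, hs.2.le⟩
  rw [Curve.vel, e.deriv_eq]
  exact deriv_comp_mul_left (r : ℝ) σ.val t

/-- The substitution s ↦ rs shows that t ↦ U_{rt,0}(σ) satisfies the integral equation along σ^r,
whose solution is unique. -/
theorem transportC_shrink (r : unitInterval) (σ : Curve p) :
    transportC (connC A hA) (Curve.shrink r σ) =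
      (transportC (connC A hA) σ).comp ⟨fun t => r * t, by fun_prop⟩ := by
  refine (eq_transportC (connC A hA) (σ := Curve.shrink r σ) ?_).symm
  ext1 t
  have h := congrArg (fun w : C(unitInterval, R) => w (r * t))
    (transportC_add_connOp (connC A hA) σ)
  refine Eq.trans ?_ h
  change _ + connOp (connC A hA) (Curve.shrink r σ) _ _ = _ + connOp (connC A hA) σ _ _
  rw [connOp_apply, connOp_apply]
  congr 1
  rw [show ((r * t : unitInterval) : ℝ) = (r : ℝ) * t from rfl]
  -- With the factor r kept outside the integral, the substitution is valid for r = 0 as well.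
  have e := intervalIntegral.smul_integral_comp_mul_left (a := 0) (b := t)
    (fun s => connC A hA (σ.val s) (σ.vel s) * extendI (transportC (connC A hA) σ) s) (r : ℝ)
  rw [mul_zero] at e
  rw [← e, ← intervalIntegral.integral_smul]
  refine integral_congr_ae_leb t ?_
  filter_upwards [ae_leb_Ioo] with s hs
  have hs' : s ∈ Icc (0 : ℝ) 1 := ⟨hs.1.le, hs.2.le⟩
  have hrs : (r : ℝ) * s ∈ Icc (0 : ℝ) 1 :=
    ⟨mul_nonneg r.2.1 hs'.1, mul_le_one₀ r.2.2 hs'.1 hs'.2⟩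
  rw [Curve.shrink_val r σ hs', Curve.shrink_vel r σ hs, map_smul, smul_mul_assoc]
  congr 2
  rw [extendI, extendI, IccExtend_of_mem _ _ hs', IccExtend_of_mem _ _ hrs]
  rfl

theorem holonomy_shrink (r : unitInterval) (σ : Curve p) :
    holonomy hA (Curve.shrink r σ) 1 = holonomy hA σ r := by
  rw [holonomy, transportC_shrink, holonomy, extendI_coe]
  refine (extendI_coe _ (1 : unitInterval)).trans ?_
  change transportC (connC A hA) σ (r * 1) = _
  rw [mul_one]

end Transport

theorem sum_smul_basisVec (u : Mink) : u = ∑ μ, u μ • basisVec μ := by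
  ext ν
  simp [basisVec, Finset.sum_apply, Pi.single_apply]

theorem map_eq_sum_basisVec {Y : Type*} [NormedAddCommGroup Y] [NormedSpace ℝ Y] (L : Mink →L[ℝ] Y)
    (u : Mink) : L u = ∑ μ, u μ • L (basisVec μ) := by
  conv_lhs => rw [sum_smul_basisVec u]
  simp

/-! ### Iterated integrals as integrals over triangles of the square -/

section Fubini

variable {R : Type} [NormedRing R] [NormedAlgebra ℝ R] [CompleteSpace R] {g h : ℝ → R}

theorem integrable_triangle (hg : Integrable g leb) (hh : Integrable h leb) :
    Integrable ({x : ℝ × ℝ | x.2 < x.1}.indicator fun x => g x.1 * h x.2) (leb.prod leb) :=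
  (hg.mul_prod hh).indicator (measurableSet_lt measurable_snd measurable_fst)

/-- This turns iterated curvature integrals into a kernel on the square, as the Volterra part of a
second derivative requires. -/
theorem integral_triangle (hg : Integrable g leb) (hh : Integrable h leb) :
    ∫ x, {x : ℝ × ℝ | x.2 < x.1}.indicator (fun x => g x.1 * h x.2) x ∂(leb.prod leb) =
      ∫ t, g t * (∫ s in (0 : ℝ)..t, h s) ∂leb := by
  rw [integral_prod _ (integrable_triangle hg hh)]
  refine integral_congr_ae ?_
  filter_upwards [ae_restrict_mem measurableSet_Icc] with t ht
  have e : (fun s => {x : ℝ × ℝ | x.2 < x.1}.indicator (fun x => g x.1 * h x.2) (t, s)) =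
      fun s => g t * (Iio t).indicator h s := by
    funext s
    by_cases hs : s < t <;> simp [indicator, hs]
  rw [e, integral_const_mul_of_integrable (hh.indicator measurableSet_Iio),
    integral_indicator measurableSet_Iio, Measure.restrict_restrict measurableSet_Iio,
    intervalIntegral.integral_of_le ht.1, ← integral_Ico_eq_integral_Ioc]
  congr 3
  ext s
  simp only [mem_inter_iff, mem_Iio, mem_Icc, mem_Ico]
  exact ⟨fun h => ⟨h.2.1, h.1⟩, fun h => ⟨h.2, h.1, h.2.le.trans ht.2⟩⟩

theorem integrable_triangle_swap (hg : Integrable g leb) (hh : Integrable h leb) :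
    Integrable ({x : ℝ × ℝ | x.1 < x.2}.indicator fun x => g x.2 * h x.1) (leb.prod leb) :=
  (integrable_triangle hg hh).swap

theorem integral_triangle_swap (hg : Integrable g leb) (hh : Integrable h leb) :
    ∫ x, {x : ℝ × ℝ | x.1 < x.2}.indicator (fun x => g x.2 * h x.1) x ∂(leb.prod leb) =
      ∫ t, g t * (∫ s in (0 : ℝ)..t, h s) ∂leb := by
  rw [← integral_triangle hg hh, ← integral_prod_swap]
  rfl

end Fubini

/-! ### Expansion of the curvature and its covariant derivative in the standard basis -/

section Curvature

variable {R : Type} [NormedRing R] [NormedAlgebra ℝ R]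

theorem curvForm_antisymm (A : Mink → Mink →L[ℝ] R) (x u v : Mink) :
    curvForm A x u v = -curvForm A x v u := by
  simp only [curvForm_apply]
  abel

theorem curvForm_expand (A : Mink → Mink →L[ℝ] R) (x u v : Mink) :
    curvForm A x u v = ∑ μ, u μ • curvForm A x (basisVec μ) v := by
  conv_lhs => rw [map_eq_sum_basisVec (curvForm A x) u]
  simp

theorem curvForm_expand_right (A : Mink → Mink →L[ℝ] R) (x u v : Mink) :
    curvForm A x u v = ∑ μ, v μ • curvForm A x u (basisVec μ) :=
  map_eq_sum_basisVec (curvForm A x u) v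

theorem covCurv_expand (A : Mink → Mink →L[ℝ] R) (x w u v : Mink) :
    covCurv A x w u v = ∑ μ, w μ • covCurv A x (basisVec μ) u v := by
  simp only [covCurv]
  conv_lhs => rw [map_eq_sum_basisVec (fderiv ℝ (curvForm A) x) w, map_eq_sum_basisVec (A x) w]
  simp [smul_add, smul_sub, Finset.sum_add_distrib, Finset.sum_sub_distrib, Finset.sum_mul,
    Finset.mul_sum]

theorem covCurv_expand_middle (A : Mink → Mink →L[ℝ] R) (x w u v : Mink) :
    covCurv A x w u v = ∑ μ, u μ • covCurv A x w (basisVec μ) v := by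
  simp only [covCurv]
  conv_lhs => rw [map_eq_sum_basisVec (fderiv ℝ (curvForm A) x w) u, curvForm_expand]
  simp [smul_add, smul_sub, Finset.sum_add_distrib, Finset.sum_sub_distrib, Finset.sum_mul,
    Finset.mul_sum]

end Curvature

/-! ### Lévy trace of the second derivative of parallel transport -/

section LevyTrace

variable {R : Type} [NormedRing R] [NormedAlgebra ℝ R] [FiniteDimensional ℝ R] [CompleteSpace R]
  [StarRing R] [NormedStarGroup R] [StarModule ℝ R]
  {p : ℝ≥0∞} [Fact (1 ≤ p)] {A : C(Mink, Mink →L[ℝ] R)}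

/-- `X ↦ U_{0,t} X U_{t,0}`. -/
def conjL (A : C(Mink, Mink →L[ℝ] R)) (σ : Curve p) (t : ℝ) : R →L[ℝ] R :=
  (ContinuousLinearMap.mul ℝ R (star (extendI (transportC A σ) t))).comp
    ((ContinuousLinearMap.mul ℝ R).flip (extendI (transportC A σ) t))

theorem conjL_apply (σ : Curve p) (t : ℝ) (X : R) : conjL A σ t X =
    star (extendI (transportC A σ) t) * (X * extendI (transportC A σ) t) := rfl

theorem continuous_conjL (σ : Curve p) : Continuous (conjL A σ) := by
  have h := continuous_extendI (transportC A σ).continuous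
  exact ((ContinuousLinearMap.mul ℝ R).continuous.comp h.star).clm_comp
    ((ContinuousLinearMap.mul ℝ R).flip.continuous.comp h)

/-- `v ↦ ∇_w F(u, v)`. -/
def covCurvL (A : Mink → Mink →L[ℝ] R) (x w u : Mink) : Mink →L[ℝ] R :=
  fderiv ℝ (curvForm A) x w u +
    (actL (A x w) (curvForm A x u) - actR (curvForm A x u) (A x w))

theorem covCurvL_apply (A : Mink → Mink →L[ℝ] R) (x w u v : Mink) :
    covCurvL A x w u v = covCurv A x w u v := rfl

variable (hA : ContDiff ℝ ∞ A)
include hA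

theorem continuousOn_curv (σ : Curve p) {a : ℝ → Mink} (ha : ContinuousOn a (Icc 0 1)) :
    ContinuousOn (fun t => (conjL A σ t).comp (curvForm A (σ.val t) (a t))) (Icc 0 1) :=
  (continuous_conjL σ).continuousOn.clm_comp
    (((contDiff_curvForm hA).continuous.comp_continuousOn σ.hasWeakDeriv.continuousOn).clm_apply ha)

theorem integrable_conjL_curv (σ : Curve p) {a b : ℝ → Mink} (ha : ContinuousOn a (Icc 0 1))
    (hb : Integrable b leb) :
    Integrable (fun t => conjL A σ t (curvForm A (σ.val t) (a t) (b t))) leb :=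
  integrable_clm_apply (continuousOn_curv hA σ ha) hb

theorem integrable_conjL_covCurv (σ : Curve p) {a b c : ℝ → Mink} (ha : ContinuousOn a (Icc 0 1))
    (hb : ContinuousOn b (Icc 0 1)) (hc : Integrable c leb) :
    Integrable (fun t => conjL A σ t (covCurv A (σ.val t) (a t) (b t) (c t))) leb := by
  have hσ := σ.hasWeakDeriv.continuousOn
  have h1 := ((contDiff_curvForm hA).continuous.comp_continuousOn hσ).clm_apply hb
  have h2 := (A.continuous.comp_continuousOn hσ).clm_apply ha
  have h3 := ((((contDiff_curvForm hA).continuous_fderiv (by simp)).comp_continuousOn hσ).clm_apply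
    ha).clm_apply hb
  refine integrable_clm_apply (φ := fun t => (conjL A σ t).comp
    (covCurvL A (σ.val t) (a t) (b t))) ?_ hc
  exact (continuous_conjL σ).continuousOn.clm_comp (h3.add
    ((((actL (R := R)).continuous.comp_continuousOn h2).clm_apply h1).sub
      (((actR (R := R)).continuous.comp_continuousOn h1).clm_apply h2)))

omit hA

theorem sum_sum_smul_mul (a b : Fin 4 → ℝ) (c : R) (x y : Fin 4 → R) :
    ∑ μ, ∑ ν, (a μ * b ν) • (c * x μ * y ν) = c * (∑ μ, a μ • x μ) * ∑ ν, b ν • y ν := by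
  simp only [Finset.mul_sum, Finset.sum_mul, mul_smul_comm, smul_mul_assoc, mul_smul,
    Finset.smul_sum]
  rw [Finset.sum_comm]
  refine Finset.sum_congr rfl fun μ _ => Finset.sum_congr rfl fun ν _ => smul_comm _ _ _

/-- For the other triangle: values in R do not commute, so the factor at the later time must stay on
the left. -/
theorem sum_sum_smul_mul_swap (a b : Fin 4 → ℝ) (c : R) (x y : Fin 4 → R) :
    ∑ μ, ∑ ν, (a μ * b ν) • (c * y ν * x μ) = c * (∑ ν, b ν • y ν) * ∑ μ, a μ • x μ := by
  rw [← sum_sum_smul_mul, Finset.sum_comm]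
  simp only [mul_comm]

theorem sum_sum_curvForm (x u v : Mink) :
    ∑ μ, ∑ ν, (u μ * v ν) • curvForm A x (basisVec μ) (basisVec ν) = curvForm A x u v := by
  rw [curvForm_expand A x u v]
  refine Finset.sum_congr rfl fun μ _ => ?_
  rw [curvForm_expand_right A x _ v, Finset.smul_sum]
  simp only [mul_smul]

theorem sum_sum_covCurv (x w u v : Mink) :
    ∑ μ, ∑ ν, (w μ * u ν) • covCurv A x (basisVec μ) (basisVec ν) v = covCurv A x w u v := by
  rw [covCurv_expand A x w u v]
  refine Finset.sum_congr rfl fun μ _ => ?_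
  rw [covCurv_expand_middle A x _ u v, Finset.smul_sum]
  simp only [mul_smul]

variable (hs : ∀ x v, star (A x v) = -A x v)
include hA hs

theorem fderiv_fderiv_transportC_eq_integrals (σ u v : Curve p) (hu : u.val 1 = 0)
    (hv : v.val 1 = 0) :
    fderiv ℝ (fderiv ℝ fun σ : Curve p => extendI (transportC A σ) 1) σ u v =
      extendI (transportC A σ) 1 *
        ((∫ t, conjL A σ t (curvForm A (σ.val t) (u.val t) (σ.vel t)) *
            extendI (curvInt hA σ v) t ∂leb) +
          (∫ t, conjL A σ t (curvForm A (σ.val t) (v.val t) (σ.vel t)) *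
            extendI (curvInt hA σ u) t ∂leb) -
          (∫ t, conjL A σ t (curvForm A (σ.val t) (v.val t) (u.vel t)) ∂leb) -
          ∫ t, conjL A σ t (covCurv A (σ.val t) (u.val t) (v.val t) (σ.vel t)) ∂leb) := by
  rw [fderiv_fderiv_transportC hA hs σ v u hv hu]
  have hI : ∀ u v : Curve p, Integrable (fun t =>
      conjL A σ t (curvForm A (σ.val t) (u.val t) (σ.vel t)) * extendI (curvInt hA σ v) t) leb :=
    fun u v => integrable_clm_apply (φ := fun t =>
      (ContinuousLinearMap.mul ℝ R).flip (extendI (curvInt hA σ v) t))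
      ((ContinuousLinearMap.continuous _).comp
        (continuous_extendI (curvInt hA σ v).continuous)).continuousOn
      (integrable_conjL_curv hA σ u.hasWeakDeriv.continuousOn σ.hasWeakDeriv.integrable)
  have hJ := integrable_conjL_curv hA σ v.hasWeakDeriv.continuousOn u.hasWeakDeriv.integrable
  have hK := integrable_conjL_covCurv hA σ u.hasWeakDeriv.continuousOn
    v.hasWeakDeriv.continuousOn σ.hasWeakDeriv.integrable
  have hIJ : Integrable (fun t =>
      conjL A σ t (curvForm A (σ.val t) (u.val t) (σ.vel t)) * extendI (curvInt hA σ v) t +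
      conjL A σ t (curvForm A (σ.val t) (v.val t) (σ.vel t)) * extendI (curvInt hA σ u) t) leb :=
    (hI u v).add (hI v u)
  have hIJ' : Integrable (fun t =>
      conjL A σ t (curvForm A (σ.val t) (u.val t) (σ.vel t)) * extendI (curvInt hA σ v) t +
      conjL A σ t (curvForm A (σ.val t) (v.val t) (σ.vel t)) * extendI (curvInt hA σ u) t -
      conjL A σ t (curvForm A (σ.val t) (v.val t) (u.vel t))) leb := hIJ.sub hJ
  rw [← integral_add (hI u v) (hI v u), ← integral_sub hIJ hJ, ← integral_sub hIJ' hK]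
  rfl

/-- Averaging the second derivative over the two orders of (u, v) brings it to the required shape.
Products of two curvatures give the Volterra kernel, the symmetrised -∇F gives the Lévy
coefficients, and F, being antisymmetric, the singular ones. Contraction with the symmetric η
removes the symmetrisation again. -/
theorem hasLevyTrace_transportC (σ : Curve p) :
    HasLevyTrace (fderiv ℝ (fderiv ℝ fun σ : Curve p => extendI (transportC A σ) 1) σ)
      (-(extendI (transportC A σ) 1 * ∫ t, conjL A σ t (∑ μ, ∑ ν, eta μ ν •
        covCurv A (σ.val t) (basisVec μ) (basisVec ν) (σ.vel t)) ∂leb)) := by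
  set W1 := extendI (transportC A σ) 1
  let k : Fin 4 → ℝ → R := fun μ t => conjL A σ t (curvForm A (σ.val t) (basisVec μ) (σ.vel t))
  let c : Fin 4 → Fin 4 → ℝ → R := fun μ ν t =>
    conjL A σ t (covCurv A (σ.val t) (basisVec μ) (basisVec ν) (σ.vel t))
  have hσi := σ.hasWeakDeriv.integrable
  have hk : ∀ μ, Integrable (k μ) leb := fun μ =>
    integrable_conjL_curv hA σ continuousOn_const hσi
  have hc : ∀ μ ν, Integrable (c μ ν) leb := fun μ ν =>
    integrable_conjL_covCurv hA σ continuousOn_const continuousOn_const hσi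
  -- The two indicators order the noncommuting curvatures with the later time on the left.
  refine ⟨fun μ ν x =>
      {x : ℝ × ℝ | x.2 < x.1}.indicator (fun x => W1 * k μ x.1 * k ν x.2) x +
      {x : ℝ × ℝ | x.1 < x.2}.indicator (fun x => W1 * k ν x.2 * k μ x.1) x,
    fun μ ν t => (-(1 / 2 : ℝ)) • (W1 * (c μ ν t + c ν μ t)),
    fun μ ν t => W1 * conjL A σ t (curvForm A (σ.val t) (basisVec μ) (basisVec ν)),
    fun μ ν => ?_, fun μ ν => ?_, fun μ ν => ?_, fun μ ν => ?_, fun μ ν => ?_, fun u v hu hv => ?_,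
    ?_⟩
  · exact (integrable_triangle ((hk μ).const_mul W1) (hk ν)).add
      (integrable_triangle_swap ((hk ν).const_mul W1) (hk μ))
  · exact (((hc μ ν).add (hc ν μ)).const_mul W1).smul (-(1 / 2 : ℝ))
  · have h : ContinuousOn (fun t => W1 * conjL A σ t
        (curvForm A (σ.val t) (basisVec μ) (basisVec ν))) (Icc 0 1) :=
      continuousOn_const.mul ((continuousOn_curv hA σ
        (a := fun _ => basisVec μ) continuousOn_const).clm_apply continuousOn_const)
    obtain ⟨C, hC⟩ := isCompact_Icc.exists_bound_of_continuousOn h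
    refine memLp_top_of_bound (h.aestronglyMeasurable measurableSet_Icc) C ?_
    filter_upwards [ae_restrict_mem measurableSet_Icc] with t ht using hC t ht
  · exact .of_forall fun t => by simp only [add_comm]
  · refine .of_forall fun t => ?_
    simp only [Pi.neg_apply]
    rw [curvForm_antisymm, map_neg, mul_neg]
  · have hg : ∀ u : Curve p, Integrable
        (fun t => conjL A σ t (curvForm A (σ.val t) (u.val t) (σ.vel t))) leb := fun u =>
      integrable_conjL_curv hA σ u.hasWeakDeriv.continuousOn hσi
    have hG : ∀ u : Curve p, ∀ t ∈ Icc (0 : ℝ) 1, ∫ s in (0 : ℝ)..t,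
        conjL A σ s (curvForm A (σ.val s) (u.val s) (σ.vel s)) = extendI (curvInt hA σ u) t := by
      intro u t ht
      rw [(hasWeakDeriv_curvInt hA σ u).eq_add_integral ht, extendI_curvInt_zero, zero_add]
      rfl
    have hgk : ∀ (u : Curve p) t, conjL A σ t (curvForm A (σ.val t) (u.val t) (σ.vel t)) =
        ∑ μ, u.val t μ • k μ t := by
      intro u t
      rw [curvForm_expand]
      simp [k]
    have e1 : ∫ x, ∑ μ, ∑ ν, (u.val x.1 μ * v.val x.2 ν) •
          ({x : ℝ × ℝ | x.2 < x.1}.indicator (fun x => W1 * k μ x.1 * k ν x.2) x +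
          {x : ℝ × ℝ | x.1 < x.2}.indicator (fun x => W1 * k ν x.2 * k μ x.1) x)
            ∂(leb.prod leb) =
        W1 * ((∫ t, conjL A σ t (curvForm A (σ.val t) (u.val t) (σ.vel t)) *
            extendI (curvInt hA σ v) t ∂leb) +
          (∫ t, conjL A σ t (curvForm A (σ.val t) (v.val t) (σ.vel t)) *
            extendI (curvInt hA σ u) t ∂leb)) := by
      have e : (fun x : ℝ × ℝ => ∑ μ, ∑ ν, (u.val x.1 μ * v.val x.2 ν) •
          ({x : ℝ × ℝ | x.2 < x.1}.indicator (fun x => W1 * k μ x.1 * k ν x.2) x +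
          {x : ℝ × ℝ | x.1 < x.2}.indicator (fun x => W1 * k ν x.2 * k μ x.1) x)) = fun x =>
          {x : ℝ × ℝ | x.2 < x.1}.indicator (fun x =>
            W1 * conjL A σ x.1 (curvForm A (σ.val x.1) (u.val x.1) (σ.vel x.1)) *
              conjL A σ x.2 (curvForm A (σ.val x.2) (v.val x.2) (σ.vel x.2))) x +
          {x : ℝ × ℝ | x.1 < x.2}.indicator (fun x =>
            W1 * conjL A σ x.2 (curvForm A (σ.val x.2) (v.val x.2) (σ.vel x.2)) *
              conjL A σ x.1 (curvForm A (σ.val x.1) (u.val x.1) (σ.vel x.1))) x := by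
        funext x
        -- On the diagonal both indicators vanish, so the identity of integrands holds everywhere.
        rcases lt_trichotomy x.1 x.2 with h | h | h
        · simp only [indicator, mem_ofPred_eq, h, h.not_gt, if_true, if_false, zero_add, hgk]
          exact sum_sum_smul_mul_swap _ _ _ _ _
        · simp [indicator, h]
        · simp only [indicator, mem_ofPred_eq, h, h.not_gt, if_true, if_false, add_zero, hgk]
          exact sum_sum_smul_mul _ _ _ _ _
      rw [e, integral_add (integrable_triangle ((hg u).const_mul W1) (hg v))
        (integrable_triangle_swap ((hg v).const_mul W1) (hg u)),
        integral_triangle ((hg u).const_mul W1) (hg v),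
        integral_triangle_swap ((hg v).const_mul W1) (hg u), mul_add]
      simp only [mul_assoc]
      have hI : ∀ u v : Curve p, Integrable (fun t =>
          conjL A σ t (curvForm A (σ.val t) (u.val t) (σ.vel t)) *
            extendI (curvInt hA σ v) t) leb :=
        fun u v => integrable_clm_apply (φ := fun t =>
          (ContinuousLinearMap.mul ℝ R).flip (extendI (curvInt hA σ v) t))
          ((ContinuousLinearMap.continuous _).comp
            (continuous_extendI (curvInt hA σ v).continuous)).continuousOn (hg u)
      rw [← integral_const_mul_of_integrable (hI u v), ← integral_const_mul_of_integrable (hI v u)]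
      congr 1
      · refine integral_congr_ae ?_
        filter_upwards [ae_restrict_mem measurableSet_Icc] with t ht
        rw [hG v t ht]
      · refine integral_congr_ae ?_
        filter_upwards [ae_restrict_mem measurableSet_Icc] with t ht
        rw [hG u t ht]
    have hK : ∀ u v : Curve p, Integrable
        (fun t => conjL A σ t (covCurv A (σ.val t) (u.val t) (v.val t) (σ.vel t))) leb := fun u v =>
      integrable_conjL_covCurv hA σ u.hasWeakDeriv.continuousOn v.hasWeakDeriv.continuousOn hσi
    have hJ : ∀ u v : Curve p, Integrable
        (fun t => conjL A σ t (curvForm A (σ.val t) (v.val t) (u.vel t))) leb := fun u v =>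
      integrable_conjL_curv hA σ v.hasWeakDeriv.continuousOn u.hasWeakDeriv.integrable
    have e2 : ∫ t, ∑ μ, ∑ ν, (u.val t μ * v.val t ν) •
          ((-(1 / 2 : ℝ)) • (W1 * (c μ ν t + c ν μ t))) ∂leb =
        (-(1 / 2 : ℝ)) • (W1 *
          ((∫ t, conjL A σ t (covCurv A (σ.val t) (u.val t) (v.val t) (σ.vel t)) ∂leb) +
          ∫ t, conjL A σ t (covCurv A (σ.val t) (v.val t) (u.val t) (σ.vel t)) ∂leb)) := by
      have hKK : Integrable (fun t =>
          conjL A σ t (covCurv A (σ.val t) (u.val t) (v.val t) (σ.vel t)) +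
          conjL A σ t (covCurv A (σ.val t) (v.val t) (u.val t) (σ.vel t))) leb :=
        (hK u v).add (hK v u)
      rw [← integral_add (hK u v) (hK v u), ← integral_const_mul_of_integrable hKK,
        ← integral_smul]
      refine integral_congr_ae (.of_forall fun t => ?_)
      beta_reduce
      rw [← sum_sum_covCurv _ (u.val t), ← sum_sum_covCurv _ (v.val t)]
      rw [Finset.sum_comm (f := fun μ ν => (v.val t μ * u.val t ν) • covCurv A (σ.val t)
        (basisVec μ) (basisVec ν) (σ.vel t))]
      simp only [map_sum, map_smul, ← Finset.sum_add_distrib, Finset.mul_sum, Finset.smul_sum, c]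
      refine Finset.sum_congr rfl fun μ _ => Finset.sum_congr rfl fun ν _ => ?_
      rw [smul_comm, mul_comm (v.val t ν), ← smul_add, mul_smul_comm]
    have e3 : ∫ t, ∑ μ, ∑ ν, (u.vel t μ * v.val t ν + v.vel t μ * u.val t ν) •
          (W1 * conjL A σ t (curvForm A (σ.val t) (basisVec μ) (basisVec ν))) ∂leb =
        -(W1 * ((∫ t, conjL A σ t (curvForm A (σ.val t) (v.val t) (u.vel t)) ∂leb) +
          ∫ t, conjL A σ t (curvForm A (σ.val t) (u.val t) (v.vel t)) ∂leb)) := by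
      have hJJ : Integrable (fun t =>
          conjL A σ t (curvForm A (σ.val t) (v.val t) (u.vel t)) +
          conjL A σ t (curvForm A (σ.val t) (u.val t) (v.vel t))) leb := (hJ u v).add (hJ v u)
      rw [← integral_add (hJ u v) (hJ v u), ← integral_const_mul_of_integrable hJJ,
        ← integral_neg]
      refine integral_congr_ae (.of_forall fun t => ?_)
      beta_reduce
      rw [curvForm_antisymm _ _ (v.val t), curvForm_antisymm _ _ (u.val t), map_neg, map_neg,
        ← neg_add, mul_neg, neg_neg, ← sum_sum_curvForm _ (u.vel t), ← sum_sum_curvForm _ (v.vel t)]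
      simp only [map_sum, map_smul, ← Finset.sum_add_distrib, Finset.mul_sum, add_smul,
        mul_add, mul_smul_comm]
    rw [e1, e2, e3]
    have hf2 : ContDiff ℝ ∞ fun σ : Curve p => extendI (transportC A σ) 1 :=
      (evalAt 1).contDiff.comp (contDiff_transportC hA)
    have hsymm := (hf2.contDiffAt (x := σ)).isSymmSndFDerivAt
      (by rw [minSmoothness_of_isRCLikeNormedField]; exact WithTop.coe_le_coe.2 le_top)
    have s1 := fderiv_fderiv_transportC_eq_integrals hA hs σ u v hu hv
    have s2 := fderiv_fderiv_transportC_eq_integrals hA hs σ v u hv hu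
    -- The formula for (u, v) contains u̇ but not v̇; the singular part needs both, with factor 1/2,
    -- so the symmetric second derivative is written as an average.
    have s3 : fderiv ℝ (fderiv ℝ fun σ : Curve p => extendI (transportC A σ) 1) σ u v =
        (1 / 2 : ℝ) • (fderiv ℝ (fderiv ℝ fun σ : Curve p => extendI (transportC A σ) 1) σ u v +
          fderiv ℝ (fderiv ℝ fun σ : Curve p => extendI (transportC A σ) 1) σ v u) := by
      rw [hsymm.eq v u, ← two_smul ℝ, smul_smul]
      norm_num
    rw [s3, s1, s2]
    simp only [mul_add, mul_sub, smul_add, smul_sub, smul_neg, neg_smul, neg_add]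
    module
  · have hsum : Integrable (fun t => conjL A σ t (∑ μ, ∑ ν, eta μ ν •
        covCurv A (σ.val t) (basisVec μ) (basisVec ν) (σ.vel t))) leb := by
      simp only [map_sum, map_smul]
      exact integrable_finsetSum _ fun μ _ => integrable_finsetSum _ fun ν _ => (hc μ ν).smul (eta μ ν)
    rw [← integral_const_mul_of_integrable hsum, ← integral_neg]
    refine integral_congr_ae (.of_forall fun t => ?_)
    have es : ∀ μ ν, eta μ ν = eta ν μ := fun μ ν => by
      by_cases h : μ = ν
      · rw [h]
      · simp [eta, h, Ne.symm h]
    have e4 : ∑ μ, ∑ ν, eta μ ν • c μ ν t = ∑ μ, ∑ ν, eta μ ν • c ν μ t := by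
      rw [Finset.sum_comm]
      simp only [es]
    have e5 : conjL A σ t (∑ μ, ∑ ν, eta μ ν •
        covCurv A (σ.val t) (basisVec μ) (basisVec ν) (σ.vel t)) =
        (1 / 2 : ℝ) • ∑ μ, ∑ ν, eta μ ν • (c μ ν t + c ν μ t) := by
      simp only [smul_add, Finset.sum_add_distrib, ← e4]
      rw [← two_smul ℝ, smul_smul]
      norm_num [c]
    simp only [e5]
    rw [mul_smul_comm, Finset.mul_sum, ← neg_smul, Finset.smul_sum]
    refine Finset.sum_congr rfl fun μ _ => ?_
    rw [Finset.mul_sum, Finset.smul_sum]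
    refine Finset.sum_congr rfl fun ν _ => ?_
    rw [smul_comm, mul_smul_comm]

end LevyTrace

/-! ### Continuously differentiable curves as elements of the curve space -/

section SmoothCurves

theorem hasWeakDeriv_of_contDiff {V : Type*} [NormedAddCommGroup V] [NormedSpace ℝ V]
    [CompleteSpace V] {f : ℝ → V} (hf : ContDiff ℝ 1 f) : HasWeakDeriv f (deriv f) := by
  have hc : Continuous (deriv f) := hf.continuous_deriv le_rfl
  have hi : Integrable (deriv f) leb := hc.continuousOn.integrableOn_compact isCompact_Icc
  refine ((HasWeakDeriv.const (f 0)).add (HasWeakDeriv.primitive hi)).congr_deriv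
    (.of_forall fun t => by simp) |>.congr fun t _ => ?_
  rw [intervalIntegral.integral_deriv_eq_sub (fun x _ => hf.differentiable one_ne_zero x)
    (hc.intervalIntegrable _ _)]
  abel

namespace Curve

variable {p : ℝ≥0∞} {f : ℝ → Mink}

theorem hasWeakDeriv_extendI_of_contDiff (hf : ContDiff ℝ 1 f) :
    HasWeakDeriv (extendI fun t : unitInterval => f t) (deriv f) :=
  (hasWeakDeriv_of_contDiff hf).congr fun t ht => by
    rw [extendI, IccExtend_of_mem _ _ ht]

/-- The restriction to `[0,1]` of a continuously differentiable curve starting at the origin. -/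
def ofContDiff (p : ℝ≥0∞) (hf : ContDiff ℝ 1 f) (h0 : f 0 = 0) : Curve p :=
  ⟨fun t => f t, by simpa using h0, (hasWeakDeriv_extendI_of_contDiff hf).ac, by
    have hc : Continuous (deriv f) := hf.continuous_deriv le_rfl
    obtain ⟨C, hC⟩ := isCompact_Icc.exists_bound_of_continuousOn (hc.continuousOn (s := Icc 0 1))
    refine MemLp.ae_eq (f := deriv f) ?_ (MemLp.of_bound hc.aestronglyMeasurable C ?_)
    · filter_upwards [(hasWeakDeriv_extendI_of_contDiff hf).ae_hasDerivAt] with t ht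
        using ht.deriv.symm
    · filter_upwards [ae_restrict_mem measurableSet_Icc] with t ht using hC t ht⟩

theorem ofContDiff_val (hf : ContDiff ℝ 1 f) (h0 : f 0 = 0) {t : ℝ} (ht : t ∈ Icc (0 : ℝ) 1) :
    (ofContDiff p hf h0).val t = f t := by
  change extendI (fun t : unitInterval => f t) t = f t
  rw [extendI, IccExtend_of_mem _ _ ht]

end Curve

end SmoothCurves

/-! ### The Riemann–Lebesgue lemma for cosines -/

section RiemannLebesgue

open Real FourierTransform

/-- Along n·L with L ≠ 0 the frequency leaves every compact set, so integrals against the characters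
tend to 0; a cosine is the mean of two of them. -/
theorem tendsto_integral_cos_smul {X F : Type*} [NormedAddCommGroup X] [NormedSpace ℝ X]
    [FiniteDimensional ℝ X] [MeasurableSpace X] [BorelSpace X] (μ : Measure X) [μ.IsAddHaarMeasure]
    [NormedAddCommGroup F] [NormedSpace ℂ F] {f : X → F} (hf : Integrable f μ) {L : StrongDual ℝ X} (hL : L ≠ 0) :
    Tendsto (fun n : ℕ => ∫ x, Real.cos (π * n * L x) • f x ∂μ) atTop (𝓝 0) := by
  have key : ∀ c : ℝ, c ≠ 0 → Tendsto (fun n : ℕ => ∫ x, 𝐞 (-(((n : ℝ) * c) • L) x) • f x ∂μ)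
      atTop (𝓝 0) := by
    intro c hc
    suffices hw : Tendsto (fun n : ℕ => ((n : ℝ) * c) • L) atTop (cocompact (StrongDual ℝ X)) from
      (tendsto_integral_exp_smul_cocompact f μ).comp hw
    have : ProperSpace (StrongDual ℝ X) := FiniteDimensional.proper ℝ _
    rw [← Metric.cobounded_eq_cocompact, ← tendsto_norm_atTop_iff_cobounded]
    have e : (fun n : ℕ => ‖((n : ℝ) * c) • L‖) = fun n : ℕ => (n : ℝ) * (|c| * ‖L‖) := by
      funext n
      rw [norm_smul, norm_mul, Real.norm_natCast, Real.norm_eq_abs, mul_assoc]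
    rw [e]
    exact tendsto_natCast_atTop_atTop.atTop_mul_const (by positivity)
  have hi : ∀ w : StrongDual ℝ X, Integrable (fun x => 𝐞 (-w x) • f x) μ := by
    intro w
    refine hf.mono ?_ (.of_forall fun x => by simp)
    have hc : Continuous fun x => ((𝐞 (-w x) : Circle) : ℂ) := by fun_prop
    exact hc.aestronglyMeasurable.smul hf.1
  -- The character is exp(2πi·), so frequencies ±n/2 produce cos(πnL).
  have h := ((key (1 / 2) (by norm_num)).add (key (-(1 / 2)) (by norm_num))).const_smul (1 / 2 : ℂ)
  rw [add_zero, smul_zero] at h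
  refine h.congr fun n => ?_
  rw [← integral_add (hi _) (hi _), ← integral_smul]
  refine integral_congr_ae (.of_forall fun x => ?_)
  simp only [Circle.smul_def, Real.fourierChar_apply, ← add_smul, smul_smul]
  rw [← algebraMap_smul ℂ (Real.cos (π * n * L x)) (f x)]
  congr 1
  simp only [FunLike.coe_smul, Pi.smul_apply, smul_eq_mul, Complex.coe_algebraMap,
    Complex.ofReal_cos, Complex.cos]
  push_cast
  ring_nf

end RiemannLebesgue

/-! ### Uniqueness of the Lévy trace -/

section Uniqueness

open Real

variable {p : ℝ≥0∞} [Fact (1 ≤ p)]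

/-- The curves `√2 sin(π n t) p_μ`. -/
def sineCurve (p : ℝ≥0∞) (n : ℕ) (μ : Fin 4) : Curve p :=
  Curve.ofContDiff p (f := fun t => (√2 * sin (π * n * t)) • basisVec μ)
    ((contDiff_const.mul (contDiff_sin.comp (contDiff_const.mul contDiff_id))).smul contDiff_const)
    (by simp)

theorem sineCurve_val (n : ℕ) (μ κ : Fin 4) {t : ℝ} (ht : t ∈ Icc (0 : ℝ) 1) :
    (sineCurve p n μ).val t κ = if κ = μ then √2 * sin (π * n * t) else 0 := by
  rw [sineCurve, Curve.ofContDiff_val _ _ ht]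
  simp [basisVec]

theorem sineCurve_val_one (n : ℕ) (μ : Fin 4) : (sineCurve p n μ).val 1 = 0 := by
  rw [sineCurve, Curve.ofContDiff_val _ _ (by simp), mul_one, mul_comm π, sin_nat_mul_pi]
  simp

theorem sineCurve_vel (n : ℕ) (μ κ : Fin 4) (h : κ ≠ μ) :
    ∀ᵐ t ∂leb, (sineCurve p n μ).vel t κ = 0 := by
  filter_upwards [(sineCurve p n μ).hasWeakDeriv.ae_hasDerivAt, ae_leb_Ioo] with t ht h'
  have h1 := (EuclideanSpace.proj (𝕜 := ℝ) κ).hasFDerivAt.comp_hasDerivAt t ht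
  refine (h1.congr_of_eventuallyEq (f₁ := fun _ => 0) ?_).unique (hasDerivAt_const t 0)
  filter_upwards [Ioo_mem_nhds h'.1 h'.2] with s hs
  change 0 = (sineCurve p n μ).val s κ
  rw [sineCurve_val n μ κ ⟨hs.1.le, hs.2.le⟩, if_neg h]

variable {F : Type*} [NormedAddCommGroup F] [NormedSpace ℂ F]

/-- 2 sin²θ = 1 - cos 2θ, and the cosine part tends to 0; the factor √2 makes the limiting weight
equal to 1. -/
theorem tendsto_integral_sin_smul {f : ℝ → F} (hf : Integrable f leb) :
    Tendsto (fun n : ℕ => ∫ t, (√2 * sin (π * n * t) * (√2 * sin (π * n * t))) • f t ∂leb) atTop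
      (𝓝 (∫ t, f t ∂leb)) := by
  have hi : Integrable ((Icc (0 : ℝ) 1).indicator f) volume :=
    (integrable_indicator_iff measurableSet_Icc).2 hf
  have h := tendsto_integral_cos_smul volume hi (L := (2 : ℝ) • ContinuousLinearMap.id ℝ ℝ)
    (fun h => by simpa using congrArg (fun L => L 1) h)
  have h2 := h.const_sub (∫ t, f t ∂leb)
  rw [sub_zero] at h2
  refine h2.congr fun n => ?_
  have e : (fun t => cos (π * n * ((2 : ℝ) • ContinuousLinearMap.id ℝ ℝ) t) •
      (Icc (0 : ℝ) 1).indicator f t) =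
      (Icc (0 : ℝ) 1).indicator fun t => cos (2 * (π * n * t)) • f t := by
    funext t
    by_cases ht : t ∈ Icc (0 : ℝ) 1
    · rw [indicator_of_mem ht, indicator_of_mem ht]
      simp only [FunLike.coe_smul, Pi.smul_apply, ContinuousLinearMap.coe_id', id,
        smul_eq_mul]
      ring_nf
    · rw [indicator_of_notMem ht, indicator_of_notMem ht, smul_zero]
  have hc : Integrable (fun t => cos (2 * (π * n * t)) • f t) leb := by
    have hcont : Continuous fun t : ℝ => cos (2 * (π * n * t)) := by fun_prop
    refine hf.mono (hcont.aestronglyMeasurable.smul hf.1) (.of_forall fun t => ?_)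
    rw [norm_smul]
    exact mul_le_of_le_one_left (norm_nonneg _) (abs_cos_le_one _)
  rw [e, integral_indicator measurableSet_Icc, ← integral_sub hf hc]
  refine integral_congr_ae (.of_forall fun t => ?_)
  beta_reduce
  rw [cos_two_mul, cos_sq', mul_mul_mul_comm, mul_self_sqrt zero_le_two]
  module

/-- 2 sin a sin b = cos(a - b) - cos(a + b), and both linear forms on the plane are nonzero. -/
theorem tendsto_integral_sin_sin_smul {f : ℝ × ℝ → F} (hf : Integrable f (leb.prod leb)) :
    Tendsto (fun n : ℕ => ∫ x, (√2 * sin (π * n * x.1) * (√2 * sin (π * n * x.2))) • f x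
      ∂(leb.prod leb)) atTop (𝓝 0) := by
  have hm : leb.prod leb = volume.restrict (Icc (0 : ℝ) 1 ×ˢ Icc (0 : ℝ) 1) :=
    Measure.prod_restrict _ _
  have hS : MeasurableSet (Icc (0 : ℝ) 1 ×ˢ Icc (0 : ℝ) 1) :=
    measurableSet_Icc.prod measurableSet_Icc
  rw [hm] at hf ⊢
  have hi : Integrable ((Icc (0 : ℝ) 1 ×ˢ Icc (0 : ℝ) 1).indicator f) volume :=
    (integrable_indicator_iff hS).2 hf
  have key : ∀ L : StrongDual ℝ (ℝ × ℝ), L (1, 0) ≠ 0 → Tendsto (fun n : ℕ =>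
      ∫ x in Icc (0 : ℝ) 1 ×ˢ Icc (0 : ℝ) 1, cos (π * n * L x) • f x) atTop (𝓝 0) := by
    intro L hL
    have h := tendsto_integral_cos_smul volume hi (L := L) (fun h => hL (by rw [h]; rfl))
    refine h.congr fun n => ?_
    rw [← integral_indicator hS]
    refine integral_congr_ae (.of_forall fun x => ?_)
    by_cases hx : x ∈ Icc (0 : ℝ) 1 ×ˢ Icc (0 : ℝ) 1
    · simp only [indicator_of_mem hx]
    · simp only [indicator_of_notMem hx, smul_zero]
  have h := (key (ContinuousLinearMap.fst ℝ ℝ ℝ - ContinuousLinearMap.snd ℝ ℝ ℝ) (by simp)).sub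
    (key (ContinuousLinearMap.fst ℝ ℝ ℝ + ContinuousLinearMap.snd ℝ ℝ ℝ) (by simp))
  rw [sub_zero] at h
  refine h.congr fun n => ?_
  have hc : ∀ L : StrongDual ℝ (ℝ × ℝ), Integrable (fun x => cos (π * n * L x) • f x)
      (volume.restrict (Icc (0 : ℝ) 1 ×ˢ Icc (0 : ℝ) 1)) := by
    intro L
    have hcont : Continuous fun x : ℝ × ℝ => cos (π * n * L x) := by fun_prop
    refine hf.mono (hcont.aestronglyMeasurable.smul hf.1) (.of_forall fun t => ?_)
    rw [norm_smul]
    exact mul_le_of_le_one_left (norm_nonneg _) (abs_cos_le_one _)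
  rw [← integral_sub (hc _) (hc _)]
  refine integral_congr_ae (.of_forall fun x => ?_)
  beta_reduce
  rw [← sub_smul]
  congr 1
  simp only [sub_apply, add_apply, ContinuousLinearMap.coe_fst',
    ContinuousLinearMap.coe_snd', mul_sub, mul_add, cos_sub, cos_add]
  rw [mul_mul_mul_comm, mul_self_sqrt zero_le_two]
  ring

/-- On the sine curves the Volterra part oscillates to 0, the singular part is absent and the
diagonal Lévy coefficients keep weight 1. The trace is thus a limit of values of Q alone, whatever
representation is chosen. -/
theorem HasLevyTrace.tendsto {Q : Curve p →L[ℝ] Curve p →L[ℝ] F} {w : F} (h : HasLevyTrace Q w) :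
    Tendsto (fun n : ℕ => ∑ μ, eta μ μ • Q (sineCurve p n μ) (sineCurve p n μ)) atTop (𝓝 w) := by
  obtain ⟨QV, QL, QS, hV, hL, -, -, hSs, hQ, hw⟩ := h
  have hw' : w = ∑ μ, eta μ μ • ∫ t, QL μ μ t ∂leb := by
    have hi : ∀ μ, Integrable (fun t => ∑ ν, eta μ ν • QL μ ν t) leb := fun μ =>
      integrable_finsetSum _ fun ν _ => (hL μ ν).smul (eta μ ν)
    rw [hw, integral_finsetSum _ fun μ _ => hi μ]
    refine Finset.sum_congr rfl fun μ _ => ?_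
    rw [← integral_smul]
    refine integral_congr_ae (.of_forall fun t => ?_)
    refine Finset.sum_eq_single_of_mem μ (Finset.mem_univ _) fun ν _ hν => ?_
    simp [eta, hν.symm]
  rw [hw']
  refine tendsto_finsetSum _ fun μ _ => Tendsto.const_smul ?_ _
  have hlim := (tendsto_integral_sin_sin_smul (hV μ μ)).add (tendsto_integral_sin_smul (hL μ μ))
  rw [zero_add] at hlim
  refine hlim.congr fun n => ?_
  rw [hQ _ _ (sineCurve_val_one n μ) (sineCurve_val_one n μ)]
  have e1 : ∫ x, ∑ κ, ∑ ν, ((sineCurve p n μ).val x.1 κ * (sineCurve p n μ).val x.2 ν) • QV κ ν x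
      ∂(leb.prod leb) = ∫ x, (√2 * sin (π * n * x.1) * (√2 * sin (π * n * x.2))) • QV μ μ x
      ∂(leb.prod leb) := by
    rw [Measure.prod_restrict]
    refine setIntegral_congr_fun (measurableSet_Icc.prod measurableSet_Icc) fun x hx => ?_
    simp [sineCurve_val _ _ _ hx.1, sineCurve_val _ _ _ hx.2, ite_smul]
  have e2 : ∫ t, ∑ κ, ∑ ν, ((sineCurve p n μ).val t κ * (sineCurve p n μ).val t ν) • QL κ ν t
      ∂leb = ∫ t, (√2 * sin (π * n * t) * (√2 * sin (π * n * t))) • QL μ μ t ∂leb := by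
    refine setIntegral_congr_fun measurableSet_Icc fun t ht => ?_
    simp [sineCurve_val _ _ _ ht, ite_smul]
  have e3 : ∫ t, ∑ κ, ∑ ν, ((sineCurve p n μ).vel t κ * (sineCurve p n μ).val t ν +
      (sineCurve p n μ).vel t κ * (sineCurve p n μ).val t ν) • QS κ ν t ∂leb = 0 := by
    refine integral_eq_zero_of_ae ?_
    have hv := ae_all_iff.2 fun κ => ae_all_iff.2 fun h : κ ≠ μ => sineCurve_vel (p := p) n μ κ h
    filter_upwards [hv, ae_restrict_mem measurableSet_Icc, hSs μ μ] with t h1 ht h2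
    -- Only the index μ is excited, and the diagonal entries of an antisymmetric matrix vanish.
    have h3 : QS μ μ t = 0 := by
      have h4 : QS μ μ t = -QS μ μ t := h2
      have h5 : (2 : ℝ) • QS μ μ t = 0 := by
        rw [two_smul]
        nth_rw 1 [h4]
        exact neg_add_cancel _
      simpa using h5
    refine Finset.sum_eq_zero fun κ _ => Finset.sum_eq_zero fun ν _ => ?_
    by_cases hκ : κ = μ
    · by_cases hν : ν = μ
      · rw [hκ, hν, h3, smul_zero]
      · rw [sineCurve_val _ _ _ ht, if_neg hν]
        simp
    · rw [h1 κ hκ]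
      simp
  rw [e1, e2, e3, smul_zero, add_zero]

theorem HasLevyTrace.unique {Q : Curve p →L[ℝ] Curve p →L[ℝ] F} {w w' : F}
    (h : HasLevyTrace Q w) (h' : HasLevyTrace Q w') : w = w' :=
  tendsto_nhds_unique h.tendsto h'.tendsto

end Uniqueness

/-! ### Integration against vector measures with density -/

section VectorMeasure

variable {α V : Type*} [MeasurableSpace α] [NormedAddCommGroup V] [NormedSpace ℝ V]
  [CompleteSpace V] {μ : Measure α} {ρ : α → V}

theorem isFiniteMeasure_variation_withDensityᵥ (hρ : Integrable ρ μ) :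
    IsFiniteMeasure (μ.withDensityᵥ ρ).variation := by
  rw [Measure.variation_withDensityᵥ hρ]
  exact isFiniteMeasure_withDensity hρ.2.ne

theorem vectorMeasure_integral_indicator_const (ν : VectorMeasure α V)
    [IsFiniteMeasure ν.variation] {s : Set α} (hs : MeasurableSet s) (c : ℝ) :
    ν.integral (s.indicator fun _ => c) (ContinuousLinearMap.lsmul ℝ ℝ) = c • ν s := by
  have : IsFiniteMeasure (ν.restrict s).variation := by
    rw [VectorMeasure.variation_restrict hs]
    infer_instance
  rw [VectorMeasure.integral_indicator hs, VectorMeasure.integral_const,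
    VectorMeasure.restrict_apply _ hs .univ, univ_inter]
  rfl

theorem integral_withDensityᵥ_simpleFunc (hρ : Integrable ρ μ) (φ : SimpleFunc α ℝ) :
    (μ.withDensityᵥ ρ).integral φ (ContinuousLinearMap.lsmul ℝ ℝ) = ∫ x, φ x • ρ x ∂μ := by
  have := isFiniteMeasure_variation_withDensityᵥ hρ
  have hint : ∀ φ : SimpleFunc α ℝ, Integrable (fun x => φ x • ρ x) μ := by
    intro φ
    obtain ⟨C, hC⟩ := φ.exists_forall_norm_le
    exact hρ.bdd_smul C φ.stronglyMeasurable.aestronglyMeasurable (.of_forall hC)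
  induction φ using SimpleFunc.induction with
  | const c hs =>
    rename_i s
    have e : ⇑(SimpleFunc.piecewise s hs (SimpleFunc.const α c) (SimpleFunc.const α 0)) =
        s.indicator fun _ => c := by
      ext x
      by_cases hx : x ∈ s <;> simp [hx]
    rw [e, vectorMeasure_integral_indicator_const _ hs, withDensityᵥ_apply hρ hs, ← integral_smul,
      ← integral_indicator hs]
    refine integral_congr_ae (.of_forall fun x => ?_)
    by_cases hx : x ∈ s <;> simp [hx]
  | add _ hf hg =>
    rename_i f g _
    rw [SimpleFunc.coe_add, VectorMeasure.integral_add (f.integrable_of_isFiniteMeasure)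
      (g.integrable_of_isFiniteMeasure), hf, hg, ← integral_add (hint f) (hint g)]
    refine integral_congr_ae (.of_forall fun x => ?_)
    simp [add_smul]

/-- Bounded simple approximations of f pass to the limit on both sides by dominated convergence. -/
theorem integral_withDensityᵥ (hρ : Integrable ρ μ) {f : α → ℝ} (hf : StronglyMeasurable f)
    {C : ℝ} (hC : ∀ x, ‖f x‖ ≤ C) :
    (μ.withDensityᵥ ρ).integral f (ContinuousLinearMap.lsmul ℝ ℝ) = ∫ x, f x • ρ x ∂μ := by
  have := isFiniteMeasure_variation_withDensityᵥ hρ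
  rcases isEmpty_or_nonempty α with hα | ⟨⟨x₀⟩⟩
  · rw [VectorMeasure.integral_of_isEmpty, Measure.eq_zero_of_isEmpty μ, integral_zero_measure]
  have h0 : 0 ≤ C := (norm_nonneg _).trans (hC x₀)
  have hb : ∀ n x, ‖hf.approxBounded C n x‖ ≤ C := fun n x => hf.norm_approxBounded_le h0 n x
  have hlim : ∀ x, Tendsto (fun n => hf.approxBounded C n x) atTop (𝓝 (f x)) := fun x =>
    hf.tendsto_approxBounded_of_norm_le (hC x)
  have h1 : Tendsto (fun n => (μ.withDensityᵥ ρ).integral (hf.approxBounded C n)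
      (ContinuousLinearMap.lsmul ℝ ℝ)) atTop
      (𝓝 ((μ.withDensityᵥ ρ).integral f (ContinuousLinearMap.lsmul ℝ ℝ))) :=
    VectorMeasure.tendsto_integral_filter_of_norm_le_const
    (.of_forall fun n => (hf.approxBounded C n).stronglyMeasurable.aestronglyMeasurable)
    ⟨C, .of_forall fun n => .of_forall (hb n)⟩ (.of_forall hlim)
  have h2 : Tendsto (fun n => ∫ x, hf.approxBounded C n x • ρ x ∂μ) atTop
      (𝓝 (∫ x, f x • ρ x ∂μ)) := by
    refine tendsto_integral_of_dominated_convergence (fun x => C * ‖ρ x‖)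
      (fun n => (hf.approxBounded C n).stronglyMeasurable.aestronglyMeasurable.smul hρ.1)
      (hρ.norm.const_mul C) (fun n => .of_forall fun x => ?_)
      (.of_forall fun x => (hlim x).smul_const _)
    rw [norm_smul]
    exact mul_le_mul_of_nonneg_right (hb n x) (norm_nonneg _)
  refine tendsto_nhds_unique h1 (h2.congr fun n => ?_)
  exact (integral_withDensityᵥ_simpleFunc hρ _).symm

end VectorMeasure

/-! ### Endpoint values: existence and uniqueness -/

section Endpoint

variable {p : ℝ≥0∞} [Fact (1 ≤ p)] {V : Type*} [NormedAddCommGroup V] [NormedSpace ℝ V]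
  [CompleteSpace V]

/-- The curve `t ↦ t^{n+1} h`. -/
def powCurve (p : ℝ≥0∞) (n : ℕ) (h : Mink) : Curve p :=
  Curve.ofContDiff p (f := fun t => t ^ (n + 1) • h) ((contDiff_id.pow _).smul contDiff_const)
    (by simp)

theorem powCurve_val (n : ℕ) (h : Mink) {t : ℝ} (ht : t ∈ Icc (0 : ℝ) 1) :
    (powCurve p n h).val t = t ^ (n + 1) • h := Curve.ofContDiff_val _ _ ht

/-- On [0,1] the functions t^{n+1} are bounded by 1 and converge to the indicator of {1}; the
exponent n+1 makes the curves start at the origin for n = 0 too. -/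
theorem HasEndpointValue.tendsto {h : Mink} {T : Curve p →L[ℝ] V} {v : V}
    (H : HasEndpointValue h T v) : Tendsto (fun n : ℕ => T (powCurve p n h)) atTop (𝓝 v) := by
  obtain ⟨ν, hν, hT, rfl⟩ := H
  simp only [hT]
  refine tendsto_finsetSum _ fun μ _ => ?_
  have := hν μ
  rw [← vectorMeasure_integral_indicator_const (ν μ) (measurableSet_singleton _)]
  have hv : ∀ (n : ℕ) (t : unitInterval), (powCurve p n h).val t μ = (t : ℝ) ^ (n + 1) * h μ :=
    fun n t => by rw [powCurve_val n h t.2]; rfl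
  refine VectorMeasure.tendsto_integral_filter_of_norm_le_const
    (.of_forall fun n => ?_) ⟨|h μ|, .of_forall fun n => .of_forall fun t => ?_⟩
    (.of_forall fun t => ?_)
  · simp only [hv]
    have hc : Continuous fun t : unitInterval => (t : ℝ) ^ (n + 1) * h μ := by fun_prop
    exact hc.aestronglyMeasurable
  · rw [hv, norm_mul, norm_pow, Real.norm_eq_abs, Real.norm_eq_abs, abs_of_nonneg t.2.1]
    exact mul_le_of_le_one_left (abs_nonneg _) (pow_le_one₀ t.2.1 t.2.2)
  · simp only [hv]
    by_cases ht : t = 1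
    · simp [ht]
    · rw [indicator_of_notMem (by simpa using ht)]
      have h1 : (t : ℝ) < 1 := lt_of_le_of_ne t.2.2 fun h => ht (Subtype.ext h)
      have := ((tendsto_pow_atTop_nhds_zero_of_lt_one t.2.1 h1).comp
        (tendsto_add_atTop_nat 1)).mul_const (h μ)
      simpa using this

theorem HasEndpointValue.unique {h : Mink} {T : Curve p →L[ℝ] V} {v v' : V}
    (H : HasEndpointValue h T v) (H' : HasEndpointValue h T v') : v = v' :=
  tendsto_nhds_unique H.tendsto H'.tendsto

/-- The representing measure is a Dirac mass c_μ at 1 plus the density ρ_μ, which does not charge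
the point 1. -/
theorem hasEndpointValue_of_eq_integral (h : Mink) {T : Curve p →L[ℝ] V} {c : Fin 4 → V}
    {ρ : Fin 4 → ℝ → V} (hρ : ∀ μ, Integrable (ρ μ) leb)
    (hT : ∀ u : Curve p, T u = ∑ μ, u.val 1 μ • c μ + ∫ t, ∑ μ, u.val t μ • ρ μ t ∂leb) :
    HasEndpointValue h T (∑ μ, h μ • c μ) := by
  have hI : ∀ μ, Integrable (fun t : unitInterval => ρ μ t) := fun μ =>
    (unitInterval.measurePreserving_coe.integrable_comp_emb
      unitInterval.measurableEmbedding_coe).2 (hρ μ)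
  have hf : ∀ μ, IsFiniteMeasure
      ((volume : Measure unitInterval).withDensityᵥ fun t => ρ μ t).variation :=
    fun μ => isFiniteMeasure_variation_withDensityᵥ (hI μ)
  have hd : ∀ μ, IsFiniteMeasure (VectorMeasure.dirac (1 : unitInterval) (c μ)).variation := by
    intro μ
    rw [VectorMeasure.variation_dirac]
    exact Measure.smul_finite _ enorm_ne_top
  refine ⟨fun μ => VectorMeasure.dirac (1 : unitInterval) (c μ) +
    (volume : Measure unitInterval).withDensityᵥ fun t => ρ μ t, fun μ => ?_, fun u => ?_, ?_⟩
  · have := hf μ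
    have := hd μ
    exact isFiniteMeasure_of_le _ VectorMeasure.variation_add_le
  · have hu : ∀ μ, Continuous fun t : unitInterval => u.val t μ := fun μ =>
      (EuclideanSpace.proj (𝕜 := ℝ) μ).continuous.comp
        (u.hasWeakDeriv.continuousOn.comp_continuous continuous_subtype_val fun t => t.2)
    have hb : ∀ μ, ∃ C, ∀ t : unitInterval, ‖u.val t μ‖ ≤ C := fun μ => by
      obtain ⟨C, hC⟩ := isCompact_univ.exists_bound_of_continuousOn (hu μ).continuousOn
      exact ⟨C, fun t => hC t (mem_univ t)⟩
    have hi : ∀ μ, Integrable (fun t => u.val t μ • ρ μ t) leb := fun μ => by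
      obtain ⟨C, hC⟩ := hb μ
      refine (hρ μ).bdd_smul C ?_ ?_
      · exact ((EuclideanSpace.proj (𝕜 := ℝ) μ).continuous.comp_continuousOn
          u.hasWeakDeriv.continuousOn).aestronglyMeasurable measurableSet_Icc
      · filter_upwards [ae_restrict_mem measurableSet_Icc] with t ht using hC ⟨t, ht⟩
    rw [hT u, integral_finsetSum _ fun μ _ => hi μ, ← Finset.sum_add_distrib]
    refine Finset.sum_congr rfl fun μ _ => ?_
    obtain ⟨C, hC⟩ := hb μ
    have hint : ∀ (m : Measure unitInterval) [IsFiniteMeasure m],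
        Integrable (fun t : unitInterval => u.val t μ) m := fun m _ =>
      Integrable.of_bound (hu μ).aestronglyMeasurable C (.of_forall hC)
    have := hf μ
    have := hd μ
    rw [VectorMeasure.integral_add_vectorMeasure (hint _) (hint _), VectorMeasure.integral_dirac,
      integral_withDensityᵥ (hI μ) (hu μ).stronglyMeasurable hC]
    congr 1
    exact (unitInterval.measurePreserving_coe.integral_comp
      unitInterval.measurableEmbedding_coe fun t => u.val t μ • ρ μ t).symm
  · refine Finset.sum_congr rfl fun μ _ => ?_
    congr 1
    rw [add_apply, VectorMeasure.dirac_apply_of_mem (measurableSet_singleton _) (mem_singleton _),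
      withDensityᵥ_apply (hI μ) (measurableSet_singleton _)]
    simp

end Endpoint

/-! ### Endpoint derivative of a parallel transported section -/

section TwistedEndpoint

variable {R : Type} [NormedRing R] [NormedAlgebra ℝ R] [FiniteDimensional ℝ R] [CompleteSpace R]
  [StarRing R] [NormedStarGroup R] [StarModule ℝ R]
  {p : ℝ≥0∞} [Fact (1 ≤ p)] {A : C(Mink, Mink →L[ℝ] R)}
  {S : Type} [NormedAddCommGroup S] [NormedSpace ℝ S] [CompleteSpace S]
  (B : R →L[ℝ] S →L[ℝ] S) {ψ : Mink → S}

/-- The map `σ ↦ σ(1)`. -/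
def endpointL (p : ℝ≥0∞) [Fact (1 ≤ p)] : Curve p →L[ℝ] Mink :=
  (ContinuousMap.evalCLM ℝ (1 : unitInterval)).comp Curve.posL

theorem endpointL_apply (σ : Curve p) : endpointL p σ = σ.val 1 := Curve.posL_apply σ 1

/-- The section `ψ` at the endpoint of `σ`, transported back to the origin along `σ`. -/
def transportedSection (A : C(Mink, Mink →L[ℝ] R)) (ψ : Mink → S) (σ : Curve p) : S :=
  B (starCLM R (extendI (transportC A σ) 1)) (ψ (endpointL p σ))

variable (hA : ContDiff ℝ ∞ A) (hψ : ContDiff ℝ ∞ ψ)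
include hA hψ

theorem contDiff_transportedSection : ContDiff ℝ ∞ (transportedSection (p := p) B A ψ) := by
  have h1 : ContDiff ℝ ∞ fun σ : Curve p => starCLM R (extendI (transportC A σ) 1) :=
    ((starCLM R).comp (evalAt 1)).contDiff.comp (contDiff_transportC hA)
  exact contDiff_bilin B h1 (hψ.comp (endpointL p).contDiff)

variable (hs : ∀ x v, star (A x v) = -A x v) (hB : ∀ X Y s, B (X * Y) s = B X (B Y s))
include hs hB

/-- The boundary term of Duhamel's formula for U* completes the derivative of ψ to a covariant
derivative at σ(1); the curvature integral remains as the contribution of interior times. -/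
theorem fderiv_transportedSection (σ u : Curve p) :
    fderiv ℝ (transportedSection B A ψ) σ u =
      B (star (extendI (transportC A σ) 1))
        (B (A (σ.val 1) (u.val 1)) (ψ (σ.val 1)) + fderiv ℝ ψ (σ.val 1) (u.val 1)) +
      B (extendI (curvInt hA σ u) 1 * star (extendI (transportC A σ) 1)) (ψ (σ.val 1)) := by
  have d := differentiable_transportC (p := p) hA
  have hd : DifferentiableAt ℝ ψ (endpointL p σ) := hψ.differentiable (by simp) _
  have e : fderiv ℝ (fun σ : Curve p => ψ (endpointL p σ)) σ u =
      fderiv ℝ ψ (σ.val 1) (u.val 1) := by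
    have h := (hd.hasFDerivAt.comp σ (endpointL p).hasFDerivAt).fderiv
    rw [← endpointL_apply, ← endpointL_apply]
    exact congrArg (fun T : Curve p →L[ℝ] S => T u) h
  have h := fderiv_bilin_apply B (f := fun σ : Curve p => starCLM R (extendI (transportC A σ) 1))
    (g := fun σ : Curve p => ψ (endpointL p σ)) (differentiable_evalAt_comp d _ 1 σ)
    (hd.comp σ (endpointL p).differentiableAt) u
  refine h.trans ?_
  rw [e, fderiv_evalAt_comp d, starCLM_apply, starCLM_apply,
    star_fderiv_transportC hA hs σ u (by simp), endpointL_apply, map_add, map_add, add_apply, hB]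
  abel

/-- The curvature integral is linear in u with an integrable density, so only the covariant
derivative of ψ carries mass at 1. -/
theorem hasEndpointValue_transportedSection (h : Mink) (σ : Curve p) :
    HasEndpointValue h (fderiv ℝ (transportedSection B A ψ) σ)
      (B (star (extendI (transportC A σ) 1))
        (B (A (σ.val 1) h) (ψ (σ.val 1)) + fderiv ℝ ψ (σ.val 1) h)) := by
  let c : Mink →L[ℝ] S := (B (star (extendI (transportC A σ) 1))).comp
    ((B.flip (ψ (σ.val 1))).comp (A (σ.val 1)) + fderiv ℝ ψ (σ.val 1))
  let L : R →L[ℝ] S := (B.flip (ψ (σ.val 1))).comp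
    ((ContinuousLinearMap.mul ℝ R).flip (star (extendI (transportC A σ) 1)))
  have hint : ∀ {u : ℝ → Mink}, ContinuousOn u (Icc 0 1) → Integrable (fun t =>
      conjL A σ t (curvForm A (σ.val t) (u t) (σ.vel t))) leb := fun hu =>
    integrable_conjL_curv hA σ hu σ.hasWeakDeriv.integrable
  have key : HasEndpointValue h (fderiv ℝ (transportedSection B A ψ) σ)
      (∑ μ, h μ • c (basisVec μ)) := by
    refine hasEndpointValue_of_eq_integral h (ρ := fun μ t =>
      L (conjL A σ t (curvForm A (σ.val t) (basisVec μ) (σ.vel t))))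
      (fun μ => L.integrable_comp (hint continuousOn_const)) fun u => ?_
    have e1 : extendI (curvInt hA σ u) 1 =
        ∫ t, conjL A σ t (curvForm A (σ.val t) (u.val t) (σ.vel t)) ∂leb := by
      rw [(hasWeakDeriv_curvInt hA σ u).eq_add_integral (t := 1) (by simp),
        extendI_curvInt_zero, zero_add, integral_leb_eq]
      rfl
    rw [fderiv_transportedSection B hA hψ hs hB, ← map_eq_sum_basisVec c]
    congr 1
    change L (extendI (curvInt hA σ u) 1) = _
    rw [e1, ← L.integral_comp_comm (hint u.hasWeakDeriv.continuousOn)]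
    refine integral_congr_ae (.of_forall fun t => ?_)
    beta_reduce
    rw [curvForm_expand]
    simp only [map_sum, map_smul]
  rw [← map_eq_sum_basisVec c] at key
  exact key

end TwistedEndpoint

/-! ### Divergence of the curvature, and recovery of a one-form from its integrals along curves -/

section Current

variable {R : Type} [NormedRing R] [NormedAlgebra ℝ R] [FiniteDimensional ℝ R] [CompleteSpace R]
  [StarRing R] [NormedStarGroup R] [StarModule ℝ R]
  {p : ℝ≥0∞} [Fact (1 ≤ p)] {A : Fin 4 → Mink → R}

theorem connForm_basisVec (A : Fin 4 → Mink → R) (x : Mink) (ν : Fin 4) :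
    connForm A x (basisVec ν) = A ν x := by
  simp [connForm_apply, basisVec, ite_smul]

theorem fderiv_connForm_apply (hA : ∀ μ, ContDiff ℝ ∞ (A μ)) (x u : Mink) (ν : Fin 4) :
    fderiv ℝ (connForm A) x u (basisVec ν) = fderiv ℝ (A ν) x u := by
  have e : (fun x => connForm A x (basisVec ν)) = A ν := funext fun x => connForm_basisVec A x ν
  have hd : DifferentiableAt ℝ (connForm A) x := (contDiff_connForm hA).differentiable (by simp) x
  rw [← e, fderiv_clm_apply hd (differentiableAt_const _)]
  simp

theorem curvForm_connForm (hA : ∀ μ, ContDiff ℝ ∞ (A μ)) (x : Mink) (μ ν : Fin 4) :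
    curvForm (connForm A) x (basisVec μ) (basisVec ν) =
      fderiv ℝ (A ν) x (basisVec μ) - fderiv ℝ (A μ) x (basisVec ν) +
        (A μ x * A ν x - A ν x * A μ x) := by
  rw [curvForm_apply, fderiv_connForm_apply hA, fderiv_connForm_apply hA, connForm_basisVec,
    connForm_basisVec]

theorem covCurv_connForm (hA : ∀ μ, ContDiff ℝ ∞ (A μ)) (x : Mink) (κ μ ν : Fin 4) :
    covCurv (connForm A) x (basisVec κ) (basisVec μ) (basisVec ν) =
      fderiv ℝ (fun x => curvForm (connForm A) x (basisVec μ) (basisVec ν)) x (basisVec κ) +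
        (A κ x * curvForm (connForm A) x (basisVec μ) (basisVec ν) -
          curvForm (connForm A) x (basisVec μ) (basisVec ν) * A κ x) := by
  have hd : DifferentiableAt ℝ (curvForm (connForm A)) x :=
    (contDiff_curvForm (contDiff_connForm hA)).differentiable (by simp) x
  rw [covCurv, connForm_basisVec, fderiv_clm_apply (hd.clm_apply (differentiableAt_const _))
    (differentiableAt_const _), fderiv_clm_apply hd (differentiableAt_const _)]
  simp

/-- The one-form `v ↦ ∇^μ F_{μν} v^ν`. -/
def divCurv (A : Mink → Mink →L[ℝ] R) (x : Mink) : Mink →L[ℝ] R :=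
  ∑ μ, ∑ κ, eta μ κ • covCurvL A x (basisVec κ) (basisVec μ)

theorem eta_symm (μ ν : Fin 4) : eta μ ν = eta ν μ := by
  by_cases h : μ = ν
  · rw [h]
  · simp [eta, h, Ne.symm h]

/-- The Yang–Mills equation and the Lévy trace contract the indices in opposite orders; the symmetry
of η reconciles them. -/
theorem divCurv_apply (A : Mink → Mink →L[ℝ] R) (x v : Mink) : divCurv A x v =
    ∑ μ, ∑ ν, eta μ ν • covCurv A x (basisVec μ) (basisVec ν) v := by
  rw [Finset.sum_comm]
  simp only [divCurv, sum_apply, covCurvL_apply, FunLike.coe_smul,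
    Pi.smul_apply, eta_symm]

theorem continuous_divCurv {A : Mink → Mink →L[ℝ] R} (hA : ContDiff ℝ ∞ A) :
    Continuous (divCurv A) := by
  have h1 := (contDiff_curvForm hA).continuous
  have h2 := (contDiff_curvForm hA).continuous_fderiv (by simp)
  have h3 : ∀ κ, Continuous fun x => A x (basisVec κ) := fun κ =>
    hA.continuous.clm_apply continuous_const
  have h4 : ∀ μ, Continuous fun x => curvForm A x (basisVec μ) := fun μ =>
    h1.clm_apply continuous_const
  have h5 : ∀ μ κ, Continuous fun x => covCurvL A x (basisVec κ) (basisVec μ) := fun μ κ =>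
    ((h2.clm_apply continuous_const).clm_apply continuous_const).add
      ((((actL (R := R)).continuous.comp (h3 κ)).clm_apply (h4 μ)).sub
        (((actR (R := R)).continuous.comp (h4 μ)).clm_apply (h3 κ)))
  exact continuous_finsetSum _ fun μ _ => continuous_finsetSum _ fun κ _ =>
    (h5 μ κ).const_smul (eta μ κ)

theorem integrable_conjL_form {A : C(Mink, Mink →L[ℝ] R)} {K : Mink → Mink →L[ℝ] R}
    (hK : Continuous K) (σ : Curve p) :
    Integrable (fun t => conjL A σ t (K (σ.val t) (σ.vel t))) leb :=
  integrable_clm_apply (φ := fun t => (conjL A σ t).comp (K (σ.val t)))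
    ((continuous_conjL σ).continuousOn.clm_comp
      (hK.comp_continuousOn σ.hasWeakDeriv.continuousOn)) σ.hasWeakDeriv.integrable

variable (hA : ∀ μ, ContDiff ℝ ∞ (A μ)) (hAsu : ∀ μ x, star (A μ x) = -A μ x)
include hAsu

theorem conjL_shrink (r : unitInterval) (σ : Curve p) {t : ℝ} (ht : t ∈ Icc (0 : ℝ) 1) :
    conjL (connC A hA) (Curve.shrink r σ) t = conjL (connC A hA) σ (r * t) := by
  have hrt : (r : ℝ) * t ∈ Icc (0 : ℝ) 1 :=
    ⟨mul_nonneg r.2.1 ht.1, mul_le_one₀ r.2.2 ht.1 ht.2⟩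
  have e : extendI (transportC (connC A hA) (Curve.shrink r σ)) t =
      extendI (transportC (connC A hA) σ) (r * t) := by
    rw [transportC_shrink, extendI, IccExtend_of_mem _ _ ht, extendI, IccExtend_of_mem _ _ hrt]
    rfl
  rw [conjL, conjL, e]

/-- Along σ^r the integral is that of the same integrand for σ over [0,r]. Its vanishing for all r
allows differentiation in r, and conjugation by a unitary is injective. -/
theorem eq_zero_of_integral_conjL_eq_zero {K : Mink → Mink →L[ℝ] R} (hK : Continuous K)
    (h : ∀ σ : Curve p, ∫ t, conjL (connC A hA) σ t (K (σ.val t) (σ.vel t)) ∂leb = 0)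
    (x v : Mink) : K x v = 0 := by
  -- A quadratic curve with f(0) = 0, f(1/2) = x and f'(1/2) = v. Time 1/2 is interior, so two-sided
  -- derivatives apply.
  let f : ℝ → Mink := fun t => (2 * t) • x + (t * (2 * t - 1)) • (v - (2 : ℝ) • x)
  have hf : ContDiff ℝ 1 f := by fun_prop
  have hf0 : f 0 = 0 := by simp [f]
  have hfd : HasDerivAt f v (1 / 2) := by
    have h1 : HasDerivAt (fun t : ℝ => 2 * t) 2 (1 / 2) := by
      simpa using (hasDerivAt_id (1 / 2 : ℝ)).const_mul 2
    have h2 : HasDerivAt (fun t : ℝ => t * (2 * t - 1)) 1 (1 / 2) := by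
      refine ((hasDerivAt_id (1 / 2 : ℝ)).mul (h1.sub_const 1)).congr_deriv ?_
      norm_num
    refine ((h1.smul_const x).add (h2.smul_const (v - (2 : ℝ) • x))).congr_deriv ?_
    module
  let σ := Curve.ofContDiff p hf hf0
  let g : ℝ → R := fun t => conjL (connC A hA) σ t (K (f t) (deriv f t))
  have hg : Continuous g := (continuous_conjL σ).clm_apply
    ((hK.comp hf.continuous).clm_apply (hf.continuous_deriv le_rfl))
  have hzero : ∀ r ∈ Icc (0 : ℝ) 1, ∫ s in (0 : ℝ)..r, g s = 0 := by
    intro r hr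
    have e := intervalIntegral.smul_integral_comp_mul_left (a := 0) (b := 1) g r
    rw [mul_zero, mul_one] at e
    rw [← e, ← intervalIntegral.integral_smul, ← integral_leb_eq, ← h (Curve.shrink ⟨r, hr⟩ σ)]
    refine integral_congr_ae ?_
    -- For r = 0 the times rt are not interior, so the velocity of σ there is not controlled; the
    -- velocity of σ^0 is 0.
    rcases hr.1.eq_or_lt with h0 | h0
    · filter_upwards [ae_leb_Ioo] with t ht
      rw [Curve.shrink_vel ⟨r, hr⟩ σ ht]
      simp [← h0]
    filter_upwards [ae_leb_Ioo] with t ht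
    have ht' : t ∈ Icc (0 : ℝ) 1 := ⟨ht.1.le, ht.2.le⟩
    have hrt : r * t ∈ Ioo (0 : ℝ) 1 :=
      ⟨mul_pos h0 ht.1, (mul_le_of_le_one_left ht.1.le hr.2).trans_lt ht.2⟩
    have hvel : σ.vel (r * t) = deriv f (r * t) := by
      have e : σ.val =ᶠ[𝓝 (r * t)] f := by
        filter_upwards [Ioo_mem_nhds hrt.1 hrt.2] with s hs
        exact Curve.ofContDiff_val hf hf0 ⟨hs.1.le, hs.2.le⟩
      exact e.deriv_eq
    rw [conjL_shrink hA hAsu _ _ ht', Curve.shrink_val _ _ ht', Curve.shrink_vel _ _ ht, map_smul,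
      map_smul]
    change r • g (r * t) = r • conjL (connC A hA) σ (r * t) (K (σ.val (r * t)) (σ.vel (r * t)))
    rw [hvel, Curve.ofContDiff_val hf hf0 ⟨hrt.1.le, hrt.2.le⟩]
  have hhalf : (1 / 2 : ℝ) ∈ Icc (0 : ℝ) 1 := by norm_num
  have hd := (hg.integral_hasStrictDerivAt 0 (1 / 2)).hasDerivAt
  have hd0 : HasDerivAt (fun u => ∫ s in (0 : ℝ)..u, g s) 0 (1 / 2) := by
    refine (hasDerivAt_const (1 / 2 : ℝ) (0 : R)).congr_of_eventuallyEq ?_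
    filter_upwards [Icc_mem_nhds (a := (0 : ℝ)) (b := 1) (x := 1 / 2) (by norm_num) (by norm_num)]
      with r hr using hzero r hr
  have hg0 : g (1 / 2) = 0 := hd.unique hd0
  have hx : f (1 / 2) = x := by
    simp only [f]
    module
  simp only [g, hx, hfd.deriv, conjL_apply] at hg0
  have h1 := holonomy_mul_star hA hAsu σ hhalf
  have h2 := congrArg (fun X => holonomy hA σ (1 / 2) * X * star (holonomy hA σ (1 / 2))) hg0
  simp only [mul_zero, zero_mul] at h2
  rw [← mul_assoc, h1, one_mul, mul_assoc, h1, mul_one] at h2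
  exact h2

end Current

/-! ### The Lévy d'Alembertian of the holonomy and the divergence of the curvature -/

section GaugeField

variable {R : Type} [NormedRing R] [NormedAlgebra ℝ R] [FiniteDimensional ℝ R] [CompleteSpace R]
  [StarRing R] [NormedStarGroup R] [StarModule ℝ R]
  {p : ℝ≥0∞} [Fact (1 ≤ p)] {A : Fin 4 → Mink → R}

theorem continuous_connForm (hA : ∀ μ, Continuous (A μ)) : Continuous (connForm A) :=
  continuous_finsetSum _ fun μ _ =>
    (ContinuousLinearMap.smulRightL ℝ Mink R (EuclideanSpace.proj μ)).continuous.comp (hA μ)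

variable (hA : ∀ μ, ContDiff ℝ ∞ (A μ)) (hAsu : ∀ μ x, star (A μ x) = -A μ x)
include hAsu

theorem map_integral_conjL (L : R →L[ℝ] R)
    (hL : ∀ U X : R, U * star U = 1 → L (star U * (X * U)) = star U * (L X * U))
    {K : Mink → Mink →L[ℝ] R} (hK : Continuous K) (σ : Curve p) :
    L (∫ t, conjL (connC A hA) σ t (K (σ.val t) (σ.vel t)) ∂leb) =
      ∫ t, conjL (connC A hA) σ t (L.comp (K (σ.val t)) (σ.vel t)) ∂leb := by
  rw [← L.integral_comp_comm (integrable_conjL_form hK σ)]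
  refine setIntegral_congr_fun measurableSet_Icc fun t ht => ?_
  exact hL _ _ (holonomy_mul_star hA hAsu σ ht)

/-- Uniqueness of the trace equates the given value with -U_1 ∫ U⁻¹(div F)(σ̇)U; cancelling U_1 and
moving L inside leaves a conjugated integral of div F + L∘K that vanishes along every curve.
Uniqueness enters as the hypothesis `huniq` because R is only a real algebra, while Riemann–Lebesgue
uses complex values. -/
theorem hasLevyDAlembertian_holonomy_iff (L : R →L[ℝ] R)
    (hL : ∀ U X : R, U * star U = 1 → L (star U * (X * U)) = star U * (L X * U))
    (huniq : ∀ (Q : Curve p →L[ℝ] Curve p →L[ℝ] R) (w w' : R),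
      HasLevyTrace Q w → HasLevyTrace Q w' → w = w')
    {K : Mink → Mink →L[ℝ] R} (hK : Continuous K) :
    HasLevyDAlembertian (fun σ : Curve p => holonomy hA σ 1) (fun σ => holonomy hA σ 1 *
        L (∫ t, conjL (connC A hA) σ t (K (σ.val t) (σ.vel t)) ∂leb)) ↔
      ∀ x v, divCurv (connForm A) x v = -L (K x v) := by
  have hC : ContDiff ℝ ∞ (connC A hA) := contDiff_connForm hA
  have hD : Continuous (divCurv (connForm A)) := continuous_divCurv (contDiff_connForm hA)
  have hLK : Continuous fun x => L.comp (K x) := continuous_const.clm_comp hK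
  have htrace : ∀ σ : Curve p, HasLevyTrace
      (fderiv ℝ (fderiv ℝ fun σ : Curve p => holonomy hA σ 1) σ)
      (-(holonomy hA σ 1 *
        ∫ t, conjL (connC A hA) σ t (divCurv (connForm A) (σ.val t) (σ.vel t)) ∂leb)) := by
    intro σ
    simp only [divCurv_apply]
    exact hasLevyTrace_transportC hC (star_connForm hAsu) σ
  constructor
  · intro h x v
    have hzero : ∀ σ : Curve p, ∫ t, conjL (connC A hA) σ t
        ((divCurv (connForm A) (σ.val t) + L.comp (K (σ.val t))) (σ.vel t)) ∂leb = 0 := by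
      intro σ
      have e : _ = holonomy hA σ 1 *
          L (∫ t, conjL (connC A hA) σ t (K (σ.val t) (σ.vel t)) ∂leb) :=
        huniq _ _ _ (htrace σ) (h.2 σ)
      rw [map_integral_conjL hA hAsu L hL hK, ← mul_neg] at e
      have e1 := congrArg (fun X => star (holonomy hA σ 1) * X) e
      simp only [← mul_assoc] at e1
      rw [star_holonomy_mul hA hAsu σ (by simp), one_mul, one_mul] at e1
      simp only [add_apply, map_add]
      rw [integral_add (integrable_conjL_form hD σ) (integrable_conjL_form hLK σ), ← e1]
      exact add_neg_cancel _
    have := eq_zero_of_integral_conjL_eq_zero hA hAsu (hD.add hLK) hzero x v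
    exact eq_neg_of_add_eq_zero_left this
  · intro h
    have hf : ContDiff ℝ ∞ fun σ : Curve p => holonomy hA σ 1 :=
      (evalAt 1).contDiff.comp (contDiff_transportC hC)
    refine ⟨hf.of_le (WithTop.coe_le_coe.2 le_top), fun σ => ?_⟩
    have e : holonomy hA σ 1 * L (∫ t, conjL (connC A hA) σ t (K (σ.val t) (σ.vel t)) ∂leb) =
        -(holonomy hA σ 1 *
          ∫ t, conjL (connC A hA) σ t (divCurv (connForm A) (σ.val t) (σ.vel t)) ∂leb) := by
      rw [map_integral_conjL hA hAsu L hL hK, ← mul_neg, ← integral_neg]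
      simp only [h, map_neg, neg_neg]
      rfl
    exact (congrArg (HasLevyTrace _) e).mpr (htrace σ)

end GaugeField

/-! ### Matrices -/

attribute [local instance] Matrix.frobeniusNormedAddCommGroup Matrix.frobeniusNormedSpace

/-- `M_N(ℂ)` as a normed algebra with the Frobenius norm. -/
def MatR (N : ℕ) : Type := Mat N

namespace MatR

attribute [local instance] Matrix.frobeniusNormedRing Matrix.frobeniusNormedAlgebra

variable {N : ℕ}

def instNormedRing : NormedRing (MatR N) := (Matrix.frobeniusNormedRing : NormedRing (Mat N))

attribute [instance] instNormedRing

def instNormedAlgebra : NormedAlgebra ℝ (MatR N) :=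
  (Matrix.frobeniusNormedAlgebra : NormedAlgebra ℝ (Mat N))

attribute [instance] instNormedAlgebra

def instStarRing : StarRing (MatR N) := (Matrix.instStarRing : StarRing (Mat N))

attribute [instance] instStarRing

instance : NormedStarGroup (MatR N) := (Matrix.frobenius_normedStarGroup : NormedStarGroup (Mat N))

instance : StarModule ℝ (MatR N) :=
  ⟨fun r X => Matrix.conjTranspose_smul r (show Mat N from X)⟩

instance : FiniteDimensional ℝ (MatR N) :=
  (inferInstance : FiniteDimensional ℝ (Matrix (Fin N) (Fin N) ℂ))

instance : CompleteSpace (MatR N) := FiniteDimensional.complete ℝ (MatR N)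

end MatR

/-- `ℂ^N ⊗ ℂ^4` with the Frobenius norm. -/
def SpinR (N : ℕ) : Type := Spinor N

namespace SpinR

variable {N : ℕ}

def instNormedAddCommGroup : NormedAddCommGroup (SpinR N) :=
  (Matrix.frobeniusNormedAddCommGroup : NormedAddCommGroup (Spinor N))

attribute [instance] instNormedAddCommGroup

def instNormedSpace : NormedSpace ℝ (SpinR N) :=
  (Matrix.frobeniusNormedSpace : NormedSpace ℝ (Spinor N))

attribute [instance] instNormedSpace

instance : FiniteDimensional ℝ (SpinR N) :=
  (inferInstance : FiniteDimensional ℝ (Matrix (Fin N) (Fin 4) ℂ))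

instance : CompleteSpace (SpinR N) := FiniteDimensional.complete ℝ (SpinR N)

end SpinR

/-! ### Matrix identities for spinors, currents and the projection to su(N) -/

section Algebra

variable {N : ℕ}

theorem colorAct_eq_mul (X : Mat N) (φ : Spinor N) : colorAct X φ = X * φ := rfl

/-- Spin matrices act on the right and colour matrices on the left, so the two actions commute by
associativity. -/
theorem spinAct_eq_mul (M : Matrix (Fin 4) (Fin 4) ℂ) (φ : Spinor N) :
    spinAct M φ = φ * Mᵀ := by
  ext a α
  simp [spinAct, Matrix.mul_apply, mul_comm]

theorem bilin_eq_mul (γ : Fin 4 → Matrix (Fin 4) (Fin 4) ℂ) (μ : Fin 4) (φ : Spinor N) :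
    bilin γ μ φ = φ * (lowerGamma γ 0 * lowerGamma γ μ)ᵀ * φᴴ := by
  rw [← spinAct_eq_mul]
  rfl

/-- The current has the form φ M φ*, so it transforms by X · X*. -/
theorem bilin_colorAct (γ : Fin 4 → Matrix (Fin 4) (Fin 4) ℂ) (μ : Fin 4) (X : Mat N)
    (φ : Spinor N) : bilin γ μ (colorAct X φ) = X * (bilin γ μ φ * Xᴴ) := by
  simp only [bilin_eq_mul, colorAct_eq_mul, Matrix.conjTranspose_mul, Matrix.mul_assoc]

theorem continuous_bilin (γ : Fin 4 → Matrix (Fin 4) (Fin 4) ℂ) (μ : Fin 4) :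
    Continuous fun φ : Spinor N => bilin γ μ φ := by
  simp only [bilin_eq_mul]
  exact (continuous_id.matrix_mul continuous_const).matrix_mul continuous_id.matrix_conjTranspose

/-- `X ↦ pr_{su(N)}(i X)` as a linear map. -/
def prSuILinear (N : ℕ) : Mat N →ₗ[ℝ] Mat N where
  toFun X := prSu (Complex.I • X)
  map_add' X Y := by
    simp only [prSu, smul_add, Matrix.trace_add, add_div, add_smul]
    abel
  map_smul' r X := by
    simp only [prSu, smul_sub, Matrix.trace_smul, smul_eq_mul, RingHom.id_apply]
    rw [smul_comm r Complex.I, ← smul_assoc r (_ / _)]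
    congr 2
    simp only [Complex.real_smul]
    ring

/-- `X ↦ pr_{su(N)}(i X)`. -/
def prSuI (N : ℕ) : MatR N →L[ℝ] MatR N :=
  LinearMap.toContinuousLinearMap (E := MatR N) (show MatR N →ₗ[ℝ] MatR N from prSuILinear N)

/-- Unitary conjugation preserves the trace and the identity matrix, which are all that the
projection involves. -/
theorem prSu_conj {U : Mat N} (hU : U * Uᴴ = 1) (X : Mat N) :
    prSu (Complex.I • (Uᴴ * (X * U))) = Uᴴ * (prSu (Complex.I • X) * U) := by
  have hU' : Uᴴ * U = 1 := mul_eq_one_comm.1 hU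
  have ht : (Uᴴ * (X * U)).trace = X.trace := by
    rw [Matrix.trace_mul_comm, Matrix.mul_assoc, hU, Matrix.mul_one]
  simp only [prSu, Matrix.trace_smul, ht, Matrix.sub_mul, Matrix.mul_sub, Matrix.smul_mul,
    Matrix.mul_smul, Matrix.one_mul, hU']

/-- The action of `M_N(ℂ)` on `ℂ^N ⊗ ℂ^4` as a bilinear map. -/
def colorLinear (N : ℕ) : Mat N →ₗ[ℝ] Spinor N →ₗ[ℝ] Spinor N :=
  LinearMap.mk₂ ℝ colorAct (fun X Y φ => Matrix.add_mul X Y φ) (fun r X φ => Matrix.smul_mul r X φ)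
    (fun X φ χ => Matrix.mul_add X φ χ) (fun r X φ => Matrix.mul_smul X r φ)

/-- The action of `M_N(ℂ)` on `ℂ^N ⊗ ℂ^4` as a continuous bilinear map. -/
def colorL (N : ℕ) : MatR N →L[ℝ] SpinR N →L[ℝ] SpinR N :=
  LinearMap.mkContinuous₂ (E := MatR N) (F := SpinR N) (G := SpinR N)
    (show MatR N →ₗ[ℝ] SpinR N →ₗ[ℝ] SpinR N from colorLinear N) 1 fun X φ => by
    rw [one_mul]
    exact Matrix.frobenius_norm_mul (show Mat N from X) (show Spinor N from φ)

theorem colorL_mul (X Y : MatR N) (φ : SpinR N) :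
    colorL N (X * Y) φ = colorL N X (colorL N Y φ) :=
  Matrix.mul_assoc (show Mat N from X) (show Mat N from Y) (show Spinor N from φ)

end Algebra

/-! ### Identification of the chosen transport with the holonomy -/

section Bridge

variable {N : ℕ} {p : ℝ≥0∞} [Fact (1 ≤ p)] {A : Fin 4 → Mink → Mat N}
  (hA : ∀ μ, ContDiff ℝ ∞ (A μ))

/-- The components of the gauge field as functions with values in `MatR N`. -/
def matField (A : Fin 4 → Mink → Mat N) : Fin 4 → Mink → MatR N := A

include hA in
theorem contDiff_matField (μ : Fin 4) : ContDiff ℝ ∞ (matField A μ) := hA μ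

theorem star_matField (hAsu : ∀ μ x, A μ x ∈ su N) (μ : Fin 4) (x : Mink) :
    star (matField A μ x) = -matField A μ x := (hAsu μ x).1

theorem connForm_matField (σ : Curve p) (t : ℝ) :
    connForm (matField A) (σ.val t) (σ.vel t) = connAlong A σ t := connForm_apply _ _ _

theorem isParallelTransport_iff {σ : Curve p} {U : ℝ → ℝ → Mat N} :
    IsParallelTransport A σ U ↔ IsTransport (R := MatR N) (connAlong A σ) U :=
  ⟨fun h => ⟨h.1, h.2, h.3, h.4, h.5⟩, fun h => ⟨h.1, h.2, h.3, h.4, h.5⟩⟩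

/-- The parallel transport `U_{t,0}(σ)` in the unitary group of `M_N(ℂ)`. -/
def matHolonomy (σ : Curve p) (t : ℝ) : Mat N :=
  holonomy (R := MatR N) (contDiff_matField hA) σ t

variable (hAsu : ∀ μ x, A μ x ∈ su N)
include hAsu

/-- The holonomy shows that a solution exists, so the one selected by `Classical.epsilon` is a
solution; uniqueness determines its value. -/
theorem transport_eq_matHolonomy (σ : Curve p) : transport A σ = matHolonomy hA σ 1 := by
  have h0 := isTransport_holonomy (contDiff_matField hA) (star_matField hAsu) σ
  have e : (fun t => connForm (matField A) (σ.val t) (σ.vel t)) = connAlong A σ :=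
    funext fun t => connForm_matField σ t
  have h1 : IsParallelTransport A σ (Classical.epsilon (IsParallelTransport A σ)) := by
    rw [e] at h0
    exact Classical.epsilon_spec (p := IsParallelTransport A σ) ⟨_, isParallelTransport_iff.2 h0⟩
  have h2 := isParallelTransport_iff.1 h1
  rw [← e] at h2
  exact IsTransport.eq_holonomy (contDiff_matField hA) (star_matField hAsu) h2 (t := 1) (by simp)

theorem matHolonomy_mul_conjTranspose (σ : Curve p) {t : ℝ} (ht : t ∈ Icc (0 : ℝ) 1) :
    matHolonomy hA σ t * (matHolonomy hA σ t)ᴴ = 1 :=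
  holonomy_mul_star (contDiff_matField hA) (star_matField hAsu) σ ht

theorem transportedSpinor_eq (ψ : Mink → Spinor N) (σ : Curve p) :
    transportedSpinor A ψ σ = colorAct (matHolonomy hA σ 1)ᴴ (ψ (σ.val 1)) := by
  rw [transportedSpinor, transport_eq_matHolonomy hA hAsu σ, Matrix.inv_eq_right_inv
    (matHolonomy_mul_conjTranspose hA hAsu σ (by simp))]

theorem transportedSpinor_shrink (ψ : Mink → Spinor N) (σ : Curve p) {r : ℝ}
    (hr : r ∈ Icc (0 : ℝ) 1) :
    transportedSpinor A ψ (Curve.shrink (projIcc 0 1 zero_le_one r) σ) =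
      colorAct (matHolonomy hA σ r)ᴴ (ψ (σ.val r)) := by
  have e : matHolonomy hA (Curve.shrink ⟨r, hr⟩ σ) 1 = matHolonomy hA σ r :=
    holonomy_shrink (contDiff_matField hA) ⟨r, hr⟩ σ
  rw [projIcc_of_mem _ hr, transportedSpinor_eq hA hAsu, Curve.shrink_val _ _ (by simp), mul_one, e]

end Bridge

/-! ### The Dirac and Yang–Mills equations -/

section Equations

variable {N : ℕ} {p : ℝ≥0∞} [Fact (1 ≤ p)] {A : Fin 4 → Mink → Mat N}
  (hA : ∀ μ, ContDiff ℝ ∞ (A μ)) (hAsu : ∀ μ x, A μ x ∈ su N)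
  {ψ : Mink → Spinor N} (hψ : ContDiff ℝ ∞ ψ) (γ : Fin 4 → Matrix (Fin 4) (Fin 4) ℂ)

include hAsu hψ in
theorem hasEndpointDeriv_transportedSpinor (μ : Fin 4) :
    HasEndpointDeriv (p := p) (basisVec μ) (transportedSpinor A ψ) fun σ =>
      colorAct (matHolonomy hA σ 1)ᴴ
        (pd μ ψ (σ.val 1) + colorAct (A μ (σ.val 1)) (ψ (σ.val 1))) := by
  let ψ' : Mink → SpinR N := ψ
  have hψ' : ContDiff ℝ ∞ ψ' := hψ
  have hC : ContDiff ℝ ∞ (connC (matField A) (contDiff_matField hA)) :=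
    contDiff_connForm (contDiff_matField hA)
  have e : transportedSpinor (p := p) A ψ =
      transportedSection (colorL N) (connC (matField A) (contDiff_matField hA)) ψ' := by
    funext σ
    rw [transportedSpinor_eq hA hAsu, ← endpointL_apply]
    rfl
  rw [e]
  have h1 : ContDiff ℝ 1
      (transportedSection (p := p) (colorL N) (connC (matField A) (contDiff_matField hA)) ψ') :=
    (contDiff_transportedSection (colorL N) hC hψ').of_le (WithTop.coe_le_coe.2 le_top)
  refine ⟨h1, fun σ => ?_⟩
  have h2 := hasEndpointValue_transportedSection (colorL N) hC hψ'
    (star_connForm (star_matField hAsu)) colorL_mul (basisVec μ) σ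
  have e2 : connC (matField A) (contDiff_matField hA) (σ.val 1) (basisVec μ) =
      matField A μ (σ.val 1) := connForm_basisVec _ _ _
  rw [e2, add_comm] at h2
  exact h2

theorem spinAct_colorAct (M : Matrix (Fin 4) (Fin 4) ℂ) (X : Mat N) (φ : Spinor N) :
    spinAct M (colorAct X φ) = colorAct X (spinAct M φ) := by
  simp only [spinAct_eq_mul, colorAct_eq_mul, Matrix.mul_assoc]

theorem sum_spinAct_colorAct (c : ℂ) (X : Mat N) (χ : Fin 4 → Spinor N) (φ : Spinor N) :
    ∑ μ, spinAct (γ μ) (colorAct X (χ μ)) + c • colorAct X φ =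
      colorAct X (∑ μ, spinAct (γ μ) (χ μ) + c • φ) := by
  simp only [spinAct_colorAct]
  simp only [colorAct_eq_mul, Matrix.mul_add, Matrix.mul_sum, Matrix.mul_smul]

include hA hAsu hψ in
-- Endpoint values are unique, so any admissible DΨ is the transported covariant derivative. The
-- equation at σ is then U_1⁻¹ applied to the Dirac equation at σ(1).
theorem dirac_equation_iff (p : ℝ≥0∞) [Fact (1 ≤ p)] (m : ℝ) :
    (∀ x, (∑ μ, spinAct (γ μ) (pd μ ψ x + colorAct (A μ x) (ψ x))) +
      (Complex.I * m) • ψ x = 0) ↔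
    ∃ DΨ : Fin 4 → Curve p → Spinor N,
      (∀ μ, HasEndpointDeriv (basisVec μ) (transportedSpinor A ψ) (DΨ μ)) ∧
      ∀ σ : Curve p, (∑ μ, spinAct (γ μ) (DΨ μ σ)) +
        (Complex.I * m) • transportedSpinor A ψ σ = 0 := by
  have hD := hasEndpointDeriv_transportedSpinor (p := p) hA hAsu hψ
  constructor
  · intro h
    refine ⟨_, hD, fun σ => ?_⟩
    rw [transportedSpinor_eq hA hAsu, sum_spinAct_colorAct, h]
    exact Matrix.mul_zero (matHolonomy hA σ 1)ᴴ
  · rintro ⟨DΨ, h1, h2⟩ x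
    -- The straight segment from the origin to x.
    let σ : Curve p := Curve.ofContDiff p (f := fun t => t • x)
      (contDiff_id.smul contDiff_const) (zero_smul ℝ x)
    have hσ : σ.val 1 = x := by
      rw [Curve.ofContDiff_val _ _ (by simp), one_smul]
    have h3 : ∀ μ, DΨ μ σ = colorAct (matHolonomy hA σ 1)ᴴ
        (pd μ ψ (σ.val 1) + colorAct (A μ (σ.val 1)) (ψ (σ.val 1))) := fun μ =>
      HasEndpointValue.unique (V := SpinR N) ((h1 μ).2 σ) ((hD μ).2 σ)
    have h4 := h2 σ
    simp only [h3] at h4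
    rw [transportedSpinor_eq hA hAsu, sum_spinAct_colorAct, hσ] at h4
    have h5 := congrArg (colorAct (matHolonomy hA σ 1)) h4
    rw [colorAct_eq_mul, colorAct_eq_mul, ← Matrix.mul_assoc,
      matHolonomy_mul_conjTranspose hA hAsu σ (by simp), Matrix.one_mul] at h5
    exact h5.trans (Matrix.mul_zero (matHolonomy hA σ 1))

/-- The components of the current `ψ̄ γ_ν ψ`. -/
def current (γ : Fin 4 → Matrix (Fin 4) (Fin 4) ℂ) (ψ : Mink → Spinor N) (ν : Fin 4) (x : Mink) :
    MatR N := bilin γ ν (ψ x)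

include hψ in
theorem continuous_current (ν : Fin 4) : Continuous (current γ ψ ν) :=
  (continuous_bilin γ ν).comp hψ.continuous

include hA in
theorem curv_eq_curvForm (μ ν : Fin 4) : curv A μ ν =
    fun x => curvForm (connForm (matField A)) x (basisVec μ) (basisVec ν) :=
  funext fun x => (curvForm_connForm (contDiff_matField hA) x μ ν).symm

include hA in
theorem covD_curv (κ μ ν : Fin 4) (x : Mink) : covD A κ (curv A μ ν) x =
    covCurv (connForm (matField A)) x (basisVec κ) (basisVec μ) (basisVec ν) := by
  rw [curv_eq_curvForm hA]
  exact (covCurv_connForm (contDiff_matField hA) x κ μ ν).symm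

include hA in
theorem divCurv_connForm_basisVec (x : Mink) (ν : Fin 4) :
    divCurv (connForm (matField A)) x (basisVec ν) =
      ∑ μ, ∑ κ, eta μ κ • covD A κ (curv A μ ν) x := by
  simp only [covD_curv hA]
  simp only [divCurv, sum_apply, FunLike.coe_smul, Pi.smul_apply, covCurvL_apply]
  rfl

include hA in
theorem yangMills_equation_iff :
    (∀ x ν, ∑ μ, ∑ κ, eta μ κ • covD A κ (curv A μ ν) x =
      -prSu (Complex.I • bilin γ ν (ψ x))) ↔
    ∀ x v, divCurv (connForm (matField A)) x v = -prSuI N (connForm (current γ ψ) x v) := by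
  constructor
  · intro h x v
    rw [map_eq_sum_basisVec (divCurv (connForm (matField A)) x) v,
      map_eq_sum_basisVec (connForm (current γ ψ) x) v, map_sum, ← Finset.sum_neg_distrib]
    refine Finset.sum_congr rfl fun ν _ => ?_
    rw [map_smul, ← smul_neg, connForm_basisVec, divCurv_connForm_basisVec hA]
    exact congrArg (fun X : MatR N => v ν • X) (h x ν)
  · intro h x ν
    have := h x (basisVec ν)
    rw [connForm_basisVec, divCurv_connForm_basisVec hA] at this
    exact this

include hAsu in
-- Along σ^r the transported spinor is U_{r,0}⁻¹ψ(σ(r)), so its current is the conjugate by U_{r,0}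
-- of the current of ψ at σ(r).
theorem integral_bilin_transportedSpinor (σ : Curve p) :
    ∫ r in Icc (0 : ℝ) 1, ∑ ν, σ.vel r ν • bilin γ ν (transportedSpinor A ψ
        (Curve.shrink (projIcc 0 1 zero_le_one r) σ)) =
      (∫ t, conjL (connC (matField A) (contDiff_matField hA)) σ t
        (connForm (current γ ψ) (σ.val t) (σ.vel t)) ∂leb : MatR N) := by
  refine setIntegral_congr_fun (E := MatR N) measurableSet_Icc fun t ht => ?_
  beta_reduce
  rw [connForm_apply, map_sum]
  refine Finset.sum_congr rfl fun ν _ => ?_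
  rw [map_smul]
  refine congrArg (fun X : MatR N => σ.vel t ν • X) ?_
  rw [transportedSpinor_shrink hA hAsu ψ σ ht, bilin_colorAct, Matrix.conjTranspose_conjTranspose]
  rfl

include hA hAsu hψ in
theorem yangMills_dAlembertian_iff :
    HasLevyDAlembertian (p := p) (fun σ => transport A σ) (fun σ => transport A σ *
      prSu (Complex.I • ∫ r in (Set.Icc (0 : ℝ) 1), ∑ ν, σ.vel r ν • bilin γ ν
        (transportedSpinor A ψ (Curve.shrink (projIcc 0 1 zero_le_one r) σ)))) ↔
    ∀ x ν, ∑ μ, ∑ κ, eta μ κ • covD A κ (curv A μ ν) x =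
      -prSu (Complex.I • bilin γ ν (ψ x)) := by
  -- Uniqueness is taken from `Mat N`, which carries the complex structure that `MatR N` was not
  -- given.
  have huniq : ∀ (Q : Curve p →L[ℝ] Curve p →L[ℝ] MatR N) (w w' : MatR N),
      HasLevyTrace Q w → HasLevyTrace Q w' → w = w' := fun Q w w' h h' =>
    HasLevyTrace.unique (F := Mat N) h h'
  have key := hasLevyDAlembertian_holonomy_iff (p := p) (contDiff_matField hA)
    (star_matField hAsu) (prSuI N) (fun U X hU => prSu_conj (U := U) hU X) huniq
    (continuous_connForm (continuous_current hψ γ))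
  rw [yangMills_equation_iff hA γ, ← key]
  have e1 : (fun σ : Curve p => transport A σ) = fun σ =>
      holonomy (R := MatR N) (contDiff_matField hA) σ 1 :=
    funext fun σ => transport_eq_matHolonomy hA hAsu σ
  simp only [integral_bilin_transportedSpinor hA hAsu γ]
  simp only [transport_eq_matHolonomy hA hAsu]
  exact Iff.rfl

end Equations

end LevyYM

end

theorem mainTheorem5 (N : ℕ) (p : ENNReal) [Fact (1 ≤ p)] (hp : p = 1 ∨ p = 2)
    (γ : Fin 4 → Matrix (Fin 4) (Fin 4) ℂ) (hγ : LevyYM.IsDirac γ) (m : ℝ)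
    (A : Fin 4 → LevyYM.Mink → LevyYM.Mat N)
    (hA : ∀ μ, ContDiff ℝ ∞ (A μ)) (hAsu : ∀ μ x, A μ x ∈ LevyYM.su N)
    (ψ : LevyYM.Mink → LevyYM.Spinor N) (hψ : ContDiff ℝ ∞ ψ) :
    LevyYM.IsYangMillsDirac γ m A ψ ↔
      (∃ DΨ : Fin 4 → LevyYM.Curve p → LevyYM.Spinor N,
        (∀ μ, LevyYM.HasEndpointDeriv (LevyYM.basisVec μ)
          (LevyYM.transportedSpinor A ψ) (DΨ μ)) ∧
        ∀ σ : LevyYM.Curve p, (∑ μ, LevyYM.spinAct (γ μ) (DΨ μ σ)) +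
          (Complex.I * m) • LevyYM.transportedSpinor A ψ σ = 0) ∧
      LevyYM.HasLevyDAlembertian (p := p) (fun σ => LevyYM.transport A σ)
        (fun σ => LevyYM.transport A σ *
          LevyYM.prSu (Complex.I • ∫ r in (Set.Icc (0 : ℝ) 1), ∑ ν,
            σ.vel r ν • LevyYM.bilin γ ν (LevyYM.transportedSpinor A ψ
              (LevyYM.Curve.shrink (Set.projIcc 0 1 zero_le_one r) σ)))) :=
  and_congr (LevyYM.dirac_equation_iff hA hAsu hψ γ p m)
    (LevyYM.yangMills_dAlembertian_iff (p := p) hA hAsu hψ γ).symm
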